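/- Let $\omega_1,\omega_2\in\mathbb{C}$ be linearly independent over $\mathbb{R}$, let $\Lambda=\mathbb{Z}\omega_1+\mathbb{Z}\omega_2$, and let $T=\mathbb{C}/\Lambda$ be the corresponding flat torus. A solution of $$\triangle u+4\pi e^{u}=4\pi\delta_0\quad\text{on }T \tag{$*$}$$ is a function $u$ on $T$ (that is, a $\Lambda$-periodic function on $\mathbb{C}$) such that $u$ and $e^u$ are integrable on $T$ and $\int_T (u\,\triangle\varphi+4\pi e^u\varphi)\,dA=4\pi\varphi(0)$ for every $\varphi\in C^\infty(T)$. Theorem. Equation $(*)$ has exactly one solution $u$ (up to equality almost everywhere). It is smooth on $T\setminus\{0\}$, and it is even: $u(-z)=u(z)$. Moreover, its developing maps are as follows. Call a meromorphic function $F$ on $\mathbb{C}$ a developing map of $u$ with constant $c\in\mathbb{R}$ if $u=c+\log\frac{|F'|^2}{(1+|F|^2)^2}$ at all points outside $\Lambda$ that are not poles of $F$. Let $\sigma$ be the Weierstrass $\sigma$ function of the lattice $\mathbb{Z}\omega_1+\mathbb{Z}2\omega_2$ (that is, of the double torus), and put $$a=-\tfrac{\omega_1}{2},\qquad b=\tfrac{\omega_1}{2}+\omega_2,\qquad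 r=\frac{\sigma(\frac12\omega_1)\,\sigma(\frac12\omega_1+\omega_2)}{\sigma(\omega_1+\omega_2)},\qquad g(z)=\frac1r\,\frac{\sigma(z)\,\sigma(z-\omega_2)}{\sigma(z-a)\,\sigma(z-b)} .$$ (1) There is a meromorphic function $f$ on $\mathbb{C}$ with $f'/f=g$ and $|f(0)f(\omega_2)|=1$ (in particular $f$ is regular and non-zero at $0$ and $\omega_2$), and the functions with these properties are exactly the $kf$ with $k\in\mathbb{C}$, $|k|=1$. (2) $f$ is a developing map of $u$ with constant $\log(2/\pi)$, i.e. $u=\log\frac{2}{\pi}+\log\frac{|f'|^2}{(1+|f|^2)^2}$, and $f(z+\omega_1)=-f(z)$ and $f(z+\omega_2)=\dfrac{f(0)f(\omega_2)}{f(z)}$. (3) Every developing map $F$ of $u$, with any constant $c$, has $c=\log(2/\pi)$ and is of the form $F=\dfrac{pf-\bar q}{qf+\bar p}$ with $p,q\in\mathbb{C}$, $|p|^2+|q|^2=1$. (4) The developing maps $F$ of $u$ (with constant $\log(2/\pi)$) for which $F(z+\omega_1)=-F(z)$ and $F(z+\omega_2)=c'/F(z)$ for some constant $c'$ with $|c'|=1$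 are exactly the functions $kf$ and $k/f$ with $|k|=1$. -/

import Mathlib

open scoped ContDiff Laplacian

noncomputable section

namespace MeanField

/-- A function on the plane is `Λ`-periodic, i.e. a function on the torus `ℂ / Λ`. -/
def IsPeriodic (L : PeriodPair) (u : ℂ → ℝ) : Prop :=
  ∀ l ∈ L.lattice, ∀ z, u (z + l) = u z

/-- A period parallelogram `{s ω₁ + t ω₂ | 0 ≤ s, t < 1}` of the torus. -/
def cell (L : PeriodPair) : Set ℂ := ZSpan.fundamentalDomain L.basis

/-- `u` solves `Δ u + ρ e ^ u = ρ δ₀` on the torus `ℂ / Λ` in the sense of distributions: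
`u` and `e ^ u` are integrable on the torus, and the equation holds when tested against every smooth
function on the torus. -/
structure IsSolution (L : PeriodPair) (ρ : ℝ) (u : ℂ → ℝ) : Prop where
  periodic : IsPeriodic L u
  locallyIntegrable : MeasureTheory.LocallyIntegrable u MeasureTheory.volume
  locallyIntegrable_exp :
    MeasureTheory.LocallyIntegrable (fun z => Real.exp (u z)) MeasureTheory.volume
  weak : ∀ φ : ℂ → ℝ, ContDiff ℝ ∞ φ → IsPeriodic L φ →
    ∫ z in cell L, (u z * Δ φ z + ρ * Real.exp (u z) * φ z) = ρ * φ 0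

/-- The Weierstrass sigma function of the lattice `Λ`, as the canonical product
`z ∏ (1 - z / l) exp (z / l + z² / (2 l²))` over the nonzero lattice points `l`. -/
def sigma (L : PeriodPair) (z : ℂ) : ℂ :=
  z * ∏' l : {l : L.lattice // l ≠ 0},
    ((1 - z / (l.1 : ℂ)) * Complex.exp (z / (l.1 : ℂ) + (z / (l.1 : ℂ)) ^ 2 / 2))

/-- The periods `ω₁, 2 ω₂` of the double torus. -/
def double (L : PeriodPair) : PeriodPair where
  ω₁ := L.ω₁
  ω₂ := 2 * L.ω₂
  indep := by
    rw [LinearIndependent.pair_iff]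
    intro s t h
    have := LinearIndependent.pair_iff.mp L.indep s (2 * t) (by
      rw [← h]
      simp only [Complex.real_smul]
      push_cast
      ring)
    exact ⟨this.1, by linarith [this.2]⟩

/-- The number `r = σ(ω₁/2) σ(ω₁/2 + ω₂) / σ(ω₁ + ω₂)`, with `σ` that of the double torus. -/
def sigmaConst (L : PeriodPair) : ℂ :=
  sigma (double L) (L.ω₁ / 2) * sigma (double L) (L.ω₁ / 2 + L.ω₂) /
    sigma (double L) (L.ω₁ + L.ω₂)

/-- The elliptic function `r⁻¹ σ(z) σ(z - ω₂) / (σ(z - a) σ(z - b))` on the double torus, where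
`a = - ω₁ / 2` and `b = ω₁ / 2 + ω₂`. -/
def sigmaQuotient (L : PeriodPair) (z : ℂ) : ℂ :=
  (sigmaConst L)⁻¹ * (sigma (double L) z * sigma (double L) (z - L.ω₂)) /
    (sigma (double L) (z - (-(L.ω₁ / 2))) * sigma (double L) (z - (L.ω₁ / 2 + L.ω₂)))

/-- `f` is meromorphic on `ℂ` (with value `0` at its poles and no removable singularities),
`f' / f` is the quotient of sigma functions above, and `|f(0) f(ω₂)| = 1`. -/
structure IsSigmaMap (L : PeriodPair) (f : ℂ → ℂ) : Prop where
  meromorphic : MeromorphicNFOn f Set.univ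
  logDeriv_eq : logDeriv f =ᶠ[Filter.codiscrete ℂ] sigmaQuotient L
  norm_eq : ‖f 0 * f L.ω₂‖ = 1

/-- `f` is a developing map of `u` with constant `c`: it is meromorphic on `ℂ` and
`u = c + log (|f'|² / (1 + |f|²)²)`, written here in exponential form, away from the lattice and from
the poles of `f`. -/
structure IsDevelopingMap (L : PeriodPair) (c : ℝ) (u : ℂ → ℝ) (f : ℂ → ℂ) : Prop where
  meromorphic : MeromorphicNFOn f Set.univ
  exp_eq : ∀ z, z ∉ L.lattice → AnalyticAt ℂ f z →
    Real.exp (u z) = Real.exp c * (‖deriv f z‖ ^ 2 / (1 + ‖f z‖ ^ 2) ^ 2)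

/-- The monodromy is in normal form: `f (z + ω₁) = - f z` and `f (z + ω₂) = c / f z` with `|c| = 1`.
For functions in normal form (value `0` at a pole) the identities make sense at every point. -/
def HasNormalMonodromy (L : PeriodPair) (f : ℂ → ℂ) : Prop :=
  (∀ z, f (z + L.ω₁) = -f z) ∧ ∃ c : ℂ, ‖c‖ = 1 ∧ ∀ z, f (z + L.ω₂) = c / f z

end MeanField

end

/-!
A developing map of a solution of the mean field equation pulls the round metric of the sphere back
to the conformal metric `e ^ u |dz|²`, and it is determined by `u` up to rotations. At `ρ = 4π` the
metric has a single cone point, of angle `4π`, so that a developing map is branched, simply, exactly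
over the lattice.

*Existence.* A residue computation with the sigma function of the double torus writes the given
elliptic function as a logarithmic derivative `f' / f` with `f = A / B`, where `A` and `B` are
entire with simple zeros on the two cosets of the double lattice through `a` and `b`
(`exists_isDevelopingPair`). The logarithmic derivative is odd, `ω₁`-periodic and `ω₂`-antiperiodic,
whence `f` is even, `f (z + ω₁) = - f z` and `f (z + ω₂) = 1 / f z`. These are rotations of the
sphere, so the conformal factor `(2 / π) |f'|² / (1 + |f|²)²` is even and elliptic. Written as
`(2 / π) |W|² / (|A|² + |B|²)²`, with `W` the Wronskian of `A` and `B`, it is smooth with zeros of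
order two on the lattice only, and its logarithm is a solution
(`IsDevelopingPair.isSolution_log_conformalFactor`) because `log |W|` has Laplacian `2π δ` at each
lattice point. Distributional statements on the torus are transferred to the plane by
periodization of test functions (`IsSolution.integral_test`, `isSolution_of_integral_test`).

*Uniqueness.* Let `v` be a solution and `u` the explicit one. The difference `v - u` satisfies
`Δ θ = - U (e ^ θ - 1)` weakly with a smooth `U ≥ 0` and is therefore smooth
(`exists_contDiff_of_integral_test`; the starting point is that `e ^ θ` is locally square
integrable, by Jensen's inequality for a logarithmic potential of small mass). Then
`w = e ^ (-θ / 2) (|A|² + |B|²)` solves `w w_{z z̄} - w_z w_{z̄} = |W|²`, so that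
`(W w_{z z} - W' w_z) / w` is entire (`differentiable_schwarzian`). Its difference from the same
expression for `|A|² + |B|²` is, divided by `W`, an elliptic function with at most simple poles on
the lattice which, because of the behaviour of `f` under `ω₂`, is a constant; the vanishing of `W`
at `0` makes the constant zero (`IsDevelopingPair.linear_equation`). So `w` solves the linear
equation of which `A` and `B` are a basis of holomorphic solutions, i.e. `w` is a Hermitian form in
`A` and `B` (`exists_wronskian_const`). As `w / (|A|² + |B|²)` is elliptic, the transformation
`f ↦ -f` removes the cross terms and `f ↦ 1 / f` makes the two diagonal coefficients equal
(`IsDevelopingPair.hermitian_form_const`): `θ` is constant, and by its equation `θ = 0`.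

*Developing maps.* If `F` is another developing map, a local square root of `W / F'` gives a pair
`P`, `Q` with `F = P / Q`, the same Wronskian as `A`, `B`, and `|P|² + |Q|²` proportional to
`|A|² + |B|²`. The matrix that expresses `P`, `Q` in terms of `A`, `B` is both holomorphic and
antiholomorphic, hence constant, and it is special unitary
(`exists_unitary_of_pairNorm_eq`). The identity theorem for meromorphic functions extends
the resulting Möbius relation to the plane.
-/

noncomputable section
namespace MeanField

open Filter Topology

/-! ### The Weierstrass sigma function -/

/-- The Weierstrass primary factor of genus two. -/
def primaryFactor (x : ℂ) : ℂ := (1 - x) * Complex.exp (x + x ^ 2 / 2)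

lemma norm_primaryFactor_sub_one_le {x : ℂ} (hx : ‖x‖ ≤ 1 / 2) :
    ‖primaryFactor x - 1‖ ≤ 2 * ‖x‖ ^ 3 := by
  have hx1 : ‖-x‖ < 1 := by rw [norm_neg]; linarith
  have h1 := Complex.norm_log_sub_logTaylor_le 2 hx1
  set y : ℂ := Complex.log (1 + -x) - Complex.logTaylor (2 + 1) (-x) with hy
  have hne : (1 : ℂ) + -x ≠ 0 := by
    intro h
    have : x = 1 := by linear_combination -h
    rw [this] at hx; norm_num at hx
  have hE : primaryFactor x = Complex.exp y := by
    have : Complex.logTaylor (2 + 1) (-x) = -(x + x ^ 2 / 2) := by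
      simp [Complex.logTaylor_succ, Complex.logTaylor_zero]; ring
    rw [hy, this, Complex.exp_sub, Complex.exp_log hne, primaryFactor, Complex.exp_neg]
    field_simp
    ring
  have hyb : ‖y‖ ≤ ‖x‖ ^ 3 := by
    refine h1.trans ?_
    rw [norm_neg]
    have h2 : (1 - ‖x‖)⁻¹ ≤ 2 := by
      rw [inv_le_comm₀ (by linarith) (by norm_num)]; linarith
    have h3 : 0 ≤ ‖x‖ ^ 3 := by positivity
    norm_num
    nlinarith
  have hy1 : ‖y‖ ≤ 1 := hyb.trans (pow_le_one₀ (norm_nonneg _) (by linarith))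
  rw [hE]
  exact (Complex.norm_exp_sub_one_le hy1).trans (by linarith)

lemma primaryFactor_eq_zero_iff {x : ℂ} : primaryFactor x = 0 ↔ x = 1 := by
  rw [primaryFactor, mul_eq_zero, or_iff_left (Complex.exp_ne_zero _), sub_eq_zero, eq_comm]

lemma differentiable_primaryFactor : Differentiable ℂ primaryFactor := by
  unfold primaryFactor; fun_prop

variable (L : PeriodPair)

lemma summable_norm_lattice_pow : Summable fun l : {l : L.lattice // l ≠ 0} =>
    ‖(l.1 : ℂ)‖ ^ (-3 : ℝ) :=
  (ZLattice.summable_norm_rpow (L := L.lattice) (-3) (by simp; norm_num)).subtype _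

lemma eventually_norm_lattice_ge (R : ℝ) :
    ∀ᶠ l : {l : L.lattice // l ≠ 0} in cofinite, R ≤ ‖(l.1 : ℂ)‖ := by
  have h1 : ∀ᶠ l : L.lattice in cofinite, R ≤ ‖(l : ℂ)‖ := by
    refine (isCompact_iff_finite.mp (isCompact_closedBall (0 : L.lattice) R)).subset ?_
    intro l hl
    simp only [Set.mem_compl_iff, Set.mem_ofPred_eq, not_le] at hl
    simpa using hl.le
  exact Subtype.val_injective.tendsto_cofinite.eventually h1

lemma eventually_norm_primaryFactor_le (r : ℝ) (hr : 0 < r) :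
    ∀ᶠ l : {l : L.lattice // l ≠ 0} in cofinite, ∀ z : ℂ, ‖z‖ ≤ r →
      ‖primaryFactor (z / (l.1 : ℂ)) - 1‖ ≤ 2 * r ^ 3 * ‖(l.1 : ℂ)‖ ^ (-3 : ℝ) := by
  filter_upwards [eventually_norm_lattice_ge L (2 * r)] with l hl z hz
  have hl0 : 0 < ‖(l.1 : ℂ)‖ := by linarith
  have h1 : ‖z / (l.1 : ℂ)‖ ≤ 1 / 2 := by
    rw [norm_div, div_le_div_iff₀ hl0 (by norm_num)]; linarith
  refine (norm_primaryFactor_sub_one_le h1).trans ?_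
  have h3 : ‖(l.1 : ℂ)‖ ^ (-3 : ℝ) = (‖(l.1 : ℂ)‖ ^ 3)⁻¹ := by
    rw [Real.rpow_neg hl0.le]; norm_cast
  rw [h3, norm_div, div_pow, mul_assoc, ← div_eq_mul_inv]
  gcongr

/-- The finite partial products of the sigma function. -/
def sigmaPartial (S : Finset {l : L.lattice // l ≠ 0}) (z : ℂ) : ℂ :=
  z * ∏ l ∈ S, primaryFactor (z / (l.1 : ℂ))

lemma tendstoLocallyUniformlyOn_sigmaPartial :
    TendstoLocallyUniformlyOn (sigmaPartial L) (sigma L) atTop Set.univ := by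
  have h : HasProdLocallyUniformlyOn
      (fun (l : {l : L.lattice // l ≠ 0}) (z : ℂ) => 1 + (primaryFactor (z / (l.1 : ℂ)) - 1))
      (fun z => ∏' l : {l : L.lattice // l ≠ 0}, (1 + (primaryFactor (z / (l.1 : ℂ)) - 1)))
      Set.univ := by
    refine hasProdLocallyUniformlyOn_of_forall_compact isOpen_univ fun K _ hK => ?_
    obtain ⟨r, hr⟩ := hK.isBounded.exists_norm_le
    refine Summable.hasProdUniformlyOn_one_add hK
      ((summable_norm_lattice_pow L).mul_left (2 * (max r 1) ^ 3)) ?_ ?_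
    · filter_upwards [eventually_norm_primaryFactor_le L (max r 1) (by positivity)] with l hl z hz
      exact hl z ((hr z hz).trans (le_max_left _ _))
    · intro l
      have := differentiable_primaryFactor.continuous
      fun_prop
  rw [hasProdLocallyUniformlyOn_iff_tendstoLocallyUniformlyOn] at h
  have h2 : TendstoLocallyUniformlyOn (fun (_ : Finset {l : L.lattice // l ≠ 0}) (z : ℂ) => z)
      (fun z => z) atTop Set.univ := by
    intro u hu x _
    exact ⟨Set.univ, univ_mem, Eventually.of_forall fun _ _ _ => refl_mem_uniformity hu⟩
  have h3 := h2.mul₀ h continuous_id.continuousOn ?_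
  · refine (h3.congr_right ?_).congr ?_
    · intro z _
      simp [sigma, primaryFactor]
    · refine fun S z _ => ?_
      simp [sigmaPartial]
  · refine h.continuousOn (Frequently.of_forall fun S => ?_)
    have := differentiable_primaryFactor.continuous
    fun_prop

lemma differentiable_sigmaPartial (S : Finset {l : L.lattice // l ≠ 0}) :
    Differentiable ℂ (sigmaPartial L S) := by
  have := differentiable_primaryFactor
  unfold sigmaPartial; fun_prop

lemma differentiable_sigma : Differentiable ℂ (sigma L) := by
  rw [← differentiableOn_univ]
  exact (tendstoLocallyUniformlyOn_sigmaPartial L).differentiableOn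
    (Eventually.of_forall fun S => (differentiable_sigmaPartial L S).differentiableOn) isOpen_univ

lemma sigma_eq (z : ℂ) :
    sigma L z = z * ∏' l : {l : L.lattice // l ≠ 0}, primaryFactor (z / (l.1 : ℂ)) := rfl

lemma multipliable_primaryFactor (z : ℂ) :
    Summable fun l : {l : L.lattice // l ≠ 0} => ‖primaryFactor (z / (l.1 : ℂ)) - 1‖ := by
  refine ((summable_norm_lattice_pow L).mul_left (2 * (‖z‖ + 1) ^ 3)).of_norm_bounded_eventually ?_
  filter_upwards [eventually_norm_primaryFactor_le L (‖z‖ + 1) (by positivity)] with l hl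
  rw [norm_norm]
  exact hl z (by linarith)

lemma sigma_eq_zero_iff {z : ℂ} : sigma L z = 0 ↔ z ∈ L.lattice := by
  constructor
  · intro h
    by_contra hz
    rw [sigma_eq, mul_eq_zero] at h
    rcases h with h | h
    · exact hz (h ▸ zero_mem _)
    · have := tprod_one_add_ne_zero_of_summable
        (f := fun l : {l : L.lattice // l ≠ 0} => primaryFactor (z / (l.1 : ℂ)) - 1)
        (fun l h' => ?_) (multipliable_primaryFactor L z)
      · simp only [add_sub_cancel] at this
        exact this h
      · rw [add_sub_cancel, primaryFactor_eq_zero_iff] at h'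
        have hl : (l.1 : ℂ) ≠ 0 := by simpa using l.2
        rw [div_eq_one_iff_eq hl] at h'
        exact hz (h' ▸ l.1.2)
  · intro h
    by_cases hz : z = 0
    · simp [sigma, hz]
    · rw [sigma_eq]
      have hne : (⟨z, h⟩ : L.lattice) ≠ 0 := by simpa [Subtype.ext_iff] using hz
      have : HasProd (fun l : {l : L.lattice // l ≠ 0} => primaryFactor (z / (l.1 : ℂ))) 0 := by
        refine tendsto_const_nhds.congr' ?_
        filter_upwards [eventually_ge_atTop {⟨⟨z, h⟩, hne⟩}] with S hS
        symm
        refine Finset.prod_eq_zero (i := ⟨⟨z, h⟩, hne⟩) (hS (Finset.mem_singleton_self _)) ?_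
        rw [primaryFactor_eq_zero_iff, div_self hz]
      rw [this.tprod_eq, mul_zero]

lemma sigma_neg (z : ℂ) : sigma L (-z) = -sigma L z := by
  rw [sigma_eq, sigma_eq, neg_mul]
  congr 2
  let e : {l : L.lattice // l ≠ 0} ≃ {l : L.lattice // l ≠ 0} :=
    (Equiv.neg L.lattice).subtypeEquiv (by simp)
  rw [← e.tprod_eq]
  congr 1
  ext l
  simp [e, neg_div_neg_eq]

lemma deriv_sigma_zero : deriv (sigma L) 0 = 1 := by
  have h1 : HasDerivAt (sigma L) (deriv (sigma L) 0) 0 := (differentiable_sigma L 0).hasDerivAt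
  have h := (tendstoLocallyUniformlyOn_sigmaPartial L).deriv
    (Eventually.of_forall fun S => (differentiable_sigmaPartial L S).differentiableOn) isOpen_univ
  have h2 := h.tendsto_at (Set.mem_univ 0)
  refine tendsto_nhds_unique h2 (tendsto_const_nhds.congr fun S => ?_)
  simp only [Function.comp]
  have hd : DifferentiableAt ℂ (fun z : ℂ => ∏ l ∈ S, primaryFactor (z / (l.1 : ℂ))) 0 := by
    have := differentiable_primaryFactor
    fun_prop
  have := ((hasDerivAt_id (0 : ℂ)).mul hd.hasDerivAt).deriv
  refine Eq.trans ?_ this.symm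
  simp [primaryFactor]

/-- On a connected open set, two nonvanishing holomorphic functions with the same logarithmic
derivative are proportional. -/
lemma exists_eq_const_mul_of_deriv_mul_eq {V : Set ℂ} (hV : IsOpen V) (hc : IsPreconnected V)
    {F G : ℂ → ℂ} (hF : DifferentiableOn ℂ F V) (hG : DifferentiableOn ℂ G V)
    (hG0 : ∀ z ∈ V, G z ≠ 0) (h : ∀ z ∈ V, deriv F z * G z = F z * deriv G z) :
    ∃ k : ℂ, ∀ z ∈ V, F z = k * G z := by
  rcases V.eq_empty_or_nonempty with rfl | ⟨x, hx⟩
  · exact ⟨0, by simp⟩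
  refine ⟨F x / G x, fun z hz => ?_⟩
  have := hV.is_const_of_deriv_eq_zero hc (f := fun z => F z / G z) (hF.div hG hG0) ?_ hx hz
  · rw [this, div_mul_cancel₀ _ (hG0 z hz)]
  · intro y hy
    have h1 := (hF.differentiableAt (hV.mem_nhds hy)).hasDerivAt
    have h2 := (hG.differentiableAt (hV.mem_nhds hy)).hasDerivAt
    have := (h1.fun_div h2 (hG0 y hy)).deriv
    rw [this, h y hy]
    simp

lemma countable_lattice : (L.lattice : Set ℂ).Countable := by
  have : Countable L.lattice := by
    have := L.latticeEquivProd.toEquiv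
    exact this.injective.countable
  exact Set.to_countable _

lemma isPreconnected_compl_lattice : IsPreconnected ((L.lattice : Set ℂ)ᶜ) := by
  refine ((countable_lattice L).isConnected_compl_of_one_lt_rank ?_).isPreconnected
  rw [Complex.rank_real_complex]; norm_num

lemma isOpen_compl_lattice : IsOpen ((L.lattice : Set ℂ)ᶜ) := L.isClosed_lattice.isOpen_compl

lemma dense_compl_lattice : Dense ((L.lattice : Set ℂ)ᶜ) :=
  (countable_lattice L).dense_compl ℝ

lemma hasDerivAt_primaryFactor_div {l z : ℂ} (hl : l ≠ 0) (hz : z ≠ l) :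
    logDeriv (fun z => primaryFactor (z / l)) z = 1 / (z - l) + 1 / l + z / l ^ 2 := by
  have h1 : HasDerivAt (fun z => primaryFactor (z / l))
      ((0 - 1 / l) * Complex.exp (z / l + (z / l) ^ 2 / 2) + (1 - z / l) *
        (Complex.exp (z / l + (z / l) ^ 2 / 2) * (1 / l + (2 * (z / l) ^ (2 - 1) * (1 / l)) / 2)))
      z := by
    have hd : HasDerivAt (fun z : ℂ => z / l) (1 / l) z := (hasDerivAt_id z).div_const l
    exact ((hasDerivAt_const z (1 : ℂ)).sub hd).mul
      ((hd.add (((hd.pow 2)).div_const 2)).cexp)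
  rw [logDeriv_apply, h1.deriv, primaryFactor]
  have h2 := Complex.exp_ne_zero (z / l + (z / l) ^ 2 / 2)
  have h3 : z - l ≠ 0 := sub_ne_zero.mpr hz
  have h4 : 1 - z / l ≠ 0 := by
    rw [sub_ne_zero, ne_comm, Ne, div_eq_one_iff_eq hl]; exact hz
  have h5 : l - z ≠ 0 := sub_ne_zero.mpr hz.symm
  have h6 : 1 - z / l = -(z - l) / l := by field_simp; ring
  rw [h6]
  simp only [Nat.add_one_sub_one, pow_one]
  generalize Complex.exp (z / l + (z / l) ^ 2 / 2) = e at h2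
  field_simp
  ring

lemma sigmaPartial_ne_zero (S : Finset {l : L.lattice // l ≠ 0}) {z : ℂ} (hz : z ∉ L.lattice) :
    sigmaPartial L S z ≠ 0 := by
  refine mul_ne_zero (fun h => hz (h ▸ zero_mem _)) (Finset.prod_ne_zero_iff.mpr fun l _ h => ?_)
  have hl : (l.1 : ℂ) ≠ 0 := by simpa using l.2
  rw [primaryFactor_eq_zero_iff, div_eq_one_iff_eq hl] at h
  exact hz (h ▸ l.1.2)

lemma logDeriv_sigmaPartial (S : Finset {l : L.lattice // l ≠ 0}) {z : ℂ} (hz : z ∉ L.lattice) :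
    logDeriv (sigmaPartial L S) z =
      1 / z + ∑ l ∈ S, (1 / (z - (l.1 : ℂ)) + 1 / (l.1 : ℂ) + z / (l.1 : ℂ) ^ 2) := by
  have hz0 : z ≠ 0 := fun h => hz (h ▸ zero_mem _)
  have hp := differentiable_primaryFactor
  have hne : ∀ l ∈ S, primaryFactor (z / (l.1 : ℂ)) ≠ 0 := by
    have := right_ne_zero_of_mul (sigmaPartial_ne_zero L S hz)
    exact Finset.prod_ne_zero_iff.mp this
  have h1 : logDeriv (sigmaPartial L S) z = logDeriv (fun z => z) z +
      logDeriv (fun z => ∏ l ∈ S, primaryFactor (z / (l.1 : ℂ))) z :=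
    logDeriv_mul z hz0 (Finset.prod_ne_zero_iff.mpr hne) (by fun_prop) (by fun_prop)
  have h2 : logDeriv (fun z => ∏ l ∈ S, primaryFactor (z / (l.1 : ℂ))) z =
      ∑ l ∈ S, logDeriv (fun z => primaryFactor (z / (l.1 : ℂ))) z := by
    rw [← logDeriv_prod hne (fun l _ => by fun_prop)]
  rw [h1, h2]
  congr 1
  · simp [logDeriv_apply]
  · refine Finset.sum_congr rfl fun l _ => hasDerivAt_primaryFactor_div (by simpa using l.2) ?_
    rintro rfl
    exact hz l.1.2

/-- The identity `(log σ)'' = - ℘`, obtained for the finite partial products and passed to the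
locally uniform limit. -/
lemma deriv_sigma_sq_sub {z : ℂ} (hz : z ∉ L.lattice) :
    deriv (sigma L) z ^ 2 - sigma L z * deriv (deriv (sigma L)) z =
      sigma L z ^ 2 * L.weierstrassP z := by
  have hz0 : z ≠ 0 := fun h => hz (h ▸ zero_mem _)
  have t0 := tendstoLocallyUniformlyOn_sigmaPartial L
  have t1 := t0.deriv (Eventually.of_forall fun S =>
    (differentiable_sigmaPartial L S).differentiableOn) isOpen_univ
  have hdd : ∀ S, Differentiable ℂ (deriv (sigmaPartial L S)) := fun S => by
    have := (differentiable_sigmaPartial L S).contDiff (n := 2)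
    exact (this.differentiable_deriv_two)
  have t2 := t1.deriv (Eventually.of_forall fun S => (hdd S).differentiableOn) isOpen_univ
  have T0 := t0.tendsto_at (Set.mem_univ z)
  have T1 := t1.tendsto_at (Set.mem_univ z)
  have T2 := t2.tendsto_at (Set.mem_univ z)
  have hsum : HasSum (fun l : {l : L.lattice // l ≠ 0} =>
      1 / (z - (l.1 : ℂ)) ^ 2 - 1 / (l.1 : ℂ) ^ 2) (L.weierstrassP z - 1 / z ^ 2) := by
    have h1 := L.hasSum_weierstrassPExcept 0 z
    have h2 := L.weierstrassPExcept_add 0 z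
    have h3 : L.weierstrassPExcept 0 z = L.weierstrassP z - 1 / z ^ 2 := by
      rw [← h2]; simp
    rw [h3] at h1
    have h4 : Function.support (fun l : L.lattice =>
        if (l : ℂ) = 0 then 0 else (1 / (z - (l : ℂ)) ^ 2 - 1 / (l : ℂ) ^ 2)) ⊆
        {l : L.lattice | l ≠ 0} := by
      intro l hl
      simp only [Function.mem_support] at hl
      intro h
      simp [h] at hl
    rw [← hasSum_subtype_iff_of_support_subset h4] at h1
    refine h1.congr_fun fun l => ?_
    have hl : (l.1 : ℂ) ≠ 0 := fun h => l.2 (by ext; exact h)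
    simp only [Function.comp, if_neg hl]
  have key : ∀ S, deriv (sigmaPartial L S) z ^ 2 - sigmaPartial L S z *
      deriv (deriv (sigmaPartial L S)) z = sigmaPartial L S z ^ 2 *
        (1 / z ^ 2 + ∑ l ∈ S, (1 / (z - (l.1 : ℂ)) ^ 2 - 1 / (l.1 : ℂ) ^ 2)) := by
    intro S
    have hne := sigmaPartial_ne_zero L S hz
    have e1 : logDeriv (sigmaPartial L S) =ᶠ[𝓝 z] fun z =>
        1 / z + ∑ l ∈ S, (1 / (z - (l.1 : ℂ)) + 1 / (l.1 : ℂ) + z / (l.1 : ℂ) ^ 2) := by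
      filter_upwards [(isOpen_compl_lattice L).mem_nhds hz] with w hw
      exact logDeriv_sigmaPartial L S hw
    have d1 : HasDerivAt (logDeriv (sigmaPartial L S))
        ((deriv (deriv (sigmaPartial L S)) z * sigmaPartial L S z -
          deriv (sigmaPartial L S) z * deriv (sigmaPartial L S) z) / sigmaPartial L S z ^ 2) z :=
      (hdd S z).hasDerivAt.div (differentiable_sigmaPartial L S z).hasDerivAt hne
    have d2 : HasDerivAt (fun z : ℂ =>
        1 / z + ∑ l ∈ S, (1 / (z - (l.1 : ℂ)) + 1 / (l.1 : ℂ) + z / (l.1 : ℂ) ^ 2))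
        (-(1 / z ^ 2) + ∑ l ∈ S, (-(1 / (z - (l.1 : ℂ)) ^ 2) + 1 / (l.1 : ℂ) ^ 2)) z := by
      refine HasDerivAt.fun_add ?_ (HasDerivAt.fun_sum fun l _ => ?_)
      · have := hasDerivAt_inv hz0
        rw [← one_div] at this
        exact this.congr_of_eventuallyEq (Eventually.of_forall fun w => one_div w)
      · have hzl : z - (l.1 : ℂ) ≠ 0 := by
          rw [sub_ne_zero]; rintro rfl; exact hz l.1.2
        have a1 := ((hasDerivAt_id z).sub_const (l.1 : ℂ)).inv hzl
        have a2 := ((hasDerivAt_id z).div_const ((l.1 : ℂ) ^ 2))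
        convert (a1.add_const (1 / (l.1 : ℂ))).add a2 using 1
        · ext; simp
        · simp [neg_div]
    have := d1.unique (d2.congr_of_eventuallyEq e1)
    rw [div_eq_iff (pow_ne_zero 2 hne)] at this
    have h5 : ∑ l ∈ S, (-(1 / (z - (l.1 : ℂ)) ^ 2) + 1 / (l.1 : ℂ) ^ 2) =
        -∑ l ∈ S, (1 / (z - (l.1 : ℂ)) ^ 2 - 1 / (l.1 : ℂ) ^ 2) := by
      rw [← Finset.sum_neg_distrib]
      exact Finset.sum_congr rfl fun _ _ => by ring
    rw [h5] at this
    linear_combination -this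
  have lim1 := (T1.pow 2).sub (T0.mul T2)
  have lim2 := (T0.pow 2).mul ((tendsto_const_nhds (x := 1 / z ^ 2)).add hsum)
  have := tendsto_nhds_unique (lim1.congr fun S => key S) lim2
  rw [this]
  ring

/-- Quasi-periodicity of the sigma function. -/
lemma exists_sigma_add {l : ℂ} (hl : l ∈ L.lattice) :
    ∃ c η : ℂ, c ≠ 0 ∧ ∀ z, sigma L (z + l) = c * Complex.exp (η * z) * sigma L z := by
  have hmem : ∀ z, z + l ∈ L.lattice ↔ z ∈ L.lattice := fun z =>
    ⟨fun h => by simpa using sub_mem h hl, fun h => add_mem h hl⟩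
  have hne : ∀ z ∈ (L.lattice : Set ℂ)ᶜ, sigma L z ≠ 0 := fun z hz h =>
    hz ((sigma_eq_zero_iff L).mp h)
  have hne' : ∀ z ∈ (L.lattice : Set ℂ)ᶜ, sigma L (z + l) ≠ 0 := fun z hz h =>
    hz ((hmem z).mp ((sigma_eq_zero_iff L).mp h))
  have hd := differentiable_sigma L
  have hdd : Differentiable ℂ (deriv (sigma L)) :=
    (hd.contDiff (n := 2)).differentiable_deriv_two
  have hsh : ∀ z, HasDerivAt (fun z => sigma L (z + l)) (deriv (sigma L) (z + l)) z := fun z =>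
    (hd (z + l)).hasDerivAt.comp_add_const z l
  have hsh' : ∀ z, HasDerivAt (fun z => deriv (sigma L) (z + l))
      (deriv (deriv (sigma L)) (z + l)) z := fun z =>
    (hdd (z + l)).hasDerivAt.comp_add_const z l
  have hηd : ∀ z ∈ (L.lattice : Set ℂ)ᶜ, HasDerivAt
      (fun z => deriv (sigma L) (z + l) / sigma L (z + l) - deriv (sigma L) z / sigma L z) 0 z := by
    intro z hz
    have h1 := ((hsh' z).fun_div (hsh z) (hne' z hz)).fun_sub
      ((hdd z).hasDerivAt.fun_div (hd z).hasDerivAt (hne z hz))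
    refine h1.congr_deriv ?_
    have e1 := deriv_sigma_sq_sub L hz
    have e2 := deriv_sigma_sq_sub L (z := z + l) (fun h => hz ((hmem z).mp h))
    rw [L.weierstrassP_add_coe z ⟨l, hl⟩] at e2
    rw [sub_eq_zero, div_eq_div_iff (pow_ne_zero 2 (hne' z hz)) (pow_ne_zero 2 (hne z hz))]
    linear_combination -sigma L z ^ 2 * e2 + sigma L (z + l) ^ 2 * e1
  have hV := isOpen_compl_lattice L
  have hc := isPreconnected_compl_lattice L
  obtain ⟨x, hx⟩ := (dense_compl_lattice L).nonempty
  obtain ⟨η, hη⟩ : ∃ η, ∀ z ∈ (L.lattice : Set ℂ)ᶜ,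
      deriv (sigma L) (z + l) / sigma L (z + l) - deriv (sigma L) z / sigma L z = η :=
    ⟨_, fun z hz => hV.is_const_of_deriv_eq_zero hc
      (fun y hy => (hηd y hy).differentiableAt.differentiableWithinAt)
      (fun y hy => (hηd y hy).deriv) hz hx⟩
  have hG : ∀ z, HasDerivAt (fun z => Complex.exp (η * z) * sigma L z)
      (Complex.exp (η * z) * η * sigma L z + Complex.exp (η * z) * deriv (sigma L) z) z := by
    intro z
    have : HasDerivAt (fun z : ℂ => η * z) η z := by
      simpa using (hasDerivAt_id z).const_mul η
    exact this.cexp.mul (hd z).hasDerivAt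
  obtain ⟨k, hk⟩ := exists_eq_const_mul_of_deriv_mul_eq hV hc
    (F := fun z => sigma L (z + l)) (G := fun z => Complex.exp (η * z) * sigma L z)
    (fun z _ => (hsh z).differentiableAt.differentiableWithinAt)
    (fun z _ => (hG z).differentiableAt.differentiableWithinAt)
    (fun z hz => mul_ne_zero (Complex.exp_ne_zero _) (hne z hz)) (fun z hz => by
      rw [(hsh z).deriv, (hG z).deriv]
      have := hη z hz
      rw [div_sub_div _ _ (hne' z hz) (hne z hz),
        div_eq_iff (mul_ne_zero (hne' z hz) (hne z hz))] at this
      linear_combination Complex.exp (η * z) * this)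
  refine ⟨k, η, ?_, ?_⟩
  · rintro rfl
    exact hne' x hx (by simpa using hk x hx)
  · have : (fun z => sigma L (z + l)) = fun z => k * Complex.exp (η * z) * sigma L z := by
      have hc1 := hd.continuous
      refine Continuous.ext_on (dense_compl_lattice L) (by fun_prop) (by fun_prop) fun z hz => ?_
      rw [hk z hz, mul_assoc]
    exact fun z => congrFun this z

lemma deriv_sigma_ne_zero {l : ℂ} (hl : l ∈ L.lattice) : deriv (sigma L) l ≠ 0 := by
  obtain ⟨c, η, hc, h⟩ := exists_sigma_add L hl
  have h1 : HasDerivAt (fun z => sigma L (z + l)) (deriv (sigma L) (0 + l)) 0 :=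
    (differentiable_sigma L (0 + l)).hasDerivAt.comp_add_const 0 l
  have h2 : HasDerivAt (fun z => c * Complex.exp (η * z) * sigma L z)
      (c * (Complex.exp (η * 0) * (η * 1)) * sigma L 0 +
        c * Complex.exp (η * 0) * deriv (sigma L) 0) 0 :=
    ((((hasDerivAt_id (0 : ℂ)).const_mul η).cexp).const_mul c).mul
      (differentiable_sigma L 0).hasDerivAt
  have h0 : sigma L 0 = 0 := (sigma_eq_zero_iff L).mpr (zero_mem _)
  rw [funext h] at h1
  have := h1.unique h2
  rw [zero_add] at this
  rw [this, h0, deriv_sigma_zero]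
  simpa using hc

end MeanField

end

noncomputable section
namespace MeanField

open Filter Topology

/-! ### Elliptic functions and the explicit developing map -/

lemma periodic_of_generators (L : PeriodPair) {α : Type*} {f : ℂ → α}
    (h1 : ∀ z, f (z + L.ω₁) = f z) (h2 : ∀ z, f (z + L.ω₂) = f z) :
    ∀ l ∈ L.lattice, ∀ z, f (z + l) = f z := by
  intro l hl z
  obtain ⟨m, n, rfl⟩ := PeriodPair.mem_lattice.mp hl
  have p1 : Function.Periodic f L.ω₁ := h1
  have p2 : Function.Periodic f L.ω₂ := h2
  exact ((p1.int_mul m).add_period (p2.int_mul n)) z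

lemma exists_sub_mem_cell (L : PeriodPair) (z : ℂ) : ∃ l ∈ L.lattice, z - l ∈ cell L := by
  refine ⟨ZSpan.floor L.basis z, ?_, ZSpan.fract_mem_fundamentalDomain L.basis z⟩
  rw [L.lattice_eq_span_range_basis]
  exact (ZSpan.floor L.basis z).2

lemma isBounded_cell (L : PeriodPair) : Bornology.IsBounded (cell L) :=
  ZSpan.fundamentalDomain_isBounded _

lemma exists_const_of_doubly_periodic (L : PeriodPair) {f : ℂ → ℂ} (hf : Differentiable ℂ f)
    (h1 : ∀ z, f (z + L.ω₁) = f z) (h2 : ∀ z, f (z + L.ω₂) = f z) : ∃ c, ∀ z, f z = c := by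
  refine hf.exists_const_forall_eq_of_bounded ?_
  have hc : IsCompact (closure (cell L)) := (isBounded_cell L).isCompact_closure
  refine (hc.image hf.continuous).isBounded.subset ?_
  rintro _ ⟨z, rfl⟩
  obtain ⟨l, hl, hz⟩ := exists_sub_mem_cell L z
  refine ⟨z - l, subset_closure hz, ?_⟩
  simpa using (periodic_of_generators L h1 h2 l hl (z - l)).symm

/-- An entire function `X` vanishing at the zeros of `Y`, all of which are simple, is a constant
multiple of `Y` as soon as `X / Y` is doubly periodic. -/
lemma exists_eq_const_mul_of_simple_zeros (L : PeriodPair) {X Y : ℂ → ℂ}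
    (hX : Differentiable ℂ X) (hY : Differentiable ℂ Y)
    (hsimple : ∀ z, Y z = 0 → deriv Y z ≠ 0) (hzero : ∀ z, Y z = 0 → X z = 0)
    (h1 : ∀ z, X z * Y (z + L.ω₁) = X (z + L.ω₁) * Y z)
    (h2 : ∀ z, X z * Y (z + L.ω₂) = X (z + L.ω₂) * Y z) : ∃ c, ∀ z, X z = c * Y z := by
  classical
  set E : ℂ → ℂ := fun z => if Y z = 0 then deriv X z / deriv Y z else X z / Y z with hE
  have hEY : ∀ z, X z = E z * Y z := by
    intro z
    by_cases h : Y z = 0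
    · rw [h, mul_zero, hzero z h]
    · simp [hE, h]
  have hEd : Differentiable ℂ E := by
    intro z
    by_cases h : Y z = 0
    · have dX : Differentiable ℂ (dslope X z) := by
        rw [← differentiableOn_univ, Complex.differentiableOn_dslope univ_mem]
        exact hX.differentiableOn
      have dY : Differentiable ℂ (dslope Y z) := by
        rw [← differentiableOn_univ, Complex.differentiableOn_dslope univ_mem]
        exact hY.differentiableOn
      have hY1 : dslope Y z z ≠ 0 := by rw [dslope_same]; exact hsimple z h
      have hev : E =ᶠ[𝓝 z] fun w => dslope X z w / dslope Y z w := by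
        filter_upwards [dY.continuous.continuousAt.eventually_ne hY1] with w hw
        rcases eq_or_ne w z with rfl | hwz
        · simp [hE, h]
        · have e1 := sub_smul_dslope X z w
          have e2 := sub_smul_dslope Y z w
          rw [hzero z h, sub_zero, smul_eq_mul] at e1
          rw [h, sub_zero, smul_eq_mul] at e2
          have hwz' : w - z ≠ 0 := sub_ne_zero.mpr hwz
          have : Y w ≠ 0 := by rw [← e2]; exact mul_ne_zero hwz' hw
          simp only [hE, if_neg this]
          rw [← e1, ← e2, mul_div_mul_left _ _ hwz']
      exact ((dX z).div (dY z) hY1).congr_of_eventuallyEq hev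
    · have hev : E =ᶠ[𝓝 z] fun w => X w / Y w := by
        filter_upwards [hY.continuous.continuousAt.eventually_ne h] with w hw
        simp [hE, hw]
      exact ((hX z).div (hY z) h).congr_of_eventuallyEq hev
  have hYne : ¬ ∀ z, Y z = 0 := by
    intro h
    have : Y = fun _ => 0 := funext h
    exact hsimple 0 (h 0) (by rw [this]; simp)
  have hper : ∀ l, (∀ z, X z * Y (z + l) = X (z + l) * Y z) → ∀ z, E (z + l) = E z := by
    intro l hl
    have hsh : Differentiable ℂ fun z : ℂ => z + l := by fun_prop
    have a1 : AnalyticOnNhd ℂ (fun z => E (z + l) - E z) Set.univ := fun z _ =>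
      ((hEd.comp hsh).sub hEd).analyticAt z
    have a2 : AnalyticOnNhd ℂ (fun z => Y z) Set.univ := fun z _ => hY.analyticAt z
    have a3 : AnalyticOnNhd ℂ (fun z => Y (z + l)) Set.univ := fun z _ =>
      (hY.comp hsh).analyticAt z
    have hmul : ∀ z ∈ Set.univ, (E (z + l) - E z) * (Y z * Y (z + l)) = 0 := by
      intro z _
      have := hl z
      rw [hEY z, hEY (z + l)] at this
      linear_combination -this
    rcases AnalyticOnNhd.eq_zero_or_eq_zero_of_mul_eq_zero a1 (a2.mul a3) hmul
      isPreconnected_univ with h | h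
    · exact fun z => sub_eq_zero.mp (h z trivial)
    · exfalso
      rcases AnalyticOnNhd.eq_zero_or_eq_zero_of_mul_eq_zero a2 a3 h
        isPreconnected_univ with h | h
      · exact hYne fun z => h z trivial
      · exact hYne fun z => by simpa using h (z - l) trivial
  obtain ⟨c, hc⟩ := exists_const_of_doubly_periodic L hEd (hper _ h1) (hper _ h2)
  exact ⟨c, fun z => by rw [hEY z, hc z]⟩

lemma mem_lattice_iff_double (L : PeriodPair) (z : ℂ) :
    z ∈ L.lattice ↔ z ∈ (double L).lattice ∨ z - L.ω₂ ∈ (double L).lattice := by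
  simp only [PeriodPair.mem_lattice, double]
  constructor
  · rintro ⟨m, n, rfl⟩
    rcases Int.even_or_odd' n with ⟨k, rfl | rfl⟩
    · exact Or.inl ⟨m, k, by push_cast; ring⟩
    · exact Or.inr ⟨m, k, by push_cast; ring⟩
  · rintro (⟨m, n, h⟩ | ⟨m, n, h⟩)
    · exact ⟨m, 2 * n, by rw [← h]; push_cast; ring⟩
    · exact ⟨m, 2 * n + 1, by push_cast; linear_combination h⟩

lemma rat_comb_notMem_double (L : PeriodPair) (α β : ℚ) (h : α.den ≠ 1 ∨ (β / 2).den ≠ 1) :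
    α * L.ω₁ + β * L.ω₂ ∉ (double L).lattice := by
  have := (double L).mul_ω₁_add_mul_ω₂_mem_lattice (α := α) (β := β / 2)
  have e : (α : ℂ) * (double L).ω₁ + ((β / 2 : ℚ) : ℂ) * (double L).ω₂ =
      α * L.ω₁ + β * L.ω₂ := by
    simp only [double]; push_cast; ring
  rw [e] at this
  rw [this]
  tauto

/-- The Wronskian `A' B - A B'`. -/
def wronskian (A B : ℂ → ℂ) (z : ℂ) : ℂ := deriv A z * B z - A z * deriv B z

/-- Numerator `A` and denominator `B` of a developing map `A / B` with the monodromy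
`f (z + ω₁) = - f z`, `f (z + ω₂) = 1 / f z`, even, and branched exactly over the lattice. -/
structure IsDevelopingPair (L : PeriodPair) (A B : ℂ → ℂ) : Prop where
  diffA : Differentiable ℂ A
  diffB : Differentiable ℂ B
  simpleA : ∀ z, A z = 0 → deriv A z ≠ 0
  simpleB : ∀ z, B z = 0 → deriv B z ≠ 0
  disjoint : ∀ z, A z = 0 → B z ≠ 0
  zeros : ∀ z, A z * B z = 0 ↔ z + L.ω₁ / 2 ∈ L.lattice
  wronskian_eq_zero : ∀ z, wronskian A B z = 0 ↔ z ∈ L.lattice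
  deriv_wronskian : ∀ z ∈ L.lattice, deriv (wronskian A B) z ≠ 0
  even : ∀ z, A (-z) * B z = A z * B (-z)
  add_ω₁ : ∀ z, A (z + L.ω₁) * B z = -(A z * B (z + L.ω₁))
  add_ω₂ : ∀ z, A (z + L.ω₂) * A z = B (z + L.ω₂) * B z
  wronskian_add_ω₁ : ∀ z, wronskian A B (z + L.ω₁) * (A z * B z) =
    wronskian A B z * (A (z + L.ω₁) * B (z + L.ω₁))
  wronskian_add_ω₂ : ∀ z, wronskian A B (z + L.ω₂) * (A z * B z) =
    -(wronskian A B z * (A (z + L.ω₂) * B (z + L.ω₂)))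

lemma hasDerivAt_comp_neg {F : ℂ → ℂ} {F' z : ℂ} (hF : HasDerivAt F F' (-z)) :
    HasDerivAt (fun z => F (-z)) (-F') z := by
  have := hF.comp z (hasDerivAt_neg z)
  rw [mul_neg_one] at this
  exact this

/-- The symmetries of `A / B` follow from those of its logarithmic derivative
`wronskian A B / (A B)`, because the complement of the zeros of `A B` is connected. -/
lemma symmetries_of_wronskian (L : PeriodPair) {A B : ℂ → ℂ} (hdiffA : Differentiable ℂ A)
    (hdiffB : Differentiable ℂ B) (simpleB : ∀ z, B z = 0 → deriv B z ≠ 0)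
    (disjoint : ∀ z, A z = 0 → B z ≠ 0)
    (hzeros : ∀ z, A z * B z = 0 ↔ z + L.ω₁ / 2 ∈ L.lattice)
    (Wneg : ∀ z, wronskian A B (-z) * (A z * B z) = -(wronskian A B z * (A (-z) * B (-z))))
    (W1 : ∀ z, wronskian A B (z + L.ω₁) * (A z * B z) =
      wronskian A B z * (A (z + L.ω₁) * B (z + L.ω₁)))
    (W2 : ∀ z, wronskian A B (z + L.ω₂) * (A z * B z) =
      -(wronskian A B z * (A (z + L.ω₂) * B (z + L.ω₂))))
    (hBa : B (-(L.ω₁ / 2)) = 0) (hBa' : B (L.ω₁ / 2) = 0)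
    (hnorm : A (0 + L.ω₂) * A 0 = B (0 + L.ω₂) * B 0) :
    (∀ z, A (-z) * B z = A z * B (-z)) ∧
    (∀ z, A (z + L.ω₁) * B z = -(A z * B (z + L.ω₁))) ∧
    (∀ z, A (z + L.ω₂) * A z = B (z + L.ω₂) * B z) := by
  set h := L.ω₁ / 2 with hh
  set w := L.ω₂ with hw
  have hL1 : L.ω₁ = 2 * h := by rw [hh]; ring
  set V : Set ℂ := {z | A z * B z ≠ 0} with hV
  have hVeq : V = (fun z => z - h) '' ((L.lattice : Set ℂ)ᶜ) := by
    ext z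
    simp only [hV, Set.mem_ofPred_eq, Ne, hzeros, Set.mem_image]
    constructor
    · intro hz; exact ⟨z + h, hz, by ring⟩
    · rintro ⟨y, hy, rfl⟩; simpa using hy
  have hVc : IsPreconnected V := by
    rw [hVeq]
    exact (isPreconnected_compl_lattice L).image _ (by fun_prop)
  have hVo : IsOpen V := isOpen_ne_fun (hdiffA.continuous.mul hdiffB.continuous) continuous_const
  have hVd : Dense V := by
    rw [hVeq]
    exact (Homeomorph.subRight h).surjective.denseRange.dense_image (by fun_prop)
      (dense_compl_lattice L)
  have hV1 : ∀ z ∈ V, z + L.ω₁ ∈ V := fun z hz => by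
    simp only [hV, Set.mem_ofPred_eq, Ne, hzeros] at hz ⊢
    intro h'
    exact hz (by convert sub_mem h' L.ω₁_mem_lattice using 1; ring)
  have hV2 : ∀ z ∈ V, z + w ∈ V := fun z hz => by
    simp only [hV, Set.mem_ofPred_eq, Ne, hzeros] at hz ⊢
    intro h'
    exact hz (by convert sub_mem h' L.ω₂_mem_lattice using 1; rw [hw]; ring)
  have hVn : ∀ z ∈ V, -z ∈ V := fun z hz => by
    simp only [hV, Set.mem_ofPred_eq, Ne, hzeros] at hz ⊢
    intro h'
    refine hz ?_
    have := sub_mem L.ω₁_mem_lattice h'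
    convert this using 1
    ring
  have hV0 : (0 : ℂ) ∈ V := by
    simp only [hV, Set.mem_ofPred_eq, Ne, hzeros, zero_add]
    exact L.ω₁_div_two_notMem_lattice
  have shA : ∀ c z, HasDerivAt (fun z => A (z + c)) (deriv A (z + c)) z := fun c z =>
    (hdiffA (z + c)).hasDerivAt.comp_add_const z c
  have shB : ∀ c z, HasDerivAt (fun z => B (z + c)) (deriv B (z + c)) z := fun c z =>
    (hdiffB (z + c)).hasDerivAt.comp_add_const z c
  have ngA : ∀ z, HasDerivAt (fun z => A (-z)) (-deriv A (-z)) z := fun z =>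
    hasDerivAt_comp_neg (hdiffA (-z)).hasDerivAt
  have ngB : ∀ z, HasDerivAt (fun z => B (-z)) (-deriv B (-z)) z := fun z =>
    hasDerivAt_comp_neg (hdiffB (-z)).hasDerivAt
  have cA := hdiffA.continuous
  have cB := hdiffB.continuous
  have spread : ∀ F G : ℂ → ℂ, Differentiable ℂ F → Differentiable ℂ G →
      (∀ z ∈ V, G z ≠ 0) → (∀ z ∈ V, deriv F z * G z = F z * deriv G z) →
      ∃ k, ∀ z, F z = k * G z := by
    intro F G hF hG hG0 hFG
    obtain ⟨k, hk⟩ := exists_eq_const_mul_of_deriv_mul_eq hVo hVc hF.differentiableOn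
      hG.differentiableOn hG0 hFG
    have hFc := hF.continuous
    have hGc := hG.continuous
    exact ⟨k, fun z => congrFun (Continuous.ext_on hVd hFc (continuous_const.mul hGc) hk) z⟩
  have heven : ∀ z, A (-z) * B z = A z * B (-z) := by
    obtain ⟨k, hk⟩ := spread (fun z => A (-z) * B z) (fun z => A z * B (-z))
      (fun z => ((ngA z).mul (hdiffB z).hasDerivAt).differentiableAt)
      (fun z => ((hdiffA z).hasDerivAt.mul (ngB z)).differentiableAt)
      (fun z hz => mul_ne_zero (left_ne_zero_of_mul hz) (right_ne_zero_of_mul (hVn z hz)))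
      (fun z _ => by
        have e1 : deriv (fun z => A (-z) * B z) z = -deriv A (-z) * B z + A (-z) * deriv B z :=
          ((ngA z).mul (hdiffB z).hasDerivAt).deriv
        have e2 : deriv (fun z => A z * B (-z)) z = deriv A z * B (-z) + A z * -deriv B (-z) :=
          ((hdiffA z).hasDerivAt.mul (ngB z)).deriv
        rw [e1, e2]
        have := Wneg z
        simp only [wronskian] at this
        linear_combination -this)
    have h0 := hk 0
    simp only [neg_zero] at h0
    have : k = 1 := by
      refine mul_right_cancel₀ hV0 ?_
      rw [one_mul]; exact h0.symm
    intro z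
    simpa [this] using hk z
  have hadd1 : ∀ z, A (z + L.ω₁) * B z = -(A z * B (z + L.ω₁)) := by
    obtain ⟨k, hk⟩ := spread (fun z => A (z + L.ω₁) * B z) (fun z => A z * B (z + L.ω₁))
      (fun z => ((shA _ z).mul (hdiffB z).hasDerivAt).differentiableAt)
      (fun z => ((hdiffA z).hasDerivAt.mul (shB _ z)).differentiableAt)
      (fun z hz => mul_ne_zero (left_ne_zero_of_mul hz) (right_ne_zero_of_mul (hV1 z hz)))
      (fun z _ => by
        have e1 : deriv (fun z => A (z + L.ω₁) * B z) z =
          deriv A (z + L.ω₁) * B z + A (z + L.ω₁) * deriv B z :=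
          ((shA _ z).mul (hdiffB z).hasDerivAt).deriv
        have e2 : deriv (fun z => A z * B (z + L.ω₁)) z =
          deriv A z * B (z + L.ω₁) + A z * deriv B (z + L.ω₁) :=
          ((hdiffA z).hasDerivAt.mul (shB _ z)).deriv
        rw [e1, e2]
        have := W1 z
        simp only [wronskian] at this
        linear_combination this)
    -- the sign is found at the pole `a = - ω₁ / 2`, using that `A / B` is even
    have ha : -h + L.ω₁ = h := by rw [hL1]; ring
    have d1 := ((shA L.ω₁ (-h)).mul (hdiffB (-h)).hasDerivAt)
    have d2 := ((hdiffA (-h)).hasDerivAt.mul (shB L.ω₁ (-h))).const_mul k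
    have E1 := d1.unique (d2.congr_of_eventuallyEq (Eventually.of_forall hk))
    have d3 := ((ngA (-h)).mul (hdiffB (-h)).hasDerivAt)
    have d4 := ((hdiffA (-h)).hasDerivAt.mul (ngB (-h)))
    have E2 := d3.unique (d4.congr_of_eventuallyEq (Eventually.of_forall heven))
    simp only [ha, neg_neg, hBa, hBa', mul_zero, zero_add] at E1 E2
    have hA0 : A (-h) ≠ 0 := fun h' => disjoint _ h' hBa
    have hB0 : deriv B h ≠ 0 := simpleB _ hBa'
    have : k = -1 := by
      refine mul_right_cancel₀ (mul_ne_zero hA0 hB0) ?_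
      linear_combination E2 - E1
    intro z
    simpa [this] using hk z
  have hadd2 : ∀ z, A (z + w) * A z = B (z + w) * B z := by
    obtain ⟨k, hk⟩ := spread (fun z => A (z + w) * A z) (fun z => B (z + w) * B z)
      (fun z => ((shA _ z).mul (hdiffA z).hasDerivAt).differentiableAt)
      (fun z => ((shB _ z).mul (hdiffB z).hasDerivAt).differentiableAt)
      (fun z hz => mul_ne_zero (right_ne_zero_of_mul (hV2 z hz)) (right_ne_zero_of_mul hz))
      (fun z _ => by
        have e1 : deriv (fun z => A (z + w) * A z) z =
          deriv A (z + w) * A z + A (z + w) * deriv A z :=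
          ((shA _ z).mul (hdiffA z).hasDerivAt).deriv
        have e2 : deriv (fun z => B (z + w) * B z) z =
          deriv B (z + w) * B z + B (z + w) * deriv B z :=
          ((shB _ z).mul (hdiffB z).hasDerivAt).deriv
        rw [e1, e2]
        have := W2 z
        simp only [wronskian] at this
        linear_combination this)
    have h0 := hk 0
    have hne : B (0 + w) * B 0 ≠ 0 :=
      mul_ne_zero (right_ne_zero_of_mul (hV2 0 hV0)) (right_ne_zero_of_mul hV0)
    have : k = 1 := by
      refine mul_right_cancel₀ hne ?_
      rw [one_mul]; exact h0.symm.trans hnorm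
    intro z
    simpa [this] using hk z
  exact ⟨heven, hadd1, hadd2⟩

set_option maxHeartbeats 1000000 in
/-- Existence of the developing pair: `A = exp (C z + C₀) σ(z - b)` and `B = σ(z - a)`. -/
lemma exists_isDevelopingPair (L : PeriodPair) : ∃ A B : ℂ → ℂ, IsDevelopingPair L A B ∧
    ∀ z, wronskian A B z = sigmaQuotient L z * (A z * B z) ∨ A z * B z = 0 := by
  set M := double L with hM
  set s := sigma M with hs
  set h := L.ω₁ / 2 with hh
  set w := L.ω₂ with hw
  set b := h + w with hb
  have hM1 : M.ω₁ = 2 * h := by simp [hM, double, hh]; ring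
  have hM2 : M.ω₂ = 2 * w := rfl
  have hL1 : L.ω₁ = 2 * h := by rw [hh]; ring
  have sd : Differentiable ℂ s := differentiable_sigma M
  have sd' : Differentiable ℂ (deriv s) := (sd.contDiff (n := 2)).differentiable_deriv_two
  have s0 : s 0 = 0 := (sigma_eq_zero_iff M).mpr (zero_mem _)
  have s1 : deriv s 0 = 1 := deriv_sigma_zero M
  have sneg : ∀ z, s (-z) = -s z := sigma_neg M
  have snh : s h ≠ 0 := fun e => by
    have := rat_comb_notMem_double L (1 / 2) 0 (Or.inl (by norm_num))
    refine this ?_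
    convert (sigma_eq_zero_iff M).mp e using 1
    push_cast; rw [hh]; ring
  have snb : s b ≠ 0 := fun e => by
    have := rat_comb_notMem_double L (1 / 2) 1 (Or.inl (by norm_num))
    refine this ?_
    convert (sigma_eq_zero_iff M).mp e using 1
    push_cast; rw [hb, hh]; ring
  have sn1 : s (2 * h + w) ≠ 0 := fun e => by
    have := rat_comb_notMem_double L 1 1 (Or.inr (by norm_num))
    refine this ?_
    convert (sigma_eq_zero_iff M).mp e using 1
    push_cast; rw [hh]; ring
  have snw : s w ≠ 0 := fun e => by
    have := rat_comb_notMem_double L 0 1 (Or.inr (by norm_num))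
    refine this ?_
    convert (sigma_eq_zero_iff M).mp e using 1
    push_cast; ring
  set r := s h * s b / s (2 * h + w) with hr
  have hr0 : r ≠ 0 := div_ne_zero (mul_ne_zero snh snb) sn1
  have hrinv : r⁻¹ * (s h * s b) = s (2 * h + w) := by
    rw [hr]; field_simp
  set N : ℂ → ℂ := fun z => s z * s (z - w) with hN
  set Y : ℂ → ℂ := fun z => s (z + h) * s (z - b) with hY
  set X : ℂ → ℂ := fun z =>
    r⁻¹ * N z - deriv s (z - b) * s (z + h) + deriv s (z + h) * s (z - b) with hX
  have hquot : ∀ z, sigmaQuotient L z = r⁻¹ * N z / Y z := by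
    intro z
    have e1 : r = sigmaConst L := by
      rw [hr, hb, sigmaConst, hs, hM, hw, hh]; congr 3; ring
    rw [e1, sigmaQuotient, ← hM, ← hs, ← hh, ← hw, sub_neg_eq_add]
  have dsh : ∀ c z, HasDerivAt (fun z => s (z + c)) (deriv s (z + c)) z := fun c z =>
    (sd (z + c)).hasDerivAt.comp_add_const z c
  have dsb : ∀ c z, HasDerivAt (fun z => s (z - c)) (deriv s (z - c)) z := fun c z =>
    (sd (z - c)).hasDerivAt.comp_sub_const z c
  have dY : ∀ z, HasDerivAt Y (deriv s (z + h) * s (z - b) + s (z + h) * deriv s (z - b)) z :=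
    fun z => (dsh h z).mul (dsb b z)
  have dN : ∀ z, HasDerivAt N (deriv s z * s (z - w) + s z * deriv s (z - w)) z :=
    fun z => (sd z).hasDerivAt.mul (dsb w z)
  have sderiv : ∀ z, s z = 0 → deriv s z ≠ 0 := fun z hz =>
    deriv_sigma_ne_zero M ((sigma_eq_zero_iff M).mp hz)
  -- `a` and `b` are inequivalent modulo the double lattice
  have hdisj : ∀ z, s (z + h) = 0 → s (z - b) ≠ 0 := by
    intro z h1 h2
    have h3 := sub_mem ((sigma_eq_zero_iff M).mp h1) ((sigma_eq_zero_iff M).mp h2)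
    have : z + h - (z - b) = 2 * h + w := by rw [hb]; ring
    rw [this] at h3
    exact sn1 ((sigma_eq_zero_iff M).mpr h3)
  have hdisjw : ∀ z, s z = 0 → s (z - w) ≠ 0 := by
    intro z h1 h2
    have h3 := sub_mem ((sigma_eq_zero_iff M).mp h1) ((sigma_eq_zero_iff M).mp h2)
    have : z - (z - w) = w := by ring
    rw [this] at h3
    exact snw ((sigma_eq_zero_iff M).mpr h3)
  have Ysimple : ∀ z, Y z = 0 → deriv Y z ≠ 0 := by
    intro z hz
    rw [(dY z).deriv]
    rcases mul_eq_zero.mp hz with h1 | h1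
    · rw [h1, zero_mul, add_zero]
      exact mul_ne_zero (sderiv _ h1) (hdisj z h1)
    · have h2 : s (z + h) ≠ 0 := fun h2 => hdisj z h2 h1
      rw [h1, mul_zero, zero_add]
      exact mul_ne_zero h2 (sderiv _ h1)
  have sadd' : ∀ (l c η : ℂ), (∀ z, s (z + l) = c * Complex.exp (η * z) * s z) →
      ∀ z, deriv s (z + l) = c * Complex.exp (η * z) * (η * s z + deriv s z) := by
    intro l c η hq z
    have h1 := dsh l z
    have h2 : HasDerivAt (fun z => c * Complex.exp (η * z) * s z)
        (c * (Complex.exp (η * z) * (η * 1)) * s z +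
          c * Complex.exp (η * z) * deriv s z) z :=
      ((((hasDerivAt_id z).const_mul η).cexp).const_mul c).mul (sd z).hasDerivAt
    rw [funext hq] at h1
    rw [h1.unique h2]
    ring
  -- all three of `N`, `Y`, `X` are multiplied by the same factor under a lattice translation
  have quasi : ∀ l ∈ M.lattice, ∃ m : ℂ → ℂ, (∀ z, N (z + l) = m z * N z) ∧
      (∀ z, Y (z + l) = m z * Y z) ∧ ∀ z, X (z + l) = m z * X z := by
    intro l hl
    obtain ⟨c, η, hc, hq⟩ := exists_sigma_add M hl
    rw [← hs] at hq
    have hq' := sadd' l c η hq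
    refine ⟨fun z => c ^ 2 * Complex.exp (η * z + η * (z - w)), ?_, ?_, ?_⟩
    · intro z
      simp only [hN]
      rw [show z + l - w = z - w + l by ring, hq z, hq (z - w), Complex.exp_add]
      ring
    · intro z
      simp only [hY]
      rw [show z + l + h = z + h + l by ring, show z + l - b = z - b + l by ring, hq (z + h),
        hq (z - b), show η * z + η * (z - w) = η * (z + h) + η * (z - b) by rw [hb]; ring,
        Complex.exp_add]
      ring
    · intro z
      simp only [hX, hN]
      rw [show z + l - w = z - w + l by ring, hq z, hq (z - w),
        show z + l + h = z + h + l by ring, show z + l - b = z - b + l by ring, hq (z + h),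
        hq (z - b), hq' (z + h), hq' (z - b)]
      have e1 : Complex.exp (η * z) * Complex.exp (η * (z - w)) =
          Complex.exp (η * z + η * (z - w)) := (Complex.exp_add _ _).symm
      have e2 : Complex.exp (η * (z + h)) * Complex.exp (η * (z - b)) =
          Complex.exp (η * z + η * (z - w)) := by
        rw [← Complex.exp_add]; congr 1; rw [hb]; ring
      linear_combination (r⁻¹ * c ^ 2 * s z * s (z - w)) * e1 + c ^ 2 * (s (z - b) *
        deriv s (z + h) - deriv s (z - b) * s (z + h)) * e2
  have Xa : X (-h) = 0 := by
    simp only [hX, hN]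
    rw [neg_add_cancel, s0, s1, show -h - w = -b by rw [hb]; ring,
      show -h - b = -(2 * h + w) by rw [hb]; ring, sneg, sneg, sneg, ← hrinv]
    ring
  have Xb : X b = 0 := by
    simp only [hX, hN]
    rw [sub_self, s0, s1, show b - w = h by rw [hb]; ring,
      show b + h = 2 * h + w by rw [hb]; ring, ← hrinv]
    ring
  have Xzero : ∀ z, Y z = 0 → X z = 0 := by
    intro z hz
    rcases mul_eq_zero.mp hz with h1 | h1
    · obtain ⟨m, -, -, hm⟩ := quasi _ ((sigma_eq_zero_iff M).mp h1)
      have := hm (-h)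
      rw [Xa, mul_zero] at this
      convert this using 2
      ring
    · obtain ⟨m, -, -, hm⟩ := quasi _ ((sigma_eq_zero_iff M).mp h1)
      have := hm b
      rw [Xb, mul_zero] at this
      convert this using 2
      ring
  have Yd : Differentiable ℂ Y := fun z => (dY z).differentiableAt
  have Nd : Differentiable ℂ N := fun z => (dN z).differentiableAt
  have Xd : Differentiable ℂ X := by simp only [hX]; fun_prop
  obtain ⟨C, hC⟩ : ∃ C, ∀ z, X z = C * Y z := by
    refine exists_eq_const_mul_of_simple_zeros M Xd Yd Ysimple Xzero ?_ ?_
    · obtain ⟨m, -, h1, h2⟩ := quasi _ M.ω₁_mem_lattice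
      intro z; rw [h1, h2]; ring
    · obtain ⟨m, -, h1, h2⟩ := quasi _ M.ω₂_mem_lattice
      intro z; rw [h1, h2]; ring
  -- the additive constant normalizes `f(0) f(ω₂) = 1`
  set e : ℂ → ℂ := fun z => Complex.exp (C * z - C * w / 2) with he
  have e0 : ∀ z, e z ≠ 0 := fun z => Complex.exp_ne_zero _
  have de : ∀ z, HasDerivAt e (C * e z) z := by
    intro z
    have := (((hasDerivAt_id z).const_mul C).sub_const (C * w / 2)).cexp
    simp only [id, mul_one] at this
    rw [mul_comm]
    exact this
  set A : ℂ → ℂ := fun z => e z * s (z - b) with hA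
  set B : ℂ → ℂ := fun z => s (z + h) with hB
  have dA : ∀ z, HasDerivAt A (C * e z * s (z - b) + e z * deriv s (z - b)) z := fun z =>
    (de z).mul (dsb b z)
  have dB : ∀ z, HasDerivAt B (deriv s (z + h)) z := fun z => dsh h z
  have hW : ∀ z, wronskian A B z = e z * r⁻¹ * N z := by
    intro z
    have h1 := hC z
    simp only [hX, hY] at h1
    rw [wronskian, (dA z).deriv, (dB z).deriv]
    simp only [hA, hB]
    linear_combination -(e z) * h1
  have hAB : ∀ z, A z * B z = e z * Y z := fun z => by simp only [hA, hB, hY]; ring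
  have dW : ∀ z, HasDerivAt (wronskian A B) (C * e z * (r⁻¹ * N z) + e z *
      (r⁻¹ * (deriv s z * s (z - w) + s z * deriv s (z - w)))) z := by
    intro z
    rw [funext hW]
    have := (de z).mul ((dN z).const_mul r⁻¹)
    refine this.congr_of_eventuallyEq (Eventually.of_forall fun z => ?_)
    simp [mul_assoc]
  have hdiffA : Differentiable ℂ A := fun z => (dA z).differentiableAt
  have hdiffB : Differentiable ℂ B := fun z => (dB z).differentiableAt
  have hAz : ∀ z, A z = 0 ↔ s (z - b) = 0 := fun z => by simp [hA, e0]
  have hNz : ∀ z, N z = 0 ↔ z ∈ L.lattice := fun z => by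
    rw [mem_lattice_iff_double, ← hM, ← hw]
    simp only [hN, mul_eq_zero, hs, sigma_eq_zero_iff]
  have hzeros : ∀ z, A z * B z = 0 ↔ z + L.ω₁ / 2 ∈ L.lattice := by
    intro z
    rw [mem_lattice_iff_double, ← hM, ← hw, ← hh, mul_eq_zero, hAz, or_comm]
    simp only [hB, hs, sigma_eq_zero_iff]
    refine or_congr Iff.rfl ?_
    have : z - b = z + h - w - M.ω₁ := by rw [hM1, hb]; ring
    rw [this]
    exact ⟨fun h => by simpa using add_mem h M.ω₁_mem_lattice, fun h => sub_mem h M.ω₁_mem_lattice⟩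
  -- the logarithmic derivative is doubly periodic for the double lattice, and odd
  have hNneg : ∀ z, N (-z) = N (z + w) := fun z => by
    simp only [hN]
    rw [show -z - w = -(z + w) by ring, sneg, sneg, add_sub_cancel_right]; ring
  have hYneg : ∀ z, Y (-z) = Y (z + w) := fun z => by
    simp only [hY]
    rw [show -z + h = -(z - h) by ring, show -z - b = -(z + b) by ring, sneg, sneg,
      show z + w + h = z + b by rw [hb]; ring, show z + w - b = z - h by rw [hb]; ring]; ring
  have hodd : ∀ z, N (-z) * Y z = -(N z * Y (-z)) := by
    obtain ⟨c1, η1, hc1, q1⟩ := exists_sigma_add M M.ω₁_mem_lattice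
    obtain ⟨c2, η2, hc2, q2⟩ := exists_sigma_add M M.ω₂_mem_lattice
    rw [← hs] at q1 q2
    obtain ⟨κ, hκ⟩ : ∃ κ, ∀ z, N (-z) * Y z = κ * (N z * Y (-z)) := by
      refine ⟨Complex.exp (η2 * h - η1 * w), fun z => ?_⟩
      rw [hNneg, hYneg]
      simp only [hN, hY]
      have a1 : s (z + w) = c2 * Complex.exp (η2 * (z - w)) * s (z - w) := by
        rw [← q2, hM2]; congr 1; ring
      have a2 : s (z + h) = c1 * Complex.exp (η1 * (z - h)) * s (z - h) := by
        rw [← q1, hM1]; congr 1; ring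
      have a3 : s (z + w + h) = c1 * Complex.exp (η1 * (z - b + 2 * w)) *
          (c2 * Complex.exp (η2 * (z - b)) * s (z - b)) := by
        rw [← q2, hM2, ← q1, hM1]; congr 1; rw [hb]; ring
      rw [a1, a2, a3, add_sub_cancel_right, show z + w - b = z - h by rw [hb]; ring]
      have E : Complex.exp (η2 * (z - w)) * Complex.exp (η1 * (z - h)) =
          Complex.exp (η2 * h - η1 * w) * (Complex.exp (η1 * (z - b + 2 * w)) *
            Complex.exp (η2 * (z - b))) := by
        simp only [← Complex.exp_add]; congr 1; rw [hb]; ring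
      linear_combination (c1 * c2 * s (z - w) * s z * s (z - h) * s (z - b)) * E
    have hN0 : N 0 = 0 := by simp [hN, s0]
    have hdN0 : deriv N 0 ≠ 0 := by
      rw [(dN 0).deriv, s0, s1, zero_sub, sneg]; simpa using snw
    have hY0 : Y 0 ≠ 0 := by
      simp only [hY, zero_add, zero_sub, sneg]
      exact mul_ne_zero snh (neg_ne_zero.mpr snb)
    have negd : ∀ F : ℂ → ℂ, Differentiable ℂ F →
        HasDerivAt (fun z => F (-z)) (-deriv F 0) 0 := by
      intro F hF
      have h1 : HasDerivAt F (deriv F 0) (-(0 : ℂ)) := by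
        rw [neg_zero]; exact (hF 0).hasDerivAt
      exact hasDerivAt_comp_neg h1
    have d1 := (negd N Nd).mul (Yd 0).hasDerivAt
    have d2 := ((Nd 0).hasDerivAt.mul (negd Y Yd)).const_mul κ
    have := d1.unique (d2.congr_of_eventuallyEq (Eventually.of_forall hκ))
    simp only [neg_zero, hN0, zero_mul, add_zero] at this
    have hk : κ = -1 := by
      refine mul_right_cancel₀ (mul_ne_zero hdN0 hY0) ?_
      linear_combination -this
    intro z
    rw [hκ z, hk]; ring
  have hg1 : ∀ z, N (z + L.ω₁) * Y z = N z * Y (z + L.ω₁) := by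
    obtain ⟨m, h1, h2, -⟩ := quasi _ M.ω₁_mem_lattice
    intro z
    have : L.ω₁ = M.ω₁ := rfl
    rw [this, h1, h2]; ring
  have hg2 : ∀ z, N (z + w) * Y z = -(N z * Y (z + w)) := fun z => by
    rw [← hNneg, ← hYneg, hodd]
  have W1 : ∀ z, wronskian A B (z + L.ω₁) * (A z * B z) =
      wronskian A B z * (A (z + L.ω₁) * B (z + L.ω₁)) := fun z => by
    rw [hW, hW, hAB, hAB]; linear_combination e z * e (z + L.ω₁) * r⁻¹ * hg1 z
  have W2 : ∀ z, wronskian A B (z + w) * (A z * B z) =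
      -(wronskian A B z * (A (z + w) * B (z + w))) := fun z => by
    rw [hW, hW, hAB, hAB]; linear_combination e z * e (z + w) * r⁻¹ * hg2 z
  have Wneg : ∀ z, wronskian A B (-z) * (A z * B z) =
      -(wronskian A B z * (A (-z) * B (-z))) := fun z => by
    rw [hW, hW, hAB, hAB]; linear_combination e z * e (-z) * r⁻¹ * hodd z
  have hnorm : A (0 + w) * A 0 = B (0 + w) * B 0 := by
    have ee : e w * e 0 = 1 := by
      simp only [he]; rw [← Complex.exp_add, ← Complex.exp_zero]; congr 1; ring
    simp only [hA, hB, zero_add, zero_sub, sneg]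
    rw [show w - b = -h by rw [hb]; ring, show w + h = b by rw [hb]; ring, sneg]
    linear_combination s h * s b * ee
  have hBa : B (-h) = 0 := by simp [hB, s0]
  have hBa' : B h = 0 := by
    simp only [hB]
    rw [hs, sigma_eq_zero_iff, show h + h = M.ω₁ by rw [hM1]; ring]
    exact M.ω₁_mem_lattice
  have hdisj' : ∀ z, A z = 0 → B z ≠ 0 := fun z h1 h2 => hdisj z h2 ((hAz z).mp h1)
  have simpleB : ∀ z, B z = 0 → deriv B z ≠ 0 := by
    intro z hz
    rw [(dB z).deriv]
    exact sderiv _ hz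
  obtain ⟨heven, hadd1, hadd2⟩ := symmetries_of_wronskian L hdiffA hdiffB simpleB hdisj' hzeros
    Wneg W1 W2 hBa hBa' hnorm
  refine ⟨A, B, ⟨hdiffA, hdiffB, ?_, ?_, ?_, hzeros, ?_, ?_, heven, hadd1, hadd2, W1, W2⟩, ?_⟩
  · intro z hz
    rw [hAz] at hz
    rw [(dA z).deriv, hz, mul_zero, zero_add]
    exact mul_ne_zero (e0 z) (sderiv _ hz)
  · exact simpleB
  · exact hdisj'
  · intro z
    rw [hW, ← hNz]
    simp [e0, hr0]
  · intro z hz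
    have hz' := (hNz z).mpr hz
    rw [(dW z).deriv, hz', mul_zero, mul_zero, zero_add]
    refine mul_ne_zero (e0 z) (mul_ne_zero (inv_ne_zero hr0) ?_)
    rcases mul_eq_zero.mp hz' with h1 | h1
    · rw [h1, zero_mul, add_zero]
      exact mul_ne_zero (sderiv _ h1) (hdisjw z h1)
    · rw [h1, mul_zero, zero_add]
      exact mul_ne_zero (fun h2 => hdisjw z h2 h1) (sderiv _ h1)
  · intro z
    by_cases hz : A z * B z = 0
    · exact Or.inr hz
    · left
      rw [hquot, hW, hAB]
      have : Y z ≠ 0 := fun h' => hz (by rw [hAB, h', mul_zero])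
      field_simp

end MeanField

end

noncomputable section
namespace MeanField

open Filter Topology ComplexConjugate

/-! ### Wirtinger calculus -/

/-- The Wirtinger derivative `∂f/∂z`. -/
def dz (f : ℂ → ℂ) (z : ℂ) : ℂ := (fderiv ℝ f z 1 - Complex.I * fderiv ℝ f z Complex.I) / 2

/-- The Wirtinger derivative `∂f/∂z̄`. -/
def dzb (f : ℂ → ℂ) (z : ℂ) : ℂ := (fderiv ℝ f z 1 + Complex.I * fderiv ℝ f z Complex.I) / 2

/-- The real-linear map `h ↦ p h + q h̄`. -/
def wirtingerCLM (p q : ℂ) : ℂ →L[ℝ] ℂ :=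
  p • ContinuousLinearMap.id ℝ ℂ + q • (Complex.conjCLE : ℂ →L[ℝ] ℂ)

@[simp] lemma wirtingerCLM_apply (p q h : ℂ) : wirtingerCLM p q h = p * h + q * conj h := by
  simp [wirtingerCLM]

/-- `f` is real differentiable at `z` with `∂f/∂z = p` and `∂f/∂z̄ = q`. -/
def HasWirtingerAt (f : ℂ → ℂ) (p q z : ℂ) : Prop := HasFDerivAt f (wirtingerCLM p q) z

namespace HasWirtingerAt

variable {f g : ℂ → ℂ} {p q p' q' z : ℂ}

lemma dz_eq (h : HasWirtingerAt f p q z) : dz f z = p := by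
  rw [dz, HasFDerivAt.fderiv h]
  simp
  linear_combination (-p / 2 + q / 2) * Complex.I_mul_I

lemma dzb_eq (h : HasWirtingerAt f p q z) : dzb f z = q := by
  rw [dzb, HasFDerivAt.fderiv h]
  simp
  linear_combination (p / 2 - q / 2) * Complex.I_mul_I

lemma of_differentiableAt (h : DifferentiableAt ℝ f z) : HasWirtingerAt f (dz f z) (dzb f z) z := by
  have : fderiv ℝ f z = wirtingerCLM (dz f z) (dzb f z) := by
    ext1 v
    have hv : v = v.re • (1 : ℂ) + v.im • Complex.I := by
      simp [Complex.re_add_im]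
    have hc : conj v = v.re - v.im * Complex.I := by
      apply Complex.ext <;> simp
    rw [wirtingerCLM_apply, hc]
    conv_lhs => rw [hv]
    conv_rhs => rw [← Complex.re_add_im v]
    rw [map_add, map_smul, map_smul, dz, dzb, Complex.real_smul, Complex.real_smul]
    simp only [Complex.add_re, Complex.ofReal_re, Complex.mul_re, Complex.I_re, mul_zero,
      Complex.ofReal_im, Complex.I_im, mul_one, sub_self, add_zero, Complex.add_im, Complex.mul_im,
      zero_add]
    linear_combination (v.im * fderiv ℝ f z Complex.I) * Complex.I_mul_I
  unfold HasWirtingerAt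
  rw [← this]
  exact h.hasFDerivAt

lemma congr_deriv (h : HasWirtingerAt f p q z) (hp : p = p') (hq : q = q') :
    HasWirtingerAt f p' q' z := hp ▸ hq ▸ h

lemma unique (h : HasWirtingerAt f p q z) (h' : HasWirtingerAt f p' q' z) : p = p' ∧ q = q' :=
  ⟨h.dz_eq.symm.trans h'.dz_eq, h.dzb_eq.symm.trans h'.dzb_eq⟩

lemma add (hf : HasWirtingerAt f p q z) (hg : HasWirtingerAt g p' q' z) :
    HasWirtingerAt (fun z => f z + g z) (p + p') (q + q') z := by
  have := HasFDerivAt.fun_add hf hg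
  refine this.congr_fderiv ?_
  ext1 v; simp; ring

lemma neg (hf : HasWirtingerAt f p q z) : HasWirtingerAt (fun z => -f z) (-p) (-q) z := by
  have := HasFDerivAt.fun_neg hf
  refine this.congr_fderiv ?_
  ext1 v; simp; ring

lemma sub (hf : HasWirtingerAt f p q z) (hg : HasWirtingerAt g p' q' z) :
    HasWirtingerAt (fun z => f z - g z) (p - p') (q - q') z := by
  simpa only [sub_eq_add_neg] using hf.add hg.neg

lemma mul (hf : HasWirtingerAt f p q z) (hg : HasWirtingerAt g p' q' z) :
    HasWirtingerAt (fun z => f z * g z) (p * g z + f z * p') (q * g z + f z * q') z := by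
  have := HasFDerivAt.fun_mul hf hg
  refine this.congr_fderiv ?_
  ext1 v; simp; ring

lemma const (c : ℂ) : HasWirtingerAt (fun _ => c) 0 0 z := by
  refine (hasFDerivAt_const c z).congr_fderiv ?_
  ext1 v; simp

lemma of_hasDerivAt (h : HasDerivAt f p z) : HasWirtingerAt f p 0 z := by
  refine (h.hasFDerivAt.restrictScalars ℝ).congr_fderiv ?_
  ext1 v; simp [mul_comm]

lemma comp {φ : ℂ → ℂ} {φ' : ℂ} (hφ : HasDerivAt φ φ' (f z)) (hf : HasWirtingerAt f p q z) :
    HasWirtingerAt (fun z => φ (f z)) (φ' * p) (φ' * q) z := by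
  refine ((hφ.hasFDerivAt.restrictScalars ℝ).comp z hf).congr_fderiv ?_
  ext1 v; simp; ring

lemma inv (hf : HasWirtingerAt f p q z) (h0 : f z ≠ 0) :
    HasWirtingerAt (fun z => (f z)⁻¹) (-p / f z ^ 2) (-q / f z ^ 2) z :=
  (comp (hasDerivAt_inv h0) hf).congr_deriv (by field_simp) (by field_simp)

lemma div (hf : HasWirtingerAt f p q z) (hg : HasWirtingerAt g p' q' z) (h0 : g z ≠ 0) :
    HasWirtingerAt (fun z => f z / g z) ((p * g z - f z * p') / g z ^ 2)
      ((q * g z - f z * q') / g z ^ 2) z := by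
  simp only [div_eq_mul_inv (f _)]
  exact (hf.mul (hg.inv h0)).congr_deriv (by field_simp; ring) (by field_simp; ring)

lemma conjugate (hf : HasWirtingerAt f p q z) :
    HasWirtingerAt (fun z => conj (f z)) (conj q) (conj p) z := by
  have := (Complex.conjCLE : ℂ →L[ℝ] ℂ).hasFDerivAt.comp z hf
  refine this.congr_fderiv ?_
  ext1 v; simp; ring

lemma hasDerivAt (h : HasWirtingerAt f p 0 z) : HasDerivAt f p z := by
  rw [hasDerivAt_iff_hasFDerivAt]
  refine hasFDerivAt_of_restrictScalars ℝ h ?_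
  ext1 v; simp [mul_comm]

end HasWirtingerAt

lemma contDiff_dz {f : ℂ → ℂ} (hf : ContDiff ℝ ∞ f) : ContDiff ℝ ∞ (dz f) := by
  have h : ContDiff ℝ ∞ (fderiv ℝ f) := hf.fderiv_right (by simp)
  unfold dz
  fun_prop

lemma contDiff_dzb {f : ℂ → ℂ} (hf : ContDiff ℝ ∞ f) : ContDiff ℝ ∞ (dzb f) := by
  have h : ContDiff ℝ ∞ (fderiv ℝ f) := hf.fderiv_right (by simp)
  unfold dzb
  fun_prop

lemma hasWirtingerAt_of_contDiff {f : ℂ → ℂ} (hf : ContDiff ℝ ∞ f) (z : ℂ) :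
    HasWirtingerAt f (dz f z) (dzb f z) z :=
  HasWirtingerAt.of_differentiableAt (hf.differentiable (by simp) z)

lemma fderiv_fderiv_apply {F : Type*} [NormedAddCommGroup F] [NormedSpace ℝ F] {f : ℂ → F} {z : ℂ}
    (hf : ContDiffAt ℝ 2 f z) (v w : ℂ) :
    fderiv ℝ (fun z => fderiv ℝ f z v) z w = fderiv ℝ (fderiv ℝ f) z w v := by
  have h : DifferentiableAt ℝ (fderiv ℝ f) z :=
    (hf.fderiv_right (m := 1) (by norm_num)).differentiableAt (by norm_num)
  rw [fderiv_clm_apply h (differentiableAt_const v)]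
  simp

lemma laplacian_eq_fderiv {F : Type*} [NormedAddCommGroup F] [NormedSpace ℝ F] {f : ℂ → F} {z : ℂ}
    (hf : ContDiffAt ℝ 2 f z) :
    Δ f z = fderiv ℝ (fun z => fderiv ℝ f z 1) z 1 +
      fderiv ℝ (fun z => fderiv ℝ f z Complex.I) z Complex.I := by
  rw [InnerProductSpace.laplacian_eq_iteratedFDeriv_complexPlane]
  simp only [iteratedFDeriv_two_apply, fderiv_fderiv_apply hf]
  simp

lemma fderiv_dz {f : ℂ → ℂ} (hf : ContDiff ℝ ∞ f) (z v : ℂ) :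
    fderiv ℝ (dz f) z v =
      (fderiv ℝ (fderiv ℝ f) z v 1 - Complex.I * fderiv ℝ (fderiv ℝ f) z v Complex.I) / 2 := by
  have h2 : ContDiffAt ℝ 2 f z := (hf.of_le (by norm_cast)).contDiffAt
  have hd : ContDiff ℝ ∞ (fderiv ℝ f) := hf.fderiv_right (by simp)
  have h1 : ∀ w : ℂ, DifferentiableAt ℝ (fun z => fderiv ℝ f z w) z := fun w =>
    (hd.differentiable (by simp) z).clm_apply (differentiableAt_const w)
  have e : dz f = fun z => (2⁻¹ : ℂ) * (fderiv ℝ f z 1 - Complex.I * fderiv ℝ f z Complex.I) := by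
    ext z; rw [dz]; ring
  rw [e, fderiv_const_mul ((h1 1).fun_sub ((h1 _).const_mul _)), fderiv_fun_sub (h1 1)
    ((h1 _).const_mul _), fderiv_const_mul (h1 _)]
  simp only [smul_apply, sub_apply,
    fderiv_fderiv_apply h2, smul_eq_mul]
  ring

lemma fderiv_dzb {f : ℂ → ℂ} (hf : ContDiff ℝ ∞ f) (z v : ℂ) :
    fderiv ℝ (dzb f) z v =
      (fderiv ℝ (fderiv ℝ f) z v 1 + Complex.I * fderiv ℝ (fderiv ℝ f) z v Complex.I) / 2 := by
  have h2 : ContDiffAt ℝ 2 f z := (hf.of_le (by norm_cast)).contDiffAt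
  have hd : ContDiff ℝ ∞ (fderiv ℝ f) := hf.fderiv_right (by simp)
  have h1 : ∀ w : ℂ, DifferentiableAt ℝ (fun z => fderiv ℝ f z w) z := fun w =>
    (hd.differentiable (by simp) z).clm_apply (differentiableAt_const w)
  have e : dzb f = fun z => (2⁻¹ : ℂ) * (fderiv ℝ f z 1 + Complex.I * fderiv ℝ f z Complex.I) := by
    ext z; rw [dzb]; ring
  rw [e, fderiv_const_mul ((h1 1).fun_add ((h1 _).const_mul _)), fderiv_fun_add (h1 1)
    ((h1 _).const_mul _), fderiv_const_mul (h1 _)]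
  simp only [smul_apply, add_apply,
    fderiv_fderiv_apply h2, smul_eq_mul]
  ring

lemma dz_dzb_comm {f : ℂ → ℂ} (hf : ContDiff ℝ ∞ f) (z : ℂ) : dz (dzb f) z = dzb (dz f) z := by
  have h2 : ContDiffAt ℝ 2 f z := (hf.of_le (by norm_cast)).contDiffAt
  have hs : IsSymmSndFDerivAt ℝ f z := h2.isSymmSndFDerivAt (by simp)
  have := hs.eq 1 Complex.I
  rw [dz, dzb, fderiv_dz hf, fderiv_dz hf, fderiv_dzb hf, fderiv_dzb hf, this]
  ring

lemma laplacian_ofReal {f : ℂ → ℝ} (hf : ContDiff ℝ ∞ f) (z : ℂ) :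
    ((Δ f z : ℝ) : ℂ) = 4 * dzb (dz fun z => (f z : ℂ)) z := by
  have h2 : ContDiffAt ℝ 2 f z := (hf.of_le (by norm_cast)).contDiffAt
  have hc : ContDiff ℝ ∞ (fun z => (f z : ℂ)) := Complex.ofRealCLM.contDiff.comp hf
  have hc2 : ContDiffAt ℝ 2 (fun z => (f z : ℂ)) z :=
    (hc.of_le (by norm_cast)).contDiffAt
  have e1 : ((Δ f z : ℝ) : ℂ) = Δ (fun z => (f z : ℂ)) z :=
    (h2.laplacian_CLM_comp_left (l := Complex.ofRealCLM)).symm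
  have hs : IsSymmSndFDerivAt ℝ (fun z => (f z : ℂ)) z := hc2.isSymmSndFDerivAt (by simp)
  have := hs.eq 1 Complex.I
  rw [e1, laplacian_eq_fderiv hc2, fderiv_fderiv_apply hc2, fderiv_fderiv_apply hc2, dzb,
    fderiv_dz hc, fderiv_dz hc, this]
  linear_combination (fderiv ℝ (fderiv ℝ fun z => (f z : ℂ)) z Complex.I Complex.I) *
    Complex.I_mul_I

/-! ### The quadratic differential of a conformal factor -/

section Rigidity

variable {w : ℂ → ℂ} {W : ℂ → ℂ}

lemma third_derivative_identity (hw : ContDiff ℝ ∞ w) (hW : Differentiable ℂ W)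
    (h : ∀ z, w z * dzb (dz w) z - dz w z * dzb w z = W z * conj (W z)) (z : ℂ) :
    w z * dzb (dz (dz w)) z - dz (dz w) z * dzb w z = deriv W z * conj (W z) := by
  have c1 := contDiff_dz hw
  have c2 := contDiff_dzb hw
  have e := ((((hasWirtingerAt_of_contDiff hw z).mul
    (hasWirtingerAt_of_contDiff (contDiff_dzb c1) z)).sub
    ((hasWirtingerAt_of_contDiff c1 z).mul (hasWirtingerAt_of_contDiff c2 z))))
  rw [funext h] at e
  have hd := HasWirtingerAt.of_hasDerivAt (hW z).hasDerivAt
  have := (e.unique (hd.mul hd.conjugate)).1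
  rw [dz_dzb_comm c1, dz_dzb_comm hw] at this
  simp only [map_zero] at this
  linear_combination this

/-- The equation `w w_{z z̄} - w_z w_{z̄} = |W|²` makes the quotient
`(W w_{zz} - W' w_z) / w` an entire function. -/
lemma differentiable_schwarzian (hw : ContDiff ℝ ∞ w) (hw0 : ∀ z, w z ≠ 0)
    (hW : Differentiable ℂ W)
    (h : ∀ z, w z * dzb (dz w) z - dz w z * dzb w z = W z * conj (W z)) :
    Differentiable ℂ fun z => (W z * dz (dz w) z - deriv W z * dz w z) / w z := by
  intro z
  have c1 := contDiff_dz hw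
  have hW' : Differentiable ℂ (deriv W) := (hW.contDiff (n := 2)).differentiable_deriv_two
  have hd := HasWirtingerAt.of_hasDerivAt (hW z).hasDerivAt
  have hd' := HasWirtingerAt.of_hasDerivAt (hW' z).hasDerivAt
  have e := ((hd.mul (hasWirtingerAt_of_contDiff (contDiff_dz c1) z)).sub
    (hd'.mul (hasWirtingerAt_of_contDiff c1 z))).div (hasWirtingerAt_of_contDiff hw z) (hw0 z)
  refine (HasWirtingerAt.hasDerivAt (e.congr_deriv rfl ?_)).differentiableAt
  have h3 := third_derivative_identity hw hW h z
  rw [div_eq_zero_iff]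
  left
  linear_combination W z * h3 - deriv W z * h z

lemma conj_dz_of_real {w : ℂ → ℂ} (hw : ContDiff ℝ ∞ w) (hr : ∀ z, conj (w z) = w z) (z : ℂ) :
    conj (dz w z) = dzb w z := by
  have h1 := hasWirtingerAt_of_contDiff hw z
  have h2 := h1.conjugate
  rw [funext hr] at h2
  exact (h1.unique h2).2.symm

lemma conj_dzb_of_conj {v u : ℂ → ℂ} (hv : ContDiff ℝ ∞ v) (hr : ∀ z, conj (v z) = u z)
    (z : ℂ) : conj (dzb v z) = dz u z ∧ conj (dz v z) = dzb u z := by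
  have h2 := (hasWirtingerAt_of_contDiff hv z).conjugate
  rw [funext hr] at h2
  exact ⟨h2.dz_eq.symm, h2.dzb_eq.symm⟩

lemma fderiv_eq_zero_of_wirtinger {f : ℂ → ℂ} {z : ℂ} (h : HasWirtingerAt f 0 0 z) :
    fderiv ℝ f z = 0 := by
  rw [HasFDerivAt.fderiv h]
  ext1 v; simp

/-- If the real function `w` solves the linear equation `W w_{zz} - W' w_z = K w` of which `F`
and `G` are holomorphic solutions, the sesquilinear Wronskian of `w` with `F` and `Ḡ` is a constant
multiple of `|W|²`. -/
lemma exists_wronskian_const {V : Set ℂ} (hVo : IsOpen V) (hVc : IsPreconnected V)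
    {K F G : ℂ → ℂ} (hw : ContDiff ℝ ∞ w) (hr : ∀ z, conj (w z) = w z)
    (hW : Differentiable ℂ W) (hW0 : ∀ z ∈ V, W z ≠ 0) (hK : Differentiable ℂ K)
    (hF : Differentiable ℂ F) (hG : Differentiable ℂ G)
    (ew : ∀ z, W z * dz (dz w) z - deriv W z * dz w z = K z * w z)
    (eF : ∀ z, W z * deriv (deriv F) z - deriv W z * deriv F z = K z * F z)
    (eG : ∀ z, W z * deriv (deriv G) z - deriv W z * deriv G z = K z * G z) :
    ∃ c : ℂ, ∀ z ∈ V,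
      w z * deriv F z * conj (deriv G z) - dz w z * F z * conj (deriv G z) -
        dzb w z * deriv F z * conj (G z) + dzb (dz w) z * F z * conj (G z) =
      c * (W z * conj (W z)) := by
  have c1 := contDiff_dz hw
  have c2 := contDiff_dzb hw
  have c12 := contDiff_dzb c1
  have hF' : Differentiable ℂ (deriv F) := (hF.contDiff (n := 2)).differentiable_deriv_two
  have hG' : Differentiable ℂ (deriv G) := (hG.contDiff (n := 2)).differentiable_deriv_two
  have hW' : Differentiable ℂ (deriv W) := (hW.contDiff (n := 2)).differentiable_deriv_two
  have e12 : ∀ z, W z * dzb (dz (dz w)) z - deriv W z * dzb (dz w) z = K z * dzb w z := by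
    intro z
    have h1 := ((HasWirtingerAt.of_hasDerivAt (hW z).hasDerivAt).mul
      (hasWirtingerAt_of_contDiff (contDiff_dz c1) z)).sub
      ((HasWirtingerAt.of_hasDerivAt (hW' z).hasDerivAt).mul (hasWirtingerAt_of_contDiff c1 z))
    rw [funext ew] at h1
    have h2 := (HasWirtingerAt.of_hasDerivAt (hK z).hasDerivAt).mul
      (hasWirtingerAt_of_contDiff hw z)
    have := (h1.unique h2).2
    linear_combination this
  have r1 : ∀ z, conj (dz w z) = dzb w z := conj_dz_of_real hw hr
  have r2 : ∀ z, conj (dzb w z) = dz w z := fun z => by rw [← r1, Complex.conj_conj]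
  have r12 : ∀ z, conj (dzb (dz w) z) = dzb (dz w) z := fun z => by
    rw [(conj_dzb_of_conj c1 r1 z).1, dz_dzb_comm hw]
  have r11 : ∀ z, conj (dz (dz w) z) = dzb (dzb w) z := fun z => (conj_dzb_of_conj c1 r1 z).2
  have r112 : ∀ z, conj (dzb (dz (dz w)) z) = dzb (dzb (dz w)) z := fun z => by
    rw [(conj_dzb_of_conj (contDiff_dz c1) r11 z).1, dz_dzb_comm c2]
    congr 1; ext y; exact dz_dzb_comm hw y
  have key : ∀ z ∈ V, HasWirtingerAt (fun z =>
      (w z * deriv F z * conj (deriv G z) - dz w z * F z * conj (deriv G z) -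
        dzb w z * deriv F z * conj (G z) + dzb (dz w) z * F z * conj (G z)) /
      (W z * conj (W z))) 0 0 z := by
    intro z hz
    have dF := HasWirtingerAt.of_hasDerivAt (hF z).hasDerivAt
    have dF' := HasWirtingerAt.of_hasDerivAt (hF' z).hasDerivAt
    have dG := (HasWirtingerAt.of_hasDerivAt (hG z).hasDerivAt).conjugate
    have dG' := (HasWirtingerAt.of_hasDerivAt (hG' z).hasDerivAt).conjugate
    have dW := HasWirtingerAt.of_hasDerivAt (hW z).hasDerivAt
    have w0 := hasWirtingerAt_of_contDiff hw z
    have w1 := hasWirtingerAt_of_contDiff c1 z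
    have w2 := hasWirtingerAt_of_contDiff c2 z
    have w12 := hasWirtingerAt_of_contDiff c12 z
    have hWz := hW0 z hz
    have hWc : conj (W z) ≠ 0 := (map_ne_zero _).mpr hWz
    have h := (((((w0.mul dF').mul dG').sub ((w1.mul dF).mul dG')).sub ((w2.mul dF').mul dG)).add
      ((w12.mul dF).mul dG)).div (dW.mul dW.conjugate) (mul_ne_zero hWz hWc)
    refine h.congr_deriv ?_ ?_
    · rw [div_eq_zero_iff]
      left
      rw [dz_dzb_comm hw, dz_dzb_comm c1]
      simp only [map_zero]
      linear_combination conj (W z) * (conj (deriv G z) * (w z * eF z - F z * ew z) -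
        conj (G z) * (dzb w z * eF z - F z * e12 z))
    · rw [div_eq_zero_iff]
      left
      have ewc : conj (W z) * dzb (dzb w) z - conj (deriv W z) * dzb w z = conj (K z) * w z := by
        rw [← r11, ← r1]
        have := congrArg conj (ew z)
        simpa [hr] using this
      have e12c : conj (W z) * dzb (dzb (dz w)) z - conj (deriv W z) * dzb (dz w) z =
          conj (K z) * dz w z := by
        have := congrArg conj (e12 z)
        simpa [r112, r12, r2] using this
      have eGc : conj (W z) * conj (deriv (deriv G) z) - conj (deriv W z) * conj (deriv G z) =
          conj (K z) * conj (G z) := by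
        have := congrArg conj (eG z)
        simpa using this
      linear_combination W z * (deriv F z * (w z * eGc - conj (G z) * ewc) -
        F z * (dz w z * eGc - conj (G z) * e12c))
  rcases V.eq_empty_or_nonempty with rfl | ⟨x, hx⟩
  · exact ⟨0, by simp⟩
  obtain ⟨c, hc⟩ : ∃ c : ℂ, ∀ z ∈ V,
      (w z * deriv F z * conj (deriv G z) - dz w z * F z * conj (deriv G z) -
        dzb w z * deriv F z * conj (G z) + dzb (dz w) z * F z * conj (G z)) /
      (W z * conj (W z)) = c :=
    ⟨_, fun z hz => hVo.is_const_of_fderiv_eq_zero (𝕜 := ℝ) hVc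
      (fun y hy => (HasFDerivAt.differentiableAt (key y hy)).differentiableWithinAt)
      (fun y hy => fderiv_eq_zero_of_wirtinger (key y hy)) hz hx⟩
  refine ⟨c, fun z hz => ?_⟩
  have hWz := hW0 z hz
  have hWc : conj (W z) ≠ 0 := (map_ne_zero _).mpr hWz
  rw [← hc z hz, div_mul_cancel₀ _ (mul_ne_zero hWz hWc)]

end Rigidity

end MeanField

end

noncomputable section
namespace MeanField

open Filter Topology ComplexConjugate MeasureTheory Metric

/-! ### The fundamental solution of the Laplacian -/

lemma abs_log_le_rpow {x : ℝ} (hx : 0 ≤ x) (hx1 : x ≤ 1) :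
    |Real.log x| ≤ 2 * x ^ (-(1 / 2 : ℝ)) := by
  rcases hx.eq_or_lt with rfl | h0
  · simp
  have h := Real.abs_log_mul_self_rpow_lt x (1 / 2) h0 hx1 (by norm_num)
  rw [abs_mul, abs_of_nonneg (Real.rpow_nonneg hx _)] at h
  rw [Real.rpow_neg hx, ← div_eq_mul_inv, le_div_iff₀ (Real.rpow_pos_of_pos h0 _)]
  norm_num at h ⊢
  exact h.le

lemma locallyIntegrable_log_norm : LocallyIntegrable (fun z : ℂ => Real.log ‖z‖) := by
  have h2 : (fun z : ℂ => Real.log ‖z‖) =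
      fun z => Real.log (max ‖z‖ 1) + Real.log (min ‖z‖ 1) := by
    ext z
    rcases le_total ‖z‖ 1 with h | h <;> simp [h]
  rw [h2]
  refine LocallyIntegrable.add ?_ ?_
  · refine Continuous.locallyIntegrable (Continuous.log (by fun_prop) fun z => ?_)
    positivity
  · refine locallyIntegrable_of_norm_le_rpow (C := 2) (α := 1 / 2) (by simp) (by simp; norm_num)
      (ae_of_all _ fun z => ?_)
      (Real.measurable_log.comp (by fun_prop)).aestronglyMeasurable
    rw [Real.norm_eq_abs]
    rcases le_total ‖z‖ 1 with h | h
    · rw [min_eq_left h]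
      exact abs_log_le_rpow (norm_nonneg z) h
    · rw [min_eq_right h]
      simp only [Real.log_one, abs_zero]
      positivity

lemma continuous_mul_of_tsupport {F k : ℂ → ℝ} (hk : Continuous k)
    (hF : ∀ z ∈ tsupport k, ContinuousAt F z) : Continuous fun z => F z * k z := by
  rw [continuous_iff_continuousAt]
  intro z
  by_cases hz : z ∈ tsupport k
  · exact (hF z hz).mul hk.continuousAt
  · have : (fun z => F z * k z) =ᶠ[𝓝 z] fun _ => 0 := by
      filter_upwards [notMem_tsupport_iff_eventuallyEq.mp hz] with y hy
      simp [hy]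
    exact continuousAt_const.congr this.symm

lemma integrable_mul_of_tsupport {F k : ℂ → ℝ} (hk : Continuous k) (hc : HasCompactSupport k)
    (hF : ∀ z ∈ tsupport k, ContinuousAt F z) : Integrable fun z => F z * k z :=
  (continuous_mul_of_tsupport hk hF).integrable_of_hasCompactSupport hc.mul_left

lemma integrable_mul_of_locallyIntegrable {F k : ℂ → ℝ} (hF : LocallyIntegrable F)
    (hk : Continuous k) (hc : HasCompactSupport k) : Integrable fun z => F z * k z := by
  have := hF.integrable_smul_right_of_hasCompactSupport hk hc
  exact this

lemma tsupport_fderiv_apply_subset' (ψ : ℂ → ℝ) (v : ℂ) :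
    tsupport (fun z => fderiv ℝ ψ z v) ⊆ tsupport ψ := by
  refine closure_minimal (fun z hz => ?_) (isClosed_tsupport ψ)
  refine support_fderiv_subset ℝ (f := ψ) ?_
  rw [Function.mem_support] at hz ⊢
  intro h
  exact hz (by simp [h])

lemma contDiff_fderiv_apply {ψ : ℂ → ℝ} (hψ : ContDiff ℝ ∞ ψ) (v : ℂ) :
    ContDiff ℝ ∞ fun z => fderiv ℝ ψ z v :=
  (hψ.fderiv_right (m := ∞) (by simp)).clm_apply contDiff_const

lemma contDiff_laplacian {ψ : ℂ → ℝ} (hψ : ContDiff ℝ ∞ ψ) : ContDiff ℝ ∞ (Δ ψ) := by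
  have : Δ ψ = fun z => fderiv ℝ (fun z => fderiv ℝ ψ z 1) z 1 +
      fderiv ℝ (fun z => fderiv ℝ ψ z Complex.I) z Complex.I := by
    ext z
    exact laplacian_eq_fderiv (hψ.of_le (by norm_cast)).contDiffAt
  rw [this]
  exact (contDiff_fderiv_apply (contDiff_fderiv_apply hψ _) _).add
    (contDiff_fderiv_apply (contDiff_fderiv_apply hψ _) _)

lemma tsupport_laplacian_subset (ψ : ℂ → ℝ) : tsupport (Δ ψ) ⊆ tsupport ψ := by
  refine closure_minimal (fun z hz => ?_) (isClosed_tsupport ψ)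
  by_contra h
  apply hz
  have h1 := notMem_tsupport_iff_eventuallyEq.mp h
  rw [InnerProductSpace.laplacian_congr_nhds h1 |>.self_of_nhds]
  exact congrFun (InnerProductSpace.laplacian_const (c := (0 : ℝ))) z

lemma hasCompactSupport_laplacian {ψ : ℂ → ℝ} (h : HasCompactSupport ψ) :
    HasCompactSupport (Δ ψ) :=
  h.of_isClosed_subset (isClosed_tsupport _) (tsupport_laplacian_subset ψ)

lemma integral_mul_fderiv_eq {F k : ℂ → ℝ} (hk : ContDiff ℝ ∞ k) (hc : HasCompactSupport k)
    (hF : ∀ z ∈ tsupport k, ContDiffAt ℝ 1 F z) (v : ℂ) :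
    ∫ z, F z * fderiv ℝ k z v = -∫ z, fderiv ℝ F z v * k z := by
  have hk' := contDiff_fderiv_apply hk v
  have hs := tsupport_fderiv_apply_subset' k v
  refine integral_mul_fderiv_eq_neg_fderiv_mul_of_integrable
    (integrable_mul_of_tsupport hk.continuous hc fun z hz => ?_)
    (integrable_mul_of_tsupport hk'.continuous (hc.of_isClosed_subset (isClosed_tsupport _) hs)
      fun z hz => (hF z (hs hz)).continuousAt)
    (integrable_mul_of_tsupport hk.continuous hc fun z hz => (hF z hz).continuousAt)
    (fun z hz => (hF z hz).differentiableAt (by simp))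
    (fun z _ => hk.differentiable (by simp) z)
  exact ((hF z hz).fderiv_right (m := 0) (by simp)).continuousAt.clm_apply continuousAt_const

lemma laplacian_comp_add_right {ψ : ℂ → ℝ} (hψ : ContDiff ℝ 2 ψ) (l z : ℂ) :
    Δ (fun z => ψ (z + l)) z = Δ ψ (z + l) := by
  have h2 : ContDiff ℝ 2 fun z => ψ (z + l) := hψ.comp (contDiff_id.add contDiff_const)
  rw [laplacian_eq_fderiv h2.contDiffAt, laplacian_eq_fderiv hψ.contDiffAt]
  simp only [fderiv_comp_add_right]
  rw [fderiv_comp_add_right (f := fun z => fderiv ℝ ψ z 1),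
    fderiv_comp_add_right (f := fun z => fderiv ℝ ψ z Complex.I)]

/-- Green's identity. -/
lemma integral_mul_laplacian {F ψ : ℂ → ℝ} (hψ : ContDiff ℝ ∞ ψ) (hc : HasCompactSupport ψ)
    (hF : ∀ z ∈ tsupport ψ, ContDiffAt ℝ 2 F z) :
    ∫ z, F z * Δ ψ z = ∫ z, Δ F z * ψ z := by
  have hd : ∀ v, HasCompactSupport fun z => fderiv ℝ ψ z v := fun v =>
    hc.of_isClosed_subset (isClosed_tsupport _) (tsupport_fderiv_apply_subset' ψ v)
  have hdd : ∀ v, HasCompactSupport fun z => fderiv ℝ (fun z => fderiv ℝ ψ z v) z v := fun v =>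
    (hd v).of_isClosed_subset (isClosed_tsupport _) (tsupport_fderiv_apply_subset' _ v)
  have hsub : ∀ v, tsupport (fun z => fderiv ℝ (fun z => fderiv ℝ ψ z v) z v) ⊆ tsupport ψ :=
    fun v => (tsupport_fderiv_apply_subset' _ v).trans (tsupport_fderiv_apply_subset' ψ v)
  have hF1 : ∀ v, ∀ z ∈ tsupport ψ, ContDiffAt ℝ 1 (fun z => fderiv ℝ F z v) z := fun v z hz =>
    ((hF z hz).fderiv_right (m := 1) (by norm_num)).clm_apply contDiffAt_const
  have key : ∀ v, ∫ z, F z * fderiv ℝ (fun z => fderiv ℝ ψ z v) z v =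
      ∫ z, fderiv ℝ (fun z => fderiv ℝ F z v) z v * ψ z := by
    intro v
    rw [integral_mul_fderiv_eq (contDiff_fderiv_apply hψ v) (hd v)
      (fun z hz => (hF z (tsupport_fderiv_apply_subset' ψ v hz)).of_le (by norm_num)) v,
      integral_mul_fderiv_eq hψ hc (hF1 v) v, neg_neg]
  have i1 : ∀ v, Integrable fun z => F z * fderiv ℝ (fun z => fderiv ℝ ψ z v) z v := fun v =>
    integrable_mul_of_tsupport (contDiff_fderiv_apply (contDiff_fderiv_apply hψ v) v).continuous
      (hdd v) fun z hz => (hF z (hsub v hz)).continuousAt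
  have i2 : ∀ v, Integrable fun z => fderiv ℝ (fun z => fderiv ℝ F z v) z v * ψ z := fun v =>
    integrable_mul_of_tsupport hψ.continuous hc fun z hz =>
      ((hF1 v z hz).fderiv_right (m := 0) (by simp)).continuousAt.clm_apply continuousAt_const
  have e1 : ∀ z, F z * Δ ψ z = F z * fderiv ℝ (fun z => fderiv ℝ ψ z 1) z 1 +
      F z * fderiv ℝ (fun z => fderiv ℝ ψ z Complex.I) z Complex.I := fun z => by
    rw [laplacian_eq_fderiv (hψ.of_le (by norm_cast)).contDiffAt]; ring
  have e2 : ∀ z, Δ F z * ψ z = fderiv ℝ (fun z => fderiv ℝ F z 1) z 1 * ψ z +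
      fderiv ℝ (fun z => fderiv ℝ F z Complex.I) z Complex.I * ψ z := fun z => by
    by_cases hz : z ∈ tsupport ψ
    · rw [laplacian_eq_fderiv (hF z hz)]; ring
    · simp [image_eq_zero_of_notMem_tsupport hz]
  simp only [e1, e2]
  rw [integral_add (i1 _) (i1 _), integral_add (i2 _) (i2 _), key, key]

/-- The Laplacian of the logarithm of a positive function, in terms of Wirtinger derivatives. -/
lemma laplacian_log {S : ℂ → ℝ} (hS : ContDiff ℝ ∞ S) (h0 : ∀ z, 0 < S z) {z p q r : ℂ}
    (h1 : dz (fun z => (S z : ℂ)) z = p) (h2 : dzb (fun z => (S z : ℂ)) z = q)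
    (h12 : dzb (dz fun z => (S z : ℂ)) z = r) :
    ((Δ (fun z => Real.log (S z)) z : ℝ) : ℂ) = 4 * ((S z * r - p * q) / (S z) ^ 2) := by
  have hc : ContDiff ℝ ∞ (fun z => (S z : ℂ)) := Complex.ofRealCLM.contDiff.comp hS
  have hne : ∀ z, (S z : ℂ) ≠ 0 := fun z => by exact_mod_cast (h0 z).ne'
  rw [laplacian_ofReal (hS.log fun z => (h0 z).ne')]
  have e1 : (dz fun z => ((Real.log (S z) : ℝ) : ℂ)) =
      fun z => dz (fun z => (S z : ℂ)) z / (S z : ℂ) := by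
    ext y
    have h := HasWirtingerAt.comp (φ := Complex.log) (Complex.hasDerivAt_log
      (Complex.ofReal_mem_slitPlane.mpr (h0 y))) (hasWirtingerAt_of_contDiff hc y)
    have e : (fun z => ((Real.log (S z) : ℝ) : ℂ)) = fun z => Complex.log (S z : ℂ) := by
      ext z; rw [Complex.ofReal_log (h0 z).le]
    rw [e, h.dz_eq]
    ring
  rw [e1, ((hasWirtingerAt_of_contDiff (contDiff_dz hc) z).div (hasWirtingerAt_of_contDiff hc z)
    (hne z)).dzb_eq, h12, h1, h2]
  ring

lemma ofReal_norm_sq_add (e : ℝ) (z : ℂ) : ((‖z‖ ^ 2 + e : ℝ) : ℂ) = z * conj z + e := by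
  rw [Complex.mul_conj, Complex.normSq_eq_norm_sq]
  push_cast
  ring

lemma laplacian_log_norm_sq_add {e : ℝ} (he : 0 < e) (z : ℂ) :
    Δ (fun z : ℂ => Real.log (‖z‖ ^ 2 + e)) z = 4 * e / (‖z‖ ^ 2 + e) ^ 2 := by
  have hd : ∀ z : ℂ, HasWirtingerAt (fun z : ℂ => ((‖z‖ ^ 2 + e : ℝ) : ℂ)) (conj z) z z := by
    intro z
    simp only [ofReal_norm_sq_add]
    have hid := HasWirtingerAt.of_hasDerivAt (hasDerivAt_id z)
    exact ((hid.mul hid.conjugate).add (HasWirtingerAt.const (e : ℂ))).congr_deriv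
      (by simp) (by simp)
  have hid := (HasWirtingerAt.of_hasDerivAt (hasDerivAt_id z)).conjugate
  have := laplacian_log (S := fun z : ℂ => ‖z‖ ^ 2 + e)
    ((contDiff_norm_sq ℝ).add contDiff_const) (fun z => by positivity)
    (hd z).dz_eq (hd z).dzb_eq (r := 1) (by
      rw [funext fun z => (hd z).dz_eq]
      simpa using hid.dzb_eq)
  apply Complex.ofReal_injective
  rw [this, ofReal_norm_sq_add]
  push_cast
  rw [show ((‖z‖ : ℂ) ^ 2) = z * conj z by
    rw [Complex.mul_conj, Complex.normSq_eq_norm_sq]; push_cast; ring]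
  ring

lemma integral_inv_one_add_norm_sq_sq :
    Integrable (fun z : ℂ => 2 / (1 + ‖z‖ ^ 2) ^ 2) ∧
      ∫ z : ℂ, 2 / (1 + ‖z‖ ^ 2) ^ 2 = 2 * Real.pi := by
  have hderiv : ∀ x ∈ Set.Ioi (0 : ℝ), HasDerivAt (fun y : ℝ => -(1 + y ^ 2)⁻¹)
      (x * (2 / (1 + x ^ 2) ^ 2)) x := by
    intro x _
    have h1 : HasDerivAt (fun y : ℝ => 1 + y ^ 2) (2 * x) x := by
      simpa using (hasDerivAt_pow 2 x).const_add 1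
    have h := (h1.inv (by positivity)).neg
    refine h.congr_deriv ?_
    field_simp
  have hlim : Tendsto (fun y : ℝ => -(1 + y ^ 2)⁻¹) atTop (𝓝 (-0)) := by
    refine Tendsto.neg (tendsto_inv_atTop_zero.comp ?_)
    exact tendsto_atTop_add_const_left _ _ (tendsto_pow_atTop (by norm_num))
  have hcont : ContinuousWithinAt (fun y : ℝ => -(1 + y ^ 2)⁻¹) (Set.Ici 0) 0 := by
    refine ContinuousAt.continuousWithinAt ?_
    refine ContinuousAt.neg (ContinuousAt.inv₀ (by fun_prop) (by norm_num))
  have hpos : ∀ x ∈ Set.Ioi (0 : ℝ), 0 ≤ x * (2 / (1 + x ^ 2) ^ 2) := fun x hx => by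
    have : (0 : ℝ) < x := hx
    positivity
  have hint := integrableOn_Ioi_deriv_of_nonneg hcont hderiv hpos hlim
  have hval := integral_Ioi_of_hasDerivAt_of_nonneg hcont hderiv hpos hlim
  constructor
  · have := integrable_fun_norm_addHaar (E := ℂ) volume (f := fun x : ℝ => 2 / (1 + x ^ 2) ^ 2)
    rw [this]
    simpa using hint
  · have := integral_fun_norm_addHaar (E := ℂ) volume (fun x : ℝ => 2 / (1 + x ^ 2) ^ 2)
    rw [this]
    simp only [Complex.finrank_real_complex, Nat.add_one_sub_one, pow_one, smul_eq_mul, hval]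
    simp [Measure.real, Complex.volume_ball]

/-- `log |z| / 2π` is a fundamental solution of the Laplacian. -/
lemma integral_log_norm_mul_laplacian {ψ : ℂ → ℝ} (hψ : ContDiff ℝ ∞ ψ)
    (hc : HasCompactSupport ψ) :
    ∫ z, Real.log ‖z‖ * Δ ψ z = 2 * Real.pi * ψ 0 := by
  have hL := contDiff_laplacian hψ
  have hLc := hasCompactSupport_laplacian hc
  set e : ℕ → ℝ := fun n => 1 / ((n : ℝ) + 1) with he
  have he0 : ∀ n, 0 < e n := fun n => by positivity
  have he1 : ∀ n, e n ≤ 1 := fun n => by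
    rw [he]; simp only
    rw [div_le_one (by positivity)]
    linarith [n.cast_nonneg (α := ℝ)]
  have helim : Tendsto e atTop (𝓝 0) := tendsto_one_div_add_atTop_nhds_zero_nat
  have hlog : ∀ e : ℝ, 0 < e → Continuous fun z : ℂ => Real.log (‖z‖ ^ 2 + e) := fun e he =>
    Continuous.log (by fun_prop) fun z => by positivity
  -- the logarithm is the limit of the smooth functions `log (|z|² + ε²) / 2`
  have lim1 : Tendsto (fun n => ∫ z, 1 / 2 * Real.log (‖z‖ ^ 2 + e n ^ 2) * Δ ψ z) atTop
      (𝓝 (∫ z, Real.log ‖z‖ * Δ ψ z)) := by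
    refine tendsto_integral_of_dominated_convergence
      (fun z => ‖Real.log ‖z‖ * Δ ψ z‖ + ‖1 / 2 * Real.log (‖z‖ ^ 2 + 1) * Δ ψ z‖)
      (fun n => ((continuous_const.mul (hlog _ (pow_pos (he0 n) 2))).mul
        hL.continuous).aestronglyMeasurable) ?_ (fun n => ?_) ?_
    · refine (integrable_mul_of_locallyIntegrable locallyIntegrable_log_norm hL.continuous
        hLc).norm.add (Integrable.norm ?_)
      exact integrable_mul_of_tsupport hL.continuous hLc fun z _ =>
        (continuous_const.mul (hlog 1 one_pos)).continuousAt
    · have h0 : ∀ᵐ z : ℂ, z ≠ 0 := by simp [ae_iff]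
      filter_upwards [h0] with z hz
      rw [norm_mul _ (Δ ψ z), norm_mul _ (Δ ψ z), norm_mul _ (Δ ψ z), ← add_mul]
      refine mul_le_mul_of_nonneg_right ?_ (norm_nonneg _)
      have hz' : 0 < ‖z‖ := norm_pos_iff.mpr hz
      have a1 : 2 * Real.log ‖z‖ ≤ Real.log (‖z‖ ^ 2 + e n ^ 2) := by
        rw [← Real.log_rpow hz', Real.rpow_ofNat]
        exact Real.log_le_log (by positivity) (by nlinarith [he0 n])
      have a2 : Real.log (‖z‖ ^ 2 + e n ^ 2) ≤ Real.log (‖z‖ ^ 2 + 1) :=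
        Real.log_le_log (by positivity) (by nlinarith [he0 n, he1 n])
      simp only [Real.norm_eq_abs]
      have b1 := neg_abs_le (Real.log ‖z‖)
      have b2 := le_abs_self (1 / 2 * Real.log (‖z‖ ^ 2 + 1))
      have b3 := abs_nonneg (Real.log ‖z‖)
      have b4 := abs_nonneg (1 / 2 * Real.log (‖z‖ ^ 2 + 1))
      rw [abs_le]
      constructor <;> linarith
    · have h0 : ∀ᵐ z : ℂ, z ≠ 0 := by simp [ae_iff]
      filter_upwards [h0] with z hz
      have hz' : 0 < ‖z‖ := norm_pos_iff.mpr hz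
      refine Tendsto.mul_const _ ?_
      have : Real.log ‖z‖ = 1 / 2 * Real.log (‖z‖ ^ 2 + 0 ^ 2) := by
        rw [← Real.rpow_ofNat ‖z‖ 2]
        simp
      rw [this]
      refine Tendsto.const_mul _ (Tendsto.log ?_ (by positivity))
      exact tendsto_const_nhds.add (helim.pow 2)
  have eq : ∀ n, ∫ z, 1 / 2 * Real.log (‖z‖ ^ 2 + e n ^ 2) * Δ ψ z =
      ∫ w : ℂ, 2 / (1 + ‖w‖ ^ 2) ^ 2 * ψ (e n • w) := by
    intro n
    have hs : ∀ z : ℂ, ContDiffAt ℝ 2 (fun z : ℂ => Real.log (‖z‖ ^ 2 + e n ^ 2)) z := fun z =>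
      ((contDiff_norm_sq ℝ).add contDiff_const).contDiffAt.log
        (by have := he0 n; positivity)
    have h1 := integral_mul_laplacian hψ hc (F := fun z : ℂ => Real.log (‖z‖ ^ 2 + e n ^ 2))
      fun z _ => hs z
    simp only [mul_assoc]
    rw [integral_const_mul, h1, ← integral_const_mul]
    have h2 := Measure.integral_comp_smul volume (fun z : ℂ =>
      1 / 2 * (Δ (fun z : ℂ => Real.log (‖z‖ ^ 2 + e n ^ 2)) z * ψ z)) (e n)
    have h3 : (e n) ^ 2 ≠ 0 := (pow_pos (he0 n) 2).ne'
    simp only [Complex.finrank_real_complex, smul_eq_mul, abs_inv, abs_of_pos (pow_pos (he0 n) 2)]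
      at h2
    rw [eq_comm, inv_mul_eq_iff_eq_mul₀ h3, ← integral_const_mul] at h2
    rw [h2]
    refine integral_congr_ae (ae_of_all _ fun w => ?_)
    simp only [laplacian_log_norm_sq_add (pow_pos (he0 n) 2), norm_smul, Real.norm_eq_abs,
      abs_of_pos (he0 n)]
    have : (e n * ‖w‖) ^ 2 + e n ^ 2 = e n ^ 2 * (1 + ‖w‖ ^ 2) := by ring
    rw [this]
    have h4 : 1 + ‖w‖ ^ 2 ≠ 0 := by positivity
    have h5 := (he0 n).ne'
    field_simp
    ring
  simp only [eq] at lim1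
  obtain ⟨C, hC⟩ := hψ.continuous.bounded_above_of_compact_support hc
  have lim2 : Tendsto (fun n => ∫ w : ℂ, 2 / (1 + ‖w‖ ^ 2) ^ 2 * ψ (e n • w)) atTop
      (𝓝 (∫ w : ℂ, 2 / (1 + ‖w‖ ^ 2) ^ 2 * ψ 0)) := by
    refine tendsto_integral_of_dominated_convergence
      (fun w : ℂ => 2 / (1 + ‖w‖ ^ 2) ^ 2 * C) (fun n => ?_)
      (integral_inv_one_add_norm_sq_sq.1.mul_const C) (fun n => ae_of_all _ fun w => ?_)
      (ae_of_all _ fun w => ?_)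
    · refine Continuous.aestronglyMeasurable (Continuous.mul ?_
        (hψ.continuous.comp (continuous_const_smul _)))
      exact continuous_const.div (by fun_prop) fun w => by positivity
    · rw [norm_mul, Real.norm_of_nonneg (r := 2 / (1 + ‖w‖ ^ 2) ^ 2) (by positivity)]
      exact mul_le_mul_of_nonneg_left (hC _) (by positivity)
    · refine Tendsto.const_mul _ ?_
      have : Tendsto (fun n => e n • w) atTop (𝓝 0) := by
        simpa using helim.smul_const w
      exact (hψ.continuous.tendsto 0).comp this
  rw [tendsto_nhds_unique lim1 lim2, integral_mul_const, integral_inv_one_add_norm_sq_sq.2]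

lemma deriv_dslope_mul {W : ℂ → ℂ} (hW : Differentiable ℂ W) {l : ℂ} (hl : W l = 0) :
    Differentiable ℂ (dslope W l) ∧ (∀ z, W z = (z - l) * dslope W l z) ∧
      ∀ z, deriv W z = dslope W l z + (z - l) * deriv (dslope W l) z := by
  have hd : Differentiable ℂ (dslope W l) := by
    rw [← differentiableOn_univ, Complex.differentiableOn_dslope univ_mem, differentiableOn_univ]
    exact hW
  have he : ∀ z, W z = (z - l) * dslope W l z := fun z => by
    have := sub_smul_dslope W l z
    rw [hl, sub_zero, smul_eq_mul] at this
    exact this.symm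
  refine ⟨hd, he, fun z => ?_⟩
  have h := ((hasDerivAt_id z).sub_const l).mul (hd z).hasDerivAt
  have h2 : W = (fun z => id z - l) * dslope W l := funext fun z => by simpa using he z
  have h3 := h.deriv
  rw [← h2] at h3
  rw [h3]
  simp

lemma log_norm_ae_eq {W : ℂ → ℂ} {l : ℂ} (he : ∀ z, W z = (z - l) * dslope W l z) {K : Set ℂ}
    {S : Finset ℂ} (hS : ∀ z ∈ K, W z = 0 → z ∈ S) :
    ∀ᵐ z, z ∈ K → Real.log ‖W z‖ = Real.log ‖z - l‖ + Real.log ‖dslope W l z‖ := by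
  have h0 : ∀ᵐ z : ℂ, z ∉ (S : Set ℂ) := by
    rw [ae_iff]
    simpa using S.finite_toSet.measure_zero volume
  filter_upwards [h0] with z hz hzK
  have hW : W z ≠ 0 := fun h => hz (hS z hzK h)
  rw [he] at hW
  rw [he, norm_mul, Real.log_mul (norm_ne_zero_iff.mpr (left_ne_zero_of_mul hW))
    (norm_ne_zero_iff.mpr (right_ne_zero_of_mul hW))]

/-- A holomorphic function with simple zeros in a compact set: its logarithm is integrable there,
and the distribution Laplacian of the logarithm is `2π` times the sum of the Dirac masses at the
zeros. -/
lemma integral_log_norm_of_simple_zeros {ψ : ℂ → ℝ} (hψ : ContDiff ℝ ∞ ψ)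
    (hc : HasCompactSupport ψ) (S : Finset ℂ) : ∀ W : ℂ → ℂ, Differentiable ℂ W →
    (∀ z ∈ tsupport ψ, W z = 0 → z ∈ S) → (∀ z ∈ S, W z = 0 ∧ deriv W z ≠ 0) →
    IntegrableOn (fun z => Real.log ‖W z‖) (tsupport ψ) ∧
      ∫ z, Real.log ‖W z‖ * Δ ψ z = 2 * Real.pi * ∑ l ∈ S, ψ l := by
  induction S using Finset.induction_on with
  | empty =>
    intro W hW h1 _
    have hW0 : ∀ z ∈ tsupport ψ, W z ≠ 0 := fun z hz h => by simpa using h1 z hz h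
    have hh : ∀ z ∈ tsupport ψ, InnerProductSpace.HarmonicAt (fun z => Real.log ‖W z‖) z :=
      fun z hz => (hW.analyticAt z).harmonicAt_log_norm (hW0 z hz)
    constructor
    · refine ContinuousOn.integrableOn_compact hc fun z hz => ?_
      exact (hh z hz).1.continuousAt.continuousWithinAt
    · rw [integral_mul_laplacian hψ hc fun z hz => (hh z hz).1]
      simp only [Finset.sum_empty, mul_zero]
      refine integral_eq_zero_of_ae (ae_of_all _ fun z => ?_)
      by_cases hz : z ∈ tsupport ψ
      · simp [(hh z hz).2.self_of_nhds]
      · simp [image_eq_zero_of_notMem_tsupport hz]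
  | insert l S hl ih =>
    intro W hW h1 h2
    obtain ⟨hd, he, hde⟩ := deriv_dslope_mul hW (h2 l (Finset.mem_insert_self l S)).1
    have hHl : dslope W l l ≠ 0 := by
      have := hde l
      rw [sub_self, zero_mul, add_zero] at this
      rw [← this]
      exact (h2 l (Finset.mem_insert_self l S)).2
    have hne : ∀ z ∈ S, z ≠ l := fun z hz h => hl (h ▸ hz)
    have hH0 : ∀ z ∈ S, dslope W l z = 0 := fun z hz => by
      have := (h2 z (Finset.mem_insert_of_mem hz)).1
      rw [he] at this
      exact (mul_eq_zero.mp this).resolve_left (sub_ne_zero.mpr (hne z hz))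
    obtain ⟨i1, i2⟩ := ih (dslope W l) hd (fun z hz h => by
        have hz0 : W z = 0 := by rw [he, h, mul_zero]
        refine (Finset.mem_insert.mp (h1 z hz hz0)).resolve_left fun hzl => ?_
        rw [hzl] at h
        exact hHl h)
      (fun z hz => ⟨hH0 z hz, fun h => by
        have := (h2 z (Finset.mem_insert_of_mem hz)).2
        rw [hde, hH0 z hz, h, mul_zero, add_zero] at this
        exact this rfl⟩)
    have hae := log_norm_ae_eq he (K := tsupport ψ) h1
    have hlog : LocallyIntegrable fun z : ℂ => Real.log ‖z - l‖ := by
      intro z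
      obtain ⟨t, ht, hi⟩ := locallyIntegrable_log_norm (z - l)
      refine ⟨(fun z => z - l) ⁻¹' t, (continuous_sub_right l).continuousAt ht, ?_⟩
      have hm := measurePreserving_sub_right (volume : Measure ℂ) l
      exact (hm.integrableOn_comp_preimage
        (Homeomorph.subRight l).measurableEmbedding (f := fun z => Real.log ‖z‖)).mpr hi
    have hL := contDiff_laplacian hψ
    have hKm := (isClosed_tsupport ψ).measurableSet
    have hzero : ∀ z, z ∉ tsupport ψ → Δ ψ z = 0 := fun z hz =>
      image_eq_zero_of_notMem_tsupport fun h => hz (tsupport_laplacian_subset ψ h)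
    have j2 : Integrable fun z => Real.log ‖dslope W l z‖ * Δ ψ z := by
      have := (i1.mul_continuousOn hL.continuous.continuousOn hc)
      rwa [integrableOn_iff_integrable_of_support_subset] at this
      intro z hz
      by_contra h
      exact hz (by simp [hzero z h])
    constructor
    · refine ((hlog.integrableOn_isCompact hc).add i1).congr ?_
      rw [EventuallyEq, ae_restrict_iff' hKm]
      filter_upwards [hae] with z hz hzK
      simp [hz hzK]
    · have e1 : ∫ z, Real.log ‖W z‖ * Δ ψ z = ∫ z, (Real.log ‖z - l‖ * Δ ψ z +
          Real.log ‖dslope W l z‖ * Δ ψ z) := by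
        refine integral_congr_ae ?_
        filter_upwards [hae] with z hz
        by_cases hzK : z ∈ tsupport ψ
        · rw [hz hzK]; ring
        · simp [hzero z hzK]
      rw [e1, integral_add (integrable_mul_of_locallyIntegrable hlog hL.continuous
        (hasCompactSupport_laplacian hc)) j2, i2, Finset.sum_insert hl]
      have e2 : ∫ z, Real.log ‖z - l‖ * Δ ψ z = 2 * Real.pi * ψ l := by
        rw [← integral_add_right_eq_self _ l]
        have h3 : ContDiff ℝ ∞ fun z => ψ (z + l) := hψ.comp (contDiff_id.add contDiff_const)
        have h4 := integral_log_norm_mul_laplacian h3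
          (hc.comp_homeomorph (Homeomorph.addRight l))
        rw [zero_add] at h4
        rw [← h4]
        refine integral_congr_ae (ae_of_all _ fun z => ?_)
        simp only [add_sub_cancel_right]
        rw [laplacian_comp_add_right (hψ.of_le (by norm_cast))]
      rw [e2]
      ring

end MeanField

end

noncomputable section
namespace MeanField

open Filter Topology ComplexConjugate MeasureTheory Metric

/-! ### Functions on the torus and functions on the plane -/

variable (L : PeriodPair)

lemma isAddFundamentalDomain_cell : IsAddFundamentalDomain L.lattice (cell L) volume := by
  have h := ZSpan.isAddFundamentalDomain L.basis volume
  rw [← L.lattice_eq_span_range_basis] at h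
  exact h

lemma measurableSet_cell : MeasurableSet (cell L) := ZSpan.fundamentalDomain_measurableSet _

/-- The sum of the lattice translates of a function. -/
def periodization (ψ : ℂ → ℝ) (z : ℂ) : ℝ := ∑' l : L.lattice, ψ (z + l)

lemma exists_finset_translates {ψ : ℂ → ℝ} (hc : HasCompactSupport ψ) (R : ℝ) :
    ∃ S : Finset L.lattice, ∀ z ∈ ball (0 : ℂ) R, ∀ l ∉ S, ψ (z + (l : ℂ)) = 0 := by
  obtain ⟨r, hr⟩ := hc.isCompact.isBounded.subset_closedBall 0
  have hfin := isCompact_iff_finite.mp (isCompact_closedBall (0 : L.lattice) (r + R))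
  refine ⟨hfin.toFinset, fun z hz l hl => ?_⟩
  by_contra h
  have h1 := hr (subset_tsupport _ (Function.mem_support.mpr h))
  rw [mem_closedBall_zero_iff] at h1
  rw [mem_ball_zero_iff] at hz
  apply hl
  rw [Set.Finite.mem_toFinset, mem_closedBall_zero_iff]
  have h2 : ‖(l : ℂ)‖ ≤ ‖z + l‖ + ‖z‖ := by
    simpa using norm_sub_le (z + (l : ℂ)) z
  rw [Submodule.norm_coe] at h2
  linarith

lemma periodization_eq_sum {ψ : ℂ → ℝ} {S : Finset L.lattice} {z : ℂ}
    (h : ∀ l ∉ S, ψ (z + (l : ℂ)) = 0) : periodization L ψ z = ∑ l ∈ S, ψ (z + (l : ℂ)) :=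
  tsum_eq_sum h

lemma periodization_eventuallyEq {ψ : ℂ → ℝ} {S : Finset L.lattice} {R : ℝ}
    (hS : ∀ z ∈ ball (0 : ℂ) R, ∀ l ∉ S, ψ (z + (l : ℂ)) = 0) {z : ℂ} (hz : z ∈ ball (0 : ℂ) R) :
    periodization L ψ =ᶠ[𝓝 z] fun z => ∑ l ∈ S, ψ (z + (l : ℂ)) := by
  filter_upwards [isOpen_ball.mem_nhds hz] with y hy
  exact periodization_eq_sum L (hS y hy)

lemma contDiff_periodization {ψ : ℂ → ℝ} (hψ : ContDiff ℝ ∞ ψ) (hc : HasCompactSupport ψ) :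
    ContDiff ℝ ∞ (periodization L ψ) := by
  rw [contDiff_iff_contDiffAt]
  intro z
  obtain ⟨S, hS⟩ := exists_finset_translates L hc (‖z‖ + 1)
  refine ContDiffAt.congr_of_eventuallyEq ?_ (periodization_eventuallyEq L hS (z := z) (by simp))
  exact (ContDiff.sum fun l _ => hψ.comp (contDiff_id.add contDiff_const)).contDiffAt

lemma isPeriodic_periodization (ψ : ℂ → ℝ) : IsPeriodic L (periodization L ψ) := by
  intro l hl z
  rw [periodization, periodization,
    ← (Equiv.addLeft (⟨l, hl⟩ : L.lattice)).tsum_eq fun m => ψ (z + (m : ℂ))]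
  simp [add_assoc]

lemma laplacian_sum {ι : Type*} (S : Finset ι) {f : ι → ℂ → ℝ} (hf : ∀ i, ContDiff ℝ 2 (f i))
    (z : ℂ) : Δ (fun z => ∑ i ∈ S, f i z) z = ∑ i ∈ S, Δ (f i) z := by
  classical
  induction S using Finset.induction_on with
  | empty => exact congrFun (InnerProductSpace.laplacian_const (c := (0 : ℝ))) z
  | insert i S hi ih =>
    simp only [Finset.sum_insert hi]
    have h : ContDiff ℝ 2 fun z => ∑ i ∈ S, f i z := ContDiff.sum fun i _ => hf i
    have := (hf i).contDiffAt.laplacian_add (x := z) h.contDiffAt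
    rw [← ih, ← this]
    rfl

lemma laplacian_periodization {ψ : ℂ → ℝ} (hψ : ContDiff ℝ ∞ ψ) (hc : HasCompactSupport ψ)
    (z : ℂ) : Δ (periodization L ψ) z = periodization L (Δ ψ) z := by
  obtain ⟨S, hS⟩ := exists_finset_translates L hc (‖z‖ + 1)
  have hz : z ∈ ball (0 : ℂ) (‖z‖ + 1) := by simp
  have hψ2 : ContDiff ℝ 2 ψ := hψ.of_le (by norm_cast)
  rw [(InnerProductSpace.laplacian_congr_nhds
    (periodization_eventuallyEq L hS hz)).self_of_nhds, laplacian_sum S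
    (f := fun l z => ψ (z + (l : ℂ))) (fun l => hψ2.comp (contDiff_id.add contDiff_const)),
    periodization_eq_sum L (S := S)]
  · exact Finset.sum_congr rfl fun l _ => laplacian_comp_add_right hψ2 _ _
  · intro l hl
    have h0 : (fun z => ψ (z + (l : ℂ))) =ᶠ[𝓝 z] fun _ => 0 := by
      filter_upwards [isOpen_ball.mem_nhds hz] with y hy
      exact hS y hy l hl
    rw [← laplacian_comp_add_right hψ2, (InnerProductSpace.laplacian_congr_nhds h0).self_of_nhds]
    exact congrFun (InnerProductSpace.laplacian_const (c := (0 : ℝ))) z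

variable {L} in
/-- Unfolding: the integral of a periodic function against a function on the plane. -/
lemma integral_mul_eq_setIntegral_cell {h k : ℂ → ℝ} (hp : IsPeriodic L h)
    (hl : LocallyIntegrable h) (hk : Continuous k) (hc : HasCompactSupport k) :
    ∫ z, h z * k z = ∫ z in cell L, h z * periodization L k z := by
  obtain ⟨R, hR⟩ := (isBounded_cell L).subset_ball 0
  obtain ⟨S, hS⟩ := exists_finset_translates L hc R
  have hint := integrable_mul_of_locallyIntegrable hl hk hc
  have : VAddInvariantMeasure L.lattice ℂ volume :=
    inferInstanceAs (VAddInvariantMeasure L.lattice.toAddSubgroup ℂ volume)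
  rw [(isAddFundamentalDomain_cell L).integral_eq_tsum'' _ hint]
  have e1 : ∀ l : L.lattice, ∫ z in cell L, h (l +ᵥ z) * k (l +ᵥ z) =
      ∫ z in cell L, h z * k (z + (l : ℂ)) := fun l => by
    refine integral_congr_ae (ae_of_all _ fun z => ?_)
    simp only [Submodule.vadd_def, vadd_eq_add]
    rw [add_comm, hp l l.2]
  simp only [e1]
  rw [tsum_eq_sum (s := S)]
  · rw [← integral_finsetSum]
    · refine setIntegral_congr_fun (measurableSet_cell L) fun z hz => ?_
      rw [periodization_eq_sum L (hS z (hR hz)), Finset.mul_sum]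
    · intro l _
      exact (integrable_mul_of_locallyIntegrable hl (hk.comp (continuous_add_const _))
        (hc.comp_homeomorph (Homeomorph.addRight (l : ℂ)))).integrableOn
  · intro l hl
    refine setIntegral_eq_zero_of_forall_eq_zero fun z hz => ?_
    rw [hS z (hR hz) l hl, mul_zero]

variable {L} in
/-- Every smooth function on the torus is a sum of translates of a test function on the plane. -/
lemma exists_periodization_eq {φ : ℂ → ℝ} (hφ : ContDiff ℝ ∞ φ) (hp : IsPeriodic L φ) :
    ∃ ψ : ℂ → ℝ, ContDiff ℝ ∞ ψ ∧ HasCompactSupport ψ ∧ periodization L ψ = φ := by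
  obtain ⟨R, hR⟩ := (isBounded_cell L).subset_ball 0
  let χ : ContDiffBump (0 : ℂ) := ⟨max R 1, max R 1 + 1, by positivity, by linarith⟩
  have hχ : ContDiff ℝ ∞ χ := χ.contDiff
  have hχc : HasCompactSupport χ := χ.hasCompactSupport
  have hpos : ∀ z, 0 < periodization L χ z := by
    intro z
    obtain ⟨l, hl, hz⟩ := exists_sub_mem_cell L z
    obtain ⟨S, hS⟩ := exists_finset_translates L hχc (‖z‖ + 1)
    have h1 : χ (z + ((⟨-l, neg_mem hl⟩ : L.lattice) : ℂ)) = 1 := by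
      refine χ.one_of_mem_closedBall ?_
      have := hR hz
      rw [mem_ball_zero_iff] at this
      rw [mem_closedBall_zero_iff]
      rw [← sub_eq_add_neg]
      exact this.le.trans (le_max_left R 1)
    rw [periodization_eq_sum L (hS z (by simp))]
    refine Finset.sum_pos' (fun l _ => χ.nonneg) ⟨⟨-l, neg_mem hl⟩, ?_, by rw [h1]; exact one_pos⟩
    by_contra hn
    rw [hS z (by simp) _ hn] at h1
    exact zero_ne_one h1
  have hcd := contDiff_periodization L hχ hχc
  refine ⟨fun z => χ z * (φ z / periodization L χ z),
    hχ.mul (hφ.div hcd fun z => (hpos z).ne'), hχc.mul_right, ?_⟩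
  ext z
  have : ∀ l : L.lattice, χ (z + l) * (φ (z + l) / periodization L χ (z + l)) =
      χ (z + l) * (φ z / periodization L χ z) := fun l => by
    rw [hp l l.2, isPeriodic_periodization L χ l l.2]
  rw [periodization, tsum_congr this, tsum_mul_right]
  exact mul_div_cancel₀ _ (hpos z).ne'

variable {L} {ρ : ℝ} {u : ℂ → ℝ}

lemma integral_test_periodization (hp : IsPeriodic L u) (hu : LocallyIntegrable u)
    (he : LocallyIntegrable fun z => Real.exp (u z)) {ψ : ℂ → ℝ} (hψ : ContDiff ℝ ∞ ψ)
    (hc : HasCompactSupport ψ) :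
    ∫ z, (u z * Δ ψ z + ρ * Real.exp (u z) * ψ z) =
      ∫ z in cell L, (u z * Δ (periodization L ψ) z +
        ρ * Real.exp (u z) * periodization L ψ z) := by
  have hL := contDiff_laplacian hψ
  have hLc := hasCompactSupport_laplacian hc
  have hper := contDiff_periodization L hψ hc
  have hK : IsCompact (closure (cell L)) := (isBounded_cell L).isCompact_closure
  have hloc : ∀ f g : ℂ → ℝ, LocallyIntegrable f → Continuous g →
      IntegrableOn (fun z => f z * g z) (cell L) := fun f g hf hg =>
    ((hf.integrableOn_isCompact hK).mul_continuousOn hg.continuousOn hK).mono_set subset_closure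
  simp only [mul_assoc ρ]
  rw [integral_add (integrable_mul_of_locallyIntegrable hu hL.continuous hLc)
    ((integrable_mul_of_locallyIntegrable he hψ.continuous hc).const_mul ρ),
    integral_add (hloc _ _ hu (contDiff_laplacian hper).continuous)
    ((hloc _ _ he hper.continuous).const_mul ρ), integral_const_mul, integral_const_mul,
    integral_mul_eq_setIntegral_cell hp hu hL.continuous hLc,
    integral_mul_eq_setIntegral_cell (fun l hl z => by rw [hp l hl]) he hψ.continuous hc]
  simp only [laplacian_periodization L hψ hc]

lemma IsSolution.integral_test (h : IsSolution L ρ u) {ψ : ℂ → ℝ} (hψ : ContDiff ℝ ∞ ψ)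
    (hc : HasCompactSupport ψ) :
    ∫ z, (u z * Δ ψ z + ρ * Real.exp (u z) * ψ z) = ρ * periodization L ψ 0 := by
  rw [integral_test_periodization h.periodic h.locallyIntegrable h.locallyIntegrable_exp hψ hc]
  exact h.weak _ (contDiff_periodization L hψ hc) (isPeriodic_periodization L ψ)

lemma isSolution_of_integral_test (hp : IsPeriodic L u) (hu : LocallyIntegrable u)
    (he : LocallyIntegrable fun z => Real.exp (u z))
    (h : ∀ ψ : ℂ → ℝ, ContDiff ℝ ∞ ψ → HasCompactSupport ψ →
      ∫ z, (u z * Δ ψ z + ρ * Real.exp (u z) * ψ z) = ρ * periodization L ψ 0) :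
    IsSolution L ρ u := by
  refine ⟨hp, hu, he, fun φ hφ hφp => ?_⟩
  obtain ⟨ψ, hψ, hc, rfl⟩ := exists_periodization_eq hφ hφp
  rw [← h ψ hψ hc, integral_test_periodization hp hu he hψ hc]

end MeanField

end

noncomputable section
namespace MeanField

open Filter Topology ComplexConjugate MeasureTheory Metric

/-! ### The explicit solution -/

/-- `|A|² + |B|²`, the denominator of the pull-back of the spherical metric by `A / B`. -/
def pairNorm (A B : ℂ → ℂ) (z : ℂ) : ℝ := ‖A z‖ ^ 2 + ‖B z‖ ^ 2

/-- The conformal factor `(2 / π) |f'|² / (1 + |f|²)²` of `f = A / B`, written without poles. -/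
def conformalFactor (A B : ℂ → ℂ) (z : ℂ) : ℝ :=
  2 / Real.pi * (‖wronskian A B z‖ ^ 2 / pairNorm A B z ^ 2)

lemma differentiable_wronskian {A B : ℂ → ℂ} (hA : Differentiable ℂ A) (hB : Differentiable ℂ B) :
    Differentiable ℂ (wronskian A B) := by
  have hA' : Differentiable ℂ (deriv A) := (hA.contDiff (n := 2)).differentiable_deriv_two
  have hB' : Differentiable ℂ (deriv B) := (hB.contDiff (n := 2)).differentiable_deriv_two
  exact (hA'.mul hB).sub (hA.mul hB')

lemma contDiff_norm_sq_comp {A : ℂ → ℂ} (hA : Differentiable ℂ A) :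
    ContDiff ℝ ∞ fun z => ‖A z‖ ^ 2 :=
  (contDiff_norm_sq ℝ).comp ((hA.contDiff (n := ∞)).restrict_scalars ℝ)

lemma ofReal_pairNorm (A B : ℂ → ℂ) (z : ℂ) :
    (pairNorm A B z : ℂ) = A z * conj (A z) + B z * conj (B z) := by
  rw [pairNorm, Complex.mul_conj, Complex.mul_conj, Complex.normSq_eq_norm_sq,
    Complex.normSq_eq_norm_sq]
  push_cast
  ring

section

variable {A B : ℂ → ℂ} (hA : Differentiable ℂ A) (hB : Differentiable ℂ B)
include hA hB

lemma contDiff_pairNorm : ContDiff ℝ ∞ (pairNorm A B) :=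
  (contDiff_norm_sq_comp hA).add (contDiff_norm_sq_comp hB)

lemma hasWirtingerAt_pairNorm (z : ℂ) : HasWirtingerAt (fun z => (pairNorm A B z : ℂ))
    (deriv A z * conj (A z) + deriv B z * conj (B z))
    (A z * conj (deriv A z) + B z * conj (deriv B z)) z := by
  simp only [ofReal_pairNorm]
  have dA := HasWirtingerAt.of_hasDerivAt (hA z).hasDerivAt
  have dB := HasWirtingerAt.of_hasDerivAt (hB z).hasDerivAt
  exact ((dA.mul dA.conjugate).add (dB.mul dB.conjugate)).congr_deriv (by simp) (by simp)

lemma hasWirtingerAt_dz_pairNorm (z : ℂ) : HasWirtingerAt (dz fun z => (pairNorm A B z : ℂ))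
    (deriv (deriv A) z * conj (A z) + deriv (deriv B) z * conj (B z))
    (deriv A z * conj (deriv A z) + deriv B z * conj (deriv B z)) z := by
  rw [funext fun z => (hasWirtingerAt_pairNorm hA hB z).dz_eq]
  have hA' : Differentiable ℂ (deriv A) := (hA.contDiff (n := 2)).differentiable_deriv_two
  have hB' : Differentiable ℂ (deriv B) := (hB.contDiff (n := 2)).differentiable_deriv_two
  have dA := HasWirtingerAt.of_hasDerivAt (hA z).hasDerivAt
  have dB := HasWirtingerAt.of_hasDerivAt (hB z).hasDerivAt
  have dA' := HasWirtingerAt.of_hasDerivAt (hA' z).hasDerivAt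
  have dB' := HasWirtingerAt.of_hasDerivAt (hB' z).hasDerivAt
  exact ((dA'.mul dA.conjugate).add (dB'.mul dB.conjugate)).congr_deriv (by simp) (by simp)

/-- `w = |A|² + |B|²` solves `w w_{z z̄} - w_z w_{z̄} = |W|²`. -/
lemma pairNorm_equation (z : ℂ) :
    (pairNorm A B z : ℂ) * dzb (dz fun z => (pairNorm A B z : ℂ)) z -
      dz (fun z => (pairNorm A B z : ℂ)) z * dzb (fun z => (pairNorm A B z : ℂ)) z =
      wronskian A B z * conj (wronskian A B z) := by
  rw [(hasWirtingerAt_dz_pairNorm hA hB z).dzb_eq, (hasWirtingerAt_pairNorm hA hB z).dz_eq,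
    (hasWirtingerAt_pairNorm hA hB z).dzb_eq, ofReal_pairNorm, wronskian]
  simp only [map_sub, map_mul]
  ring

lemma laplacian_log_pairNorm (h0 : ∀ z, 0 < pairNorm A B z) (z : ℂ) :
    Δ (fun z => Real.log (pairNorm A B z)) z =
      4 * (‖wronskian A B z‖ ^ 2 / pairNorm A B z ^ 2) := by
  apply Complex.ofReal_injective
  rw [laplacian_log (contDiff_pairNorm hA hB) h0 rfl rfl rfl, pairNorm_equation hA hB,
    Complex.mul_conj, Complex.normSq_eq_norm_sq]
  push_cast
  ring

lemma contDiff_conformalFactor (h0 : ∀ z, 0 < pairNorm A B z) :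
    ContDiff ℝ ∞ (conformalFactor A B) :=
  contDiff_const.mul ((contDiff_norm_sq_comp (differentiable_wronskian hA hB)).div
    ((contDiff_pairNorm hA hB).pow 2) fun z => (pow_pos (h0 z) 2).ne')

end

lemma conformalFactor_nonneg (A B : ℂ → ℂ) (z : ℂ) : 0 ≤ conformalFactor A B z := by
  unfold conformalFactor
  positivity

lemma conformalFactor_congr {A B : ℂ → ℂ} {z z' t : ℂ} (ht : t ≠ 0)
    (h1 : pairNorm A B z' = ‖t‖ ^ 2 * pairNorm A B z)
    (h2 : ‖wronskian A B z'‖ = ‖t‖ ^ 2 * ‖wronskian A B z‖) :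
    conformalFactor A B z' = conformalFactor A B z := by
  have : ‖t‖ ^ 2 ≠ 0 := pow_ne_zero _ (norm_ne_zero_iff.mpr ht)
  rw [conformalFactor, conformalFactor, h1, h2, mul_pow, mul_pow, mul_div_mul_left]
  exact pow_ne_zero _ this

lemma conformalFactor_eq_zero_iff {A B : ℂ → ℂ} (h0 : ∀ z, 0 < pairNorm A B z) (z : ℂ) :
    conformalFactor A B z = 0 ↔ wronskian A B z = 0 := by
  have := (h0 z).ne'
  have := Real.pi_ne_zero
  simp [conformalFactor, *]

lemma ae_notMem_lattice (L : PeriodPair) : ∀ᵐ z : ℂ, z ∉ L.lattice := by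
  rw [ae_iff]
  simpa using (countable_lattice L).measure_zero volume

namespace IsDevelopingPair

variable {L : PeriodPair} {A B : ℂ → ℂ} (h : IsDevelopingPair L A B)
include h

lemma pairNorm_pos (z : ℂ) : 0 < pairNorm A B z := by
  rw [pairNorm]
  by_cases hA : A z = 0
  · have := norm_pos_iff.mpr (h.disjoint z hA)
    positivity
  · have := norm_pos_iff.mpr hA
    positivity

lemma dense_regular : Dense {z : ℂ | A z * B z ≠ 0} := by
  have hs : {z : ℂ | A z * B z ≠ 0} = (fun z => z + L.ω₁ / 2) ⁻¹' ((L.lattice : Set ℂ)ᶜ) := by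
    ext z
    simp [h.zeros]
  rw [hs]
  exact (dense_compl_lattice L).preimage (Homeomorph.addRight (L.ω₁ / 2)).isOpenMap

lemma eq_of_regular {α : Type*} [TopologicalSpace α] [T2Space α] {f g : ℂ → α}
    (hf : Continuous f) (hg : Continuous g) (e : ∀ z, A z * B z ≠ 0 → f z = g z) (z : ℂ) :
    f z = g z :=
  congrFun (hf.ext_on h.dense_regular hg e) z

lemma continuous_conformalFactor : Continuous (conformalFactor A B) :=
  (contDiff_conformalFactor h.diffA h.diffB h.pairNorm_pos).continuous

/-- At regular points the pair is multiplied by a scalar, up to sign, under `z ↦ z + ω₁`. -/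
lemma exists_factor_ω₁ {z : ℂ} (hz : A z * B z ≠ 0) : ∃ t : ℂ, t ≠ 0 ∧
    A (z + L.ω₁) = -(t * A z) ∧ B (z + L.ω₁) = t * B z ∧
      wronskian A B (z + L.ω₁) = -(t ^ 2 * wronskian A B z) := by
  have hA := left_ne_zero_of_mul hz
  have hB := right_ne_zero_of_mul hz
  have e1 : B (z + L.ω₁) = B (z + L.ω₁) / B z * B z := (div_mul_cancel₀ _ hB).symm
  have e2 : A (z + L.ω₁) = -(B (z + L.ω₁) / B z * A z) := by
    have := h.add_ω₁ z
    field_simp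
    linear_combination this
  refine ⟨B (z + L.ω₁) / B z, fun h0 => ?_, e2, e1, ?_⟩
  · rw [h0, zero_mul] at e1 e2
    rw [neg_zero] at e2
    exact h.disjoint _ e2 e1
  · have := h.wronskian_add_ω₁ z
    apply mul_right_cancel₀ hz
    rw [this]
    nth_rw 1 [e2]
    nth_rw 2 [e1]
    ring

lemma exists_factor_ω₂ {z : ℂ} (hz : A z * B z ≠ 0) : ∃ t : ℂ, t ≠ 0 ∧
    A (z + L.ω₂) = t * B z ∧ B (z + L.ω₂) = t * A z ∧
      wronskian A B (z + L.ω₂) = -(t ^ 2 * wronskian A B z) := by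
  have hA := left_ne_zero_of_mul hz
  have hB := right_ne_zero_of_mul hz
  have e1 : B (z + L.ω₂) = B (z + L.ω₂) / A z * A z := (div_mul_cancel₀ _ hA).symm
  have e2 : A (z + L.ω₂) = B (z + L.ω₂) / A z * B z := by
    have := h.add_ω₂ z
    field_simp
    linear_combination this
  refine ⟨B (z + L.ω₂) / A z, fun h0 => ?_, e2, e1, ?_⟩
  · rw [h0, zero_mul] at e1 e2
    exact h.disjoint _ e2 e1
  · have := h.wronskian_add_ω₂ z
    apply mul_right_cancel₀ hz
    rw [this]
    nth_rw 1 [e2]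
    nth_rw 2 [e1]
    ring

lemma exists_factor_neg {z : ℂ} (hz : A z * B z ≠ 0) : ∃ t : ℂ, t ≠ 0 ∧
    A (-z) = t * A z ∧ B (-z) = t * B z ∧
      wronskian A B (-z) = -(t ^ 2 * wronskian A B z) := by
  have hA := left_ne_zero_of_mul hz
  have hB := right_ne_zero_of_mul hz
  have e1 : B (-z) = B (-z) / B z * B z := (div_mul_cancel₀ _ hB).symm
  have e2 : A (-z) = B (-z) / B z * A z := by
    have := h.even z
    field_simp
    linear_combination this
  refine ⟨B (-z) / B z, fun h0 => ?_, e2, e1, ?_⟩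
  · rw [h0, zero_mul] at e1 e2
    exact h.disjoint _ e2 e1
  · have d1 := (hasDerivAt_comp_neg (h.diffA (-z)).hasDerivAt).mul (h.diffB z).hasDerivAt
    have d2 := (h.diffA z).hasDerivAt.mul (hasDerivAt_comp_neg (h.diffB (-z)).hasDerivAt)
    have e : ((fun z => A (-z)) * B) = (A * fun z => B (-z)) := funext h.even
    rw [e] at d1
    have d := d1.unique d2
    generalize B (-z) / B z = t at e1 e2
    rw [e1, e2] at d
    rw [wronskian, e1, e2, wronskian]
    linear_combination -t * d

lemma isPeriodic_conformalFactor : IsPeriodic L (conformalFactor A B) := by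
  have hc := h.continuous_conformalFactor
  refine periodic_of_generators L
    (h.eq_of_regular (hc.comp (continuous_add_const _)) hc fun z hz => ?_)
    (h.eq_of_regular (hc.comp (continuous_add_const _)) hc fun z hz => ?_)
  · obtain ⟨t, ht, e1, e2, e3⟩ := h.exists_factor_ω₁ hz
    refine conformalFactor_congr ht ?_ ?_
    · rw [pairNorm, pairNorm, e1, e2, norm_neg, norm_mul, norm_mul]; ring
    · rw [e3, norm_neg, norm_mul, norm_pow]
  · obtain ⟨t, ht, e1, e2, e3⟩ := h.exists_factor_ω₂ hz
    refine conformalFactor_congr ht ?_ ?_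
    · rw [pairNorm, pairNorm, e1, e2, norm_mul, norm_mul]; ring
    · rw [e3, norm_neg, norm_mul, norm_pow]

lemma conformalFactor_neg (z : ℂ) : conformalFactor A B (-z) = conformalFactor A B z := by
  have hc := h.continuous_conformalFactor
  refine h.eq_of_regular (f := fun z => conformalFactor A B (-z)) (hc.comp continuous_neg) hc
    (fun z hz => ?_) z
  obtain ⟨t, ht, e1, e2, e3⟩ := h.exists_factor_neg hz
  refine conformalFactor_congr ht ?_ ?_
  · rw [pairNorm, pairNorm, e1, e2, norm_mul, norm_mul]; ring
  · rw [e3, norm_neg, norm_mul, norm_pow]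

lemma conformalFactor_pos {z : ℂ} (hz : z ∉ L.lattice) : 0 < conformalFactor A B z := by
  refine (conformalFactor_nonneg A B z).lt_of_ne' fun h0 => hz ?_
  rwa [conformalFactor_eq_zero_iff h.pairNorm_pos, h.wronskian_eq_zero] at h0

lemma exp_log_ae_eq : (fun z => Real.exp (Real.log (conformalFactor A B z))) =ᵐ[volume]
    conformalFactor A B := by
  filter_upwards [ae_notMem_lattice L] with z hz
  exact Real.exp_log (h.conformalFactor_pos hz)

lemma log_conformalFactor_ae_eq : (fun z => Real.log (conformalFactor A B z)) =ᵐ[volume]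
    fun z => Real.log (2 / Real.pi) + 2 * Real.log ‖wronskian A B z‖ -
      2 * Real.log (pairNorm A B z) := by
  filter_upwards [ae_notMem_lattice L] with z hz
  have hW : ‖wronskian A B z‖ ≠ 0 := norm_ne_zero_iff.mpr ((h.wronskian_eq_zero z).not.mpr hz)
  have hT := (h.pairNorm_pos z).ne'
  rw [conformalFactor, Real.log_mul (by positivity) (by positivity),
    Real.log_div (x := ‖_‖ ^ 2) (by positivity) (by positivity), Real.log_pow, Real.log_pow]
  push_cast
  ring

lemma integral_log_norm_wronskian {ψ : ℂ → ℝ} (hψ : ContDiff ℝ ∞ ψ) (hc : HasCompactSupport ψ) :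
    IntegrableOn (fun z => Real.log ‖wronskian A B z‖) (tsupport ψ) ∧
      ∫ z, Real.log ‖wronskian A B z‖ * Δ ψ z = 2 * Real.pi * periodization L ψ 0 := by
  obtain ⟨r, hr⟩ := hc.isCompact.isBounded.subset_closedBall 0
  have hfin := isCompact_iff_finite.mp (isCompact_closedBall (0 : L.lattice) r)
  set S := hfin.toFinset with hS
  have hmem : ∀ l : L.lattice, (l : ℂ) ∈ tsupport ψ → l ∈ S := fun l hl => by
    rw [hS, Set.Finite.mem_toFinset, mem_closedBall_zero_iff, ← Submodule.norm_coe]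
    exact mem_closedBall_zero_iff.mp (hr hl)
  have := integral_log_norm_of_simple_zeros hψ hc (S.map (Function.Embedding.subtype _))
    (wronskian A B) (differentiable_wronskian h.diffA h.diffB)
    (fun z hz h0 => by
      rw [h.wronskian_eq_zero] at h0
      exact Finset.mem_map.mpr ⟨⟨z, h0⟩, hmem _ hz, rfl⟩)
    (fun z hz => by
      obtain ⟨l, _, rfl⟩ := Finset.mem_map.mp hz
      exact ⟨(h.wronskian_eq_zero _).mpr l.2, h.deriv_wronskian _ l.2⟩)
  rw [Finset.sum_map] at this
  refine ⟨this.1, ?_⟩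
  rw [this.2, periodization_eq_sum L (S := S)]
  · simp
  · intro l hl
    refine image_eq_zero_of_notMem_tsupport fun h0 => hl (hmem l ?_)
    simpa using h0

lemma locallyIntegrable_log_norm_wronskian :
    LocallyIntegrable fun z => Real.log ‖wronskian A B z‖ := by
  rw [locallyIntegrable_iff]
  intro K hK
  obtain ⟨r, hr⟩ := hK.isBounded.subset_closedBall 0
  let χ : ContDiffBump (0 : ℂ) := ⟨max r 1, max r 1 + 1, by positivity, by linarith⟩
  refine (h.integral_log_norm_wronskian χ.contDiff χ.hasCompactSupport).1.mono_set fun z hz => ?_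
  rw [χ.tsupport_eq]
  exact closedBall_subset_closedBall ((le_max_left r 1).trans (by linarith)) (hr hz)

lemma locallyIntegrable_log_conformalFactor :
    LocallyIntegrable fun z => Real.log (conformalFactor A B z) := by
  refine LocallyIntegrable.congr (f := fun z => Real.log (2 / Real.pi) +
    2 * Real.log ‖wronskian A B z‖ - 2 * Real.log (pairNorm A B z)) ?_
    h.log_conformalFactor_ae_eq.symm
  refine (LocallyIntegrable.add continuous_const.locallyIntegrable
    (h.locallyIntegrable_log_norm_wronskian.smul (2 : ℝ))).sub (Continuous.locallyIntegrable ?_)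
  exact continuous_const.mul ((contDiff_pairNorm h.diffA h.diffB).continuous.log
    fun z => (h.pairNorm_pos z).ne')

/-- The logarithm of the conformal factor solves the mean field equation. -/
lemma isSolution_log_conformalFactor :
    IsSolution L (4 * Real.pi) fun z => Real.log (conformalFactor A B z) := by
  have hU := contDiff_conformalFactor h.diffA h.diffB h.pairNorm_pos
  refine isSolution_of_integral_test (fun l hl z => by rw [h.isPeriodic_conformalFactor l hl])
    h.locallyIntegrable_log_conformalFactor
    (hU.continuous.locallyIntegrable.congr h.exp_log_ae_eq.symm) fun ψ hψ hc => ?_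
  have hL := (contDiff_laplacian hψ).continuous
  have hLc := hasCompactSupport_laplacian hc
  have hlT : ContDiff ℝ ∞ fun z => Real.log (pairNorm A B z) :=
    (contDiff_pairNorm h.diffA h.diffB).log fun z => (h.pairNorm_pos z).ne'
  have hlT2 : ContDiff ℝ 2 fun z => Real.log (pairNorm A B z) := hlT.of_le (by norm_cast)
  have g0 : ∫ z, Real.log (2 / Real.pi) * Δ ψ z = 0 := by
    rw [integral_mul_laplacian (F := fun _ => Real.log (2 / Real.pi)) hψ hc
      fun z _ => contDiffAt_const]
    simp [InnerProductSpace.laplacian_const]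
  have g1 := integral_mul_laplacian hψ hc fun z _ => hlT2.contDiffAt (x := z)
  simp only [laplacian_log_pairNorm h.diffA h.diffB h.pairNorm_pos] at g1
  have i0 : Integrable fun z => Real.log (2 / Real.pi) * Δ ψ z :=
    integrable_mul_of_locallyIntegrable continuous_const.locallyIntegrable hL hLc
  have i1 := integrable_mul_of_locallyIntegrable h.locallyIntegrable_log_norm_wronskian hL hLc
  have i2 := integrable_mul_of_locallyIntegrable hlT.continuous.locallyIntegrable hL hLc
  have i3 := integrable_mul_of_locallyIntegrable hU.continuous.locallyIntegrable hψ.continuous hc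
  have e : ∫ z, (Real.log (conformalFactor A B z) * Δ ψ z +
      4 * Real.pi * Real.exp (Real.log (conformalFactor A B z)) * ψ z) =
      ∫ z, (Real.log (2 / Real.pi) * Δ ψ z + 2 * (Real.log ‖wronskian A B z‖ * Δ ψ z) -
        2 * (Real.log (pairNorm A B z) * Δ ψ z) +
        4 * Real.pi * (conformalFactor A B z * ψ z)) := by
    refine integral_congr_ae ?_
    filter_upwards [h.exp_log_ae_eq, h.log_conformalFactor_ae_eq] with z h1 h2
    rw [h1, h2]
    ring
  have j1 : Integrable fun z => Real.log (2 / Real.pi) * Δ ψ z +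
      2 * (Real.log ‖wronskian A B z‖ * Δ ψ z) := i0.add (i1.const_mul 2)
  have j2 : Integrable fun z => Real.log (2 / Real.pi) * Δ ψ z +
      2 * (Real.log ‖wronskian A B z‖ * Δ ψ z) - 2 * (Real.log (pairNorm A B z) * Δ ψ z) :=
    j1.sub (i2.const_mul 2)
  rw [e, integral_add j2 (i3.const_mul _), integral_sub j1 (i2.const_mul 2),
    integral_add i0 (i1.const_mul 2),
    g0, integral_const_mul, integral_const_mul, integral_const_mul, g1,
    (h.integral_log_norm_wronskian hψ hc).2]
  have e2 : ∫ z, conformalFactor A B z * ψ z =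
      1 / (2 * Real.pi) * ∫ z, 4 * (‖wronskian A B z‖ ^ 2 / pairNorm A B z ^ 2) * ψ z := by
    rw [← integral_const_mul]
    refine integral_congr_ae (ae_of_all _ fun z => ?_)
    simp only [conformalFactor]
    field_simp
    ring
  rw [e2]
  field_simp
  ring

lemma contDiffOn_log_conformalFactor :
    ContDiffOn ℝ ∞ (fun z => Real.log (conformalFactor A B z)) ((L.lattice : Set ℂ)ᶜ) :=
  (contDiff_conformalFactor h.diffA h.diffB h.pairNorm_pos).contDiffOn.log
    fun _ hz => (h.conformalFactor_pos hz).ne'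

end IsDevelopingPair

end MeanField

end

noncomputable section
namespace MeanField

open Filter Topology ComplexConjugate MeasureTheory Metric
open scoped Convolution

/-! ### A compactly supported parametrix of the Laplacian -/

/-- A smooth cutoff, equal to `1` near `0` and supported in the unit disc. -/
def kernelBump : ContDiffBump (0 : ℂ) := ⟨1 / 2, 1, by norm_num, by norm_num⟩

/-- The cut off logarithmic kernel `κ(z) log (|z|² + e) / 4π`; for `e = 0` this is a fundamental
solution of the Laplacian up to a smooth function, and for `e > 0` it is smooth. -/
def logKernel (e : ℝ) (z : ℂ) : ℝ := kernelBump z * (Real.log (‖z‖ ^ 2 + e) / (4 * Real.pi))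

lemma kernelBump_eq_zero {z : ℂ} (hz : 1 ≤ ‖z‖) : kernelBump z = 0 :=
  kernelBump.zero_of_le_dist (by rwa [dist_zero_right])

lemma logKernel_eq_zero (e : ℝ) {z : ℂ} (hz : 1 ≤ ‖z‖) : logKernel e z = 0 := by
  rw [logKernel, kernelBump_eq_zero hz, zero_mul]

lemma hasCompactSupport_logKernel (e : ℝ) : HasCompactSupport (logKernel e) :=
  kernelBump.hasCompactSupport.mul_right

lemma contDiff_logKernel {e : ℝ} (he : 0 < e) : ContDiff ℝ ∞ (logKernel e) :=
  kernelBump.contDiff.mul ((((contDiff_norm_sq ℝ).add contDiff_const).log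
    fun z => by positivity).div_const _)

lemma logKernel_zero (z : ℂ) : logKernel 0 z = kernelBump z * (Real.log ‖z‖ / (2 * Real.pi)) := by
  rw [logKernel, add_zero, Real.log_pow]
  push_cast
  ring

lemma logKernel_neg (z : ℂ) : logKernel 0 (-z) = logKernel 0 z := by
  rw [logKernel, logKernel, norm_neg, kernelBump.neg]

lemma measurable_logKernel (e : ℝ) : Measurable (logKernel e) :=
  kernelBump.continuous.measurable.mul
    ((Real.measurable_log.comp (by fun_prop)).div_const _)

lemma abs_log_norm_sq_add_le {e : ℝ} (he0 : 0 ≤ e) (he1 : e ≤ 1) {z : ℂ} (hz0 : z ≠ 0)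
    (hz1 : ‖z‖ ≤ 1) : |Real.log (‖z‖ ^ 2 + e)| ≤ 5 * ‖z‖ ^ (-(1 / 2 : ℝ)) := by
  have hz : 0 < ‖z‖ := norm_pos_iff.mpr hz0
  have h1 := abs_log_le_rpow hz.le hz1
  have h2 : (1 : ℝ) ≤ ‖z‖ ^ (-(1 / 2 : ℝ)) :=
    Real.one_le_rpow_of_pos_of_le_one_of_nonpos hz hz1 (by norm_num)
  have h3 : 2 * Real.log ‖z‖ ≤ Real.log (‖z‖ ^ 2 + e) := by
    rw [← Real.log_rpow hz, Real.rpow_ofNat]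
    exact Real.log_le_log (by positivity) (by linarith)
  have h4 : Real.log (‖z‖ ^ 2 + e) ≤ 1 := by
    have := Real.log_le_sub_one_of_pos (x := ‖z‖ ^ 2 + e) (by positivity)
    have : ‖z‖ ^ 2 ≤ 1 := pow_le_one₀ hz.le hz1
    linarith
  rw [abs_le]
  have := neg_abs_le (Real.log ‖z‖)
  constructor <;> linarith

lemma abs_logKernel_le {e : ℝ} (he0 : 0 ≤ e) (he1 : e ≤ 1) {z : ℂ} (hz0 : z ≠ 0) :
    |logKernel e z| ≤ ‖z‖ ^ (-(1 / 2 : ℝ)) := by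
  have hr : 0 ≤ ‖z‖ ^ (-(1 / 2 : ℝ)) := by positivity
  rcases le_total 1 ‖z‖ with h | h
  · rw [logKernel_eq_zero e h, abs_zero]; exact hr
  · rw [logKernel, abs_mul, abs_div, abs_of_nonneg kernelBump.nonneg,
      abs_of_pos (show 0 < 4 * Real.pi by positivity)]
    refine (mul_le_of_le_one_left (by positivity) kernelBump.le_one).trans ?_
    rw [div_le_iff₀ (by positivity)]
    have := abs_log_norm_sq_add_le he0 he1 hz0 h
    nlinarith [Real.pi_gt_three]

lemma integrable_indicator_rpow {s : ℝ} (hs : s < 2) :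
    Integrable ((closedBall (0 : ℂ) 1).indicator fun z => ‖z‖ ^ (-s)) := by
  rw [integrable_indicator_iff measurableSet_closedBall]
  refine LocallyIntegrable.integrableOn_isCompact (locallyIntegrable_of_norm_le_rpow (C := 1)
    (α := s) (by simp) (by simpa using hs) (ae_of_all _ fun z => ?_) ?_) (isCompact_closedBall 0 1)
  · rw [Real.norm_of_nonneg (by positivity), one_mul]
  · exact (Measurable.pow_const (by fun_prop) _).aestronglyMeasurable

lemma ae_ne_zero : ∀ᵐ z : ℂ, z ≠ 0 := by simp [ae_iff]

lemma norm_logKernel_le_indicator {e : ℝ} (he0 : 0 ≤ e) (he1 : e ≤ 1) {z : ℂ} (hz0 : z ≠ 0) :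
    ‖logKernel e z‖ ≤ (closedBall (0 : ℂ) 1).indicator (fun z => ‖z‖ ^ (-(1 / 2 : ℝ))) z := by
  by_cases hz : z ∈ closedBall (0 : ℂ) 1
  · rw [Set.indicator_of_mem hz]
    exact abs_logKernel_le he0 he1 hz0
  · rw [Set.indicator_of_notMem hz, logKernel_eq_zero, norm_zero]
    rw [mem_closedBall_zero_iff, not_le] at hz
    exact hz.le

lemma integrable_logKernel {e : ℝ} (he0 : 0 ≤ e) (he1 : e ≤ 1) : Integrable (logKernel e) := by
  refine (integrable_indicator_rpow (s := 1 / 2) (by norm_num)).mono'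
    (measurable_logKernel e).aestronglyMeasurable ?_
  filter_upwards [ae_ne_zero] with z hz
  exact norm_logKernel_le_indicator he0 he1 hz

lemma integrable_logKernel_sq : Integrable fun z => logKernel 0 z ^ 2 := by
  refine (integrable_indicator_rpow (s := 1) (by norm_num)).mono'
    ((measurable_logKernel 0).pow_const 2).aestronglyMeasurable ?_
  filter_upwards [ae_ne_zero] with z hz0
  have := norm_logKernel_le_indicator le_rfl zero_le_one hz0
  rw [norm_pow]
  by_cases hz : z ∈ closedBall (0 : ℂ) 1
  · rw [Set.indicator_of_mem hz] at this ⊢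
    refine (pow_le_pow_left₀ (norm_nonneg _) this 2).trans_eq ?_
    rw [← Real.rpow_natCast, ← Real.rpow_mul (norm_nonneg z)]
    norm_num
  · rw [Set.indicator_of_notMem hz] at this ⊢
    rw [le_antisymm this (norm_nonneg _)]
    norm_num

lemma logKernel_nonpos (z : ℂ) : logKernel 0 z ≤ 0 := by
  rcases le_total 1 ‖z‖ with h | h
  · rw [logKernel_eq_zero 0 h]
  · rw [logKernel_zero]
    refine mul_nonpos_of_nonneg_of_nonpos kernelBump.nonneg ?_
    exact div_nonpos_of_nonpos_of_nonneg (Real.log_nonpos (norm_nonneg z) h) (by positivity)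

/-- Exponentials of small multiples of the kernel are integrable. -/
lemma exp_neg_logKernel_le {M : ℝ} (hM0 : 0 ≤ M) (hM : M ≤ 1) (z : ℂ) :
    Real.exp (2 * M * -logKernel 0 z) ≤
      1 + (closedBall (0 : ℂ) 1).indicator (fun z => ‖z‖ ^ (-(1 : ℝ))) z := by
  have hind : 0 ≤ (closedBall (0 : ℂ) 1).indicator (fun z => ‖z‖ ^ (-(1 : ℝ))) z :=
    Set.indicator_nonneg (fun z _ => by positivity) z
  rcases le_total 1 ‖z‖ with h | h
  · rw [logKernel_eq_zero 0 h, neg_zero, mul_zero, Real.exp_zero]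
    linarith
  rcases eq_or_ne z 0 with rfl | hz0
  · rw [logKernel_zero, norm_zero, Real.log_zero, zero_div, mul_zero, neg_zero, mul_zero,
      Real.exp_zero]
    linarith
  · rw [Set.indicator_of_mem (mem_closedBall_zero_iff.mpr h)]
    have hz : 0 < ‖z‖ := norm_pos_iff.mpr hz0
    have hl := Real.log_nonpos hz.le h
    have h1 : 2 * M * -logKernel 0 z ≤ -Real.log ‖z‖ := by
      have e : 2 * M * -logKernel 0 z = (M * kernelBump z / Real.pi) * -Real.log ‖z‖ := by
        rw [logKernel_zero]; field_simp
      rw [e]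
      refine mul_le_of_le_one_left (by linarith) ?_
      rw [div_le_one Real.pi_pos]
      nlinarith [kernelBump.nonneg (x := z), kernelBump.le_one (x := z), Real.pi_gt_three]
    refine (Real.exp_le_exp.mpr h1).trans ?_
    rw [Real.exp_neg, Real.exp_log hz, Real.rpow_neg_one]
    linarith

/-- The smooth difference between the fundamental solution and the parametrix. -/
def smoothKernel (z : ℂ) : ℝ := (1 - kernelBump z) * (Real.log ‖z‖ / (2 * Real.pi))

lemma contDiff_smoothKernel : ContDiff ℝ ∞ smoothKernel := by
  rw [contDiff_iff_contDiffAt]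
  intro z
  rcases eq_or_ne z 0 with rfl | hz
  · refine (contDiffAt_const (c := 0)).congr_of_eventuallyEq ?_
    filter_upwards [kernelBump.eventuallyEq_one] with y hy
    rw [smoothKernel, hy]
    simp
  · refine (contDiffAt_const.sub kernelBump.contDiff.contDiffAt).mul (ContDiffAt.div_const ?_ _)
    exact (contDiffAt_norm ℝ hz).log (norm_ne_zero_iff.mpr hz)

/-- The error term of the parametrix. -/
def errorKernel (z : ℂ) : ℝ := -Δ smoothKernel z

lemma contDiff_errorKernel : ContDiff ℝ ∞ errorKernel :=
  (contDiff_laplacian contDiff_smoothKernel).neg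

lemma errorKernel_eq_zero {z : ℂ} (hz : 1 < ‖z‖) : errorKernel z = 0 := by
  have h1 : smoothKernel =ᶠ[𝓝 z] fun z => (1 / (2 * Real.pi)) • Real.log ‖z‖ := by
    filter_upwards [(isOpen_lt continuous_const continuous_norm).mem_nhds hz] with y hy
    rw [smoothKernel, kernelBump_eq_zero (le_of_lt hy), smul_eq_mul]
    ring
  have hz0 : z ≠ 0 := norm_pos_iff.mp (one_pos.trans hz)
  have hh : InnerProductSpace.HarmonicAt (fun z : ℂ => Real.log ‖z‖) z :=
    analyticAt_id.harmonicAt_log_norm hz0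
  rw [errorKernel, (InnerProductSpace.laplacian_congr_nhds h1).self_of_nhds]
  have := InnerProductSpace.laplacian_smul (1 / (2 * Real.pi)) hh.1
  rw [hh.2.self_of_nhds] at this
  simpa [Pi.smul_def] using this

lemma hasCompactSupport_errorKernel : HasCompactSupport errorKernel :=
  HasCompactSupport.intro (isCompact_closedBall 0 1) fun z hz =>
    errorKernel_eq_zero (by simpa using hz)

lemma fderiv_comp_neg_apply {f : ℂ → ℝ} (hf : Differentiable ℝ f) (z v : ℂ) :
    fderiv ℝ (fun z => f (-z)) z v = -fderiv ℝ f (-z) v := by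
  have h : HasFDerivAt (fun z => f (-z)) _ z :=
    HasFDerivAt.comp z (hf (-z)).hasFDerivAt (hasFDerivAt_id z).neg
  rw [h.fderiv]
  simp

lemma laplacian_comp_neg {ψ : ℂ → ℝ} (hψ : ContDiff ℝ ∞ ψ) (z : ℂ) :
    Δ (fun z => ψ (-z)) z = Δ ψ (-z) := by
  have h2 : ContDiff ℝ 2 fun z => ψ (-z) := (hψ.of_le (by norm_cast)).comp contDiff_neg
  have hd : ∀ v, Differentiable ℝ fun z => fderiv ℝ ψ z v := fun v =>
    (contDiff_fderiv_apply hψ v).differentiable (by simp)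
  rw [laplacian_eq_fderiv h2.contDiffAt, laplacian_eq_fderiv (hψ.of_le (by norm_cast)).contDiffAt]
  simp only [fderiv_comp_neg_apply (hψ.differentiable (by simp)), fderiv_fun_neg, neg_apply,
    fderiv_comp_neg_apply (hd _), neg_neg]

lemma errorKernel_neg (z : ℂ) : errorKernel (-z) = errorKernel z := by
  have h : (fun z => smoothKernel (-z)) = smoothKernel := by
    ext z
    rw [smoothKernel, smoothKernel, norm_neg, kernelBump.neg]
  rw [errorKernel, errorKernel, ← laplacian_comp_neg contDiff_smoothKernel, h]

/-- The parametrix inverts the Laplacian up to a smoothing operator. -/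
lemma integral_logKernel_mul_laplacian {ψ : ℂ → ℝ} (hψ : ContDiff ℝ ∞ ψ)
    (hc : HasCompactSupport ψ) :
    ∫ z, logKernel 0 z * Δ ψ z = ψ 0 + ∫ z, errorKernel z * ψ z := by
  have hL := (contDiff_laplacian hψ).continuous
  have hLc := hasCompactSupport_laplacian hc
  have h1 := integral_log_norm_mul_laplacian hψ hc
  have h2 := integral_mul_laplacian hψ hc fun z _ =>
    (contDiff_smoothKernel.of_le (m := 2) (by norm_cast)).contDiffAt (x := z)
  have e : ∀ z, logKernel 0 z * Δ ψ z = 1 / (2 * Real.pi) * (Real.log ‖z‖ * Δ ψ z) -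
      smoothKernel z * Δ ψ z := fun z => by
    rw [logKernel_zero, smoothKernel]; ring
  have e2 : ∫ z, errorKernel z * ψ z = -∫ z, Δ smoothKernel z * ψ z := by
    rw [← integral_neg]
    simp only [errorKernel, neg_mul]
  simp only [e]
  rw [integral_sub ((integrable_mul_of_locallyIntegrable locallyIntegrable_log_norm hL
    hLc).const_mul _) (integrable_mul_of_locallyIntegrable
    contDiff_smoothKernel.continuous.locallyIntegrable hL hLc), integral_const_mul, h1, h2, e2]
  field_simp
  ring

lemma hasFDerivAt_logKernel {e : ℝ} {z : ℂ} (he : ‖z‖ ^ 2 + e ≠ 0) :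
    HasFDerivAt (logKernel e) (kernelBump z •
      ((4 * Real.pi)⁻¹ • ((‖z‖ ^ 2 + e)⁻¹ • ((2 : ℕ) • innerSL ℝ z))) +
      (Real.log (‖z‖ ^ 2 + e) / (4 * Real.pi)) • fderiv ℝ kernelBump z) z := by
  have h1 : HasFDerivAt (fun z : ℂ => ‖z‖ ^ 2 + e) ((2 : ℕ) • innerSL ℝ z) z :=
    (hasStrictFDerivAt_norm_sq z).hasFDerivAt.add_const e
  have h2 := (h1.log he).mul_const (4 * Real.pi)⁻¹
  have h3 : HasFDerivAt kernelBump (fderiv ℝ kernelBump z) z :=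
    (kernelBump.contDiff (n := 1)).differentiable (by simp) z |>.hasFDerivAt
  exact h3.fun_mul h2

end MeanField

end

noncomputable section
namespace MeanField

open Filter Topology ComplexConjugate MeasureTheory Metric
open scoped Convolution

/-! ### Convolution with the parametrix -/

section Convolution

variable {E F : Type*} [NormedAddCommGroup E] [NormedSpace ℝ E] [NormedAddCommGroup F]
  [NormedSpace ℝ F] (T : E →L[ℝ] ℝ →L[ℝ] F)

lemma convolutionExistsAt_of_bounded {f : ℂ → E} {g : ℂ → ℝ} (hf : Integrable f)
    (hg : AEStronglyMeasurable g) {M : ℝ} (hM : ∀ z, ‖g z‖ ≤ M) (x : ℂ) :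
    ConvolutionExistsAt f g x T volume := by
  refine ((hf.norm.const_mul ‖T‖).mul_const M).mono'
    (hf.aestronglyMeasurable.convolution_integrand_snd T hg x) (ae_of_all _ fun t => ?_)
  refine (T.le_opNorm₂ _ _).trans ?_
  gcongr
  exact hM _

lemma norm_convolution_sub_le {f f' : ℂ → E} {g : ℂ → ℝ} (hf : Integrable f)
    (hf' : Integrable f') (hg : AEStronglyMeasurable g) {M : ℝ} (hM : ∀ z, ‖g z‖ ≤ M) (x : ℂ) :
    ‖(f ⋆[T, volume] g) x - (f' ⋆[T, volume] g) x‖ ≤ ‖T‖ * (∫ t, ‖f t - f' t‖) * M := by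
  rw [convolution_def, convolution_def, ← integral_sub
    (convolutionExistsAt_of_bounded T hf hg hM x) (convolutionExistsAt_of_bounded T hf' hg hM x),
    ← integral_const_mul, ← integral_mul_const]
  refine norm_integral_le_of_norm_le (((hf.sub hf').norm.const_mul _).mul_const _)
    (ae_of_all _ fun t => ?_)
  rw [← sub_apply, ← map_sub]
  refine (T.le_opNorm₂ _ _).trans ?_
  have := hM (x - t)
  gcongr

lemma tendstoUniformly_convolution {f : ℕ → ℂ → E} {f₀ : ℂ → E} {g : ℂ → ℝ}
    (hf : ∀ n, Integrable (f n)) (hf₀ : Integrable f₀) (hg : AEStronglyMeasurable g) {M : ℝ}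
    (hM : ∀ z, ‖g z‖ ≤ M) (h : Tendsto (fun n => ∫ t, ‖f n t - f₀ t‖) atTop (𝓝 0)) :
    TendstoUniformly (fun n => f n ⋆[T, volume] g) (f₀ ⋆[T, volume] g) atTop := by
  rw [Metric.tendstoUniformly_iff]
  intro ε hε
  have h3 := (h.const_mul ‖T‖).mul_const M
  rw [mul_zero, zero_mul] at h3
  filter_upwards [h3.eventually_lt_const hε] with n hn y
  rw [dist_comm, dist_eq_norm]
  exact (norm_convolution_sub_le T (hf n) hf₀ hg hM y).trans_lt hn

/-- If `f n → f` and the derivatives converge in `L¹`, convolutions with a bounded function can be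
differentiated in the limit. -/
lemma hasFDerivAt_convolution_of_tendsto {f : ℕ → ℂ → ℝ} {f₀ : ℂ → ℝ} {Q : ℂ → ℂ →L[ℝ] ℝ}
    {g : ℂ → ℝ} (hc : ∀ n, HasCompactSupport (f n)) (hf : ∀ n, ContDiff ℝ 1 (f n))
    (hf₀ : Integrable f₀) (hQ : Integrable Q) (hg : Integrable g) {M : ℝ} (hM : ∀ z, ‖g z‖ ≤ M)
    (h1 : Tendsto (fun n => ∫ t, ‖f n t - f₀ t‖) atTop (𝓝 0))
    (h2 : Tendsto (fun n => ∫ t, ‖fderiv ℝ (f n) t - Q t‖) atTop (𝓝 0)) (x : ℂ) :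
    HasFDerivAt (f₀ ⋆[ContinuousLinearMap.lsmul ℝ ℝ, volume] g)
      ((Q ⋆[(ContinuousLinearMap.lsmul ℝ ℝ : ℝ →L[ℝ] ℝ →L[ℝ] ℝ).precompL ℂ, volume] g) x) x := by
  have hi : ∀ n, Integrable (f n) := fun n =>
    (hf n).continuous.integrable_of_hasCompactSupport (hc n)
  have hi' : ∀ n, Integrable (fderiv ℝ (f n)) := fun n =>
    ((hf n).continuous_fderiv (by simp)).integrable_of_hasCompactSupport ((hc n).fderiv ℝ)
  refine hasFDerivAt_of_tendstoUniformly (l := atTop)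
    (f := fun n => f n ⋆[ContinuousLinearMap.lsmul ℝ ℝ, volume] g)
    (f' := fun n => fderiv ℝ (f n) ⋆[(ContinuousLinearMap.lsmul ℝ ℝ :
      ℝ →L[ℝ] ℝ →L[ℝ] ℝ).precompL ℂ, volume] g)
    (g' := Q ⋆[(ContinuousLinearMap.lsmul ℝ ℝ :
      ℝ →L[ℝ] ℝ →L[ℝ] ℝ).precompL ℂ, volume] g) ?_
    (fun n x => (hc n).hasFDerivAt_convolution_left _ (hf n) hg.locallyIntegrable x) ?_ x
  · exact tendstoUniformly_convolution _ hi' hQ hg.aestronglyMeasurable hM h2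
  · intro y
    exact (tendstoUniformly_convolution _ hi hf₀ hg.aestronglyMeasurable hM h1).tendsto_at y

end Convolution

lemma exists_norm_fderiv_logKernel_le : ∃ C : ℝ, ∀ e : ℝ, 0 ≤ e → e ≤ 1 → ∀ z : ℂ, z ≠ 0 →
    ‖fderiv ℝ (logKernel e) z‖ ≤
      C * (closedBall (0 : ℂ) 1).indicator (fun z => ‖z‖ ^ (-(1 : ℝ))) z := by
  have hb : ContDiff ℝ ∞ kernelBump := kernelBump.contDiff
  obtain ⟨D, hD⟩ := (hb.continuous_fderiv (by simp)).bounded_above_of_compact_support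
    (kernelBump.hasCompactSupport.fderiv ℝ)
  refine ⟨2 + 5 * D, fun e he0 he1 z hz0 => ?_⟩
  by_cases hz : z ∈ closedBall (0 : ℂ) 1
  · rw [Set.indicator_of_mem hz]
    rw [mem_closedBall_zero_iff] at hz
    have hpos : 0 < ‖z‖ := norm_pos_iff.mpr hz0
    have hS : 0 < ‖z‖ ^ 2 + e := by positivity
    rw [(hasFDerivAt_logKernel hS.ne').fderiv]
    have hpi : (1 : ℝ) ≤ 4 * Real.pi := by linarith [Real.pi_gt_three]
    have b1 : ‖kernelBump z • ((4 * Real.pi)⁻¹ • ((‖z‖ ^ 2 + e)⁻¹ • ((2 : ℕ) • innerSL ℝ z)))‖ ≤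
        2 * ‖z‖ ^ (-(1 : ℝ)) := by
      rw [norm_smul, norm_smul, norm_smul, Real.norm_of_nonneg kernelBump.nonneg,
        Real.norm_of_nonneg (by positivity), Real.norm_of_nonneg (by positivity),
        ← Nat.cast_smul_eq_nsmul ℝ, norm_smul, innerSL_apply_norm, Real.rpow_neg_one]
      have a1 : (‖z‖ ^ 2 + e)⁻¹ * (‖((2 : ℕ) : ℝ)‖ * ‖z‖) ≤ 2 * ‖z‖⁻¹ := by
        rw [inv_mul_le_iff₀ hS]
        have : (‖z‖ ^ 2 + e) * (2 * ‖z‖⁻¹) = 2 * ‖z‖ + 2 * e * ‖z‖⁻¹ := by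
          field_simp
        rw [this]
        have : 0 ≤ 2 * e * ‖z‖⁻¹ := by positivity
        norm_num
        linarith
      have a0 : 0 ≤ (‖z‖ ^ 2 + e)⁻¹ * (‖((2 : ℕ) : ℝ)‖ * ‖z‖) := by positivity
      have a2 : (4 * Real.pi)⁻¹ ≤ 1 := inv_le_one_of_one_le₀ hpi
      calc kernelBump z * ((4 * Real.pi)⁻¹ * ((‖z‖ ^ 2 + e)⁻¹ * (‖((2 : ℕ) : ℝ)‖ * ‖z‖)))
          ≤ 1 * (1 * ((‖z‖ ^ 2 + e)⁻¹ * (‖((2 : ℕ) : ℝ)‖ * ‖z‖))) := by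
            gcongr
            exact kernelBump.le_one
        _ ≤ _ := by linarith
    have b2 : ‖(Real.log (‖z‖ ^ 2 + e) / (4 * Real.pi)) • fderiv ℝ kernelBump z‖ ≤
        5 * D * ‖z‖ ^ (-(1 : ℝ)) := by
      rw [norm_smul, Real.norm_eq_abs, abs_div, abs_of_pos (show 0 < 4 * Real.pi by positivity)]
      have a1 := abs_log_norm_sq_add_le he0 he1 hz0 hz
      have a2 : ‖z‖ ^ (-(1 / 2 : ℝ)) ≤ ‖z‖ ^ (-(1 : ℝ)) :=
        Real.rpow_le_rpow_of_exponent_ge hpos hz (by norm_num)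
      have a3 : |Real.log (‖z‖ ^ 2 + e)| / (4 * Real.pi) ≤ |Real.log (‖z‖ ^ 2 + e)| :=
        div_le_self (abs_nonneg _) hpi
      have a4 : |Real.log (‖z‖ ^ 2 + e)| / (4 * Real.pi) ≤ 5 * ‖z‖ ^ (-(1 : ℝ)) := by linarith
      calc _ ≤ 5 * ‖z‖ ^ (-(1 : ℝ)) * D := by
            gcongr
            exact hD z
        _ = _ := by ring
    calc _ ≤ _ := norm_add_le _ _
      _ ≤ 2 * ‖z‖ ^ (-(1 : ℝ)) + 5 * D * ‖z‖ ^ (-(1 : ℝ)) := add_le_add b1 b2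
      _ = _ := by ring
  · rw [Set.indicator_of_notMem hz, mul_zero]
    have h0 : logKernel e =ᶠ[𝓝 z] fun _ => 0 := by
      filter_upwards [isClosed_closedBall.isOpen_compl.mem_nhds hz] with y hy
      refine logKernel_eq_zero e (le_of_lt ?_)
      simpa using hy
    rw [h0.fderiv_eq]
    simp

lemma integrable_fderiv_logKernel {e : ℝ} (he0 : 0 ≤ e) (he1 : e ≤ 1) :
    Integrable (fderiv ℝ (logKernel e)) := by
  obtain ⟨C, hC⟩ := exists_norm_fderiv_logKernel_le
  refine ((integrable_indicator_rpow (s := 1) (by norm_num)).const_mul C).mono'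
    (measurable_fderiv ℝ _).aestronglyMeasurable ?_
  filter_upwards [ae_ne_zero] with z hz
  exact hC e he0 he1 z hz

lemma tendsto_integral_norm_logKernel_sub {e : ℕ → ℝ} (he0 : ∀ n, 0 ≤ e n) (he1 : ∀ n, e n ≤ 1)
    (he : Tendsto e atTop (𝓝 0)) :
    Tendsto (fun n => ∫ t, ‖logKernel (e n) t - logKernel 0 t‖) atTop (𝓝 0) ∧
      Tendsto (fun n => ∫ t, ‖fderiv ℝ (logKernel (e n)) t - fderiv ℝ (logKernel 0) t‖)
        atTop (𝓝 0) := by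
  have hlog : ∀ z : ℂ, z ≠ 0 → Tendsto (fun n => Real.log (‖z‖ ^ 2 + e n) / (4 * Real.pi)) atTop
      (𝓝 (Real.log (‖z‖ ^ 2 + 0) / (4 * Real.pi))) := fun z hz =>
    (Tendsto.log (tendsto_const_nhds.add he)
      (by have := norm_pos_iff.mpr hz; positivity)).div_const _
  have hz0 : 0 = ∫ _ : ℂ, (0 : ℝ) := (integral_zero ℂ ℝ).symm
  constructor
  · refine Eq.subst (motive := fun a => Tendsto _ atTop (𝓝 a)) hz0.symm ?_
    refine tendsto_integral_of_dominated_convergence (fun z => 2 *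
      (closedBall (0 : ℂ) 1).indicator (fun z => ‖z‖ ^ (-(1 / 2 : ℝ))) z)
      (fun n => ((measurable_logKernel _).sub (measurable_logKernel _)).norm.aestronglyMeasurable)
      ((integrable_indicator_rpow (s := 1 / 2) (by norm_num)).const_mul 2) (fun n => ?_) ?_
    · filter_upwards [ae_ne_zero] with z hz
      rw [norm_norm]
      refine (norm_sub_le _ _).trans ?_
      have := norm_logKernel_le_indicator (he0 n) (he1 n) hz
      have := norm_logKernel_le_indicator le_rfl zero_le_one hz
      linarith
    · filter_upwards [ae_ne_zero] with z hz
      rw [← tendsto_iff_norm_sub_tendsto_zero]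
      exact (hlog z hz).const_mul (kernelBump z)
  · obtain ⟨C, hC⟩ := exists_norm_fderiv_logKernel_le
    refine Eq.subst (motive := fun a => Tendsto _ atTop (𝓝 a)) hz0.symm ?_
    refine tendsto_integral_of_dominated_convergence (fun z => 2 * (C *
      (closedBall (0 : ℂ) 1).indicator (fun z => ‖z‖ ^ (-(1 : ℝ))) z))
      (fun n => ((measurable_fderiv ℝ _).sub
        (measurable_fderiv ℝ _)).norm.aestronglyMeasurable)
      (((integrable_indicator_rpow (s := 1) (by norm_num)).const_mul C).const_mul 2)
      (fun n => ?_) ?_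
    · filter_upwards [ae_ne_zero] with z hz
      rw [norm_norm]
      refine (norm_sub_le _ _).trans ?_
      have := hC _ (he0 n) (he1 n) z hz
      have := hC 0 le_rfl zero_le_one z hz
      linarith
    · filter_upwards [ae_ne_zero] with z hz
      rw [← tendsto_iff_norm_sub_tendsto_zero]
      have hpos : 0 < ‖z‖ := norm_pos_iff.mpr hz
      have hn : ∀ n, ‖z‖ ^ 2 + e n ≠ 0 := fun n => by have := he0 n; positivity
      have h0 : ‖z‖ ^ 2 + (0 : ℝ) ≠ 0 := by positivity
      simp only [fun n => (hasFDerivAt_logKernel (hn n)).fderiv, (hasFDerivAt_logKernel h0).fderiv]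
      refine Tendsto.add (Tendsto.const_smul (Tendsto.const_smul (Tendsto.smul_const ?_ _) _) _)
        ((hlog z hz).smul_const _)
      exact (tendsto_const_nhds.add he).inv₀ h0

lemma hasFDerivAt_logKernel_convolution {g : ℂ → ℝ} (hg : Integrable g) {M : ℝ}
    (hM : ∀ z, ‖g z‖ ≤ M) (x : ℂ) :
    HasFDerivAt (logKernel 0 ⋆[ContinuousLinearMap.lsmul ℝ ℝ, volume] g)
      ((fderiv ℝ (logKernel 0) ⋆[(ContinuousLinearMap.lsmul ℝ ℝ :
        ℝ →L[ℝ] ℝ →L[ℝ] ℝ).precompL ℂ, volume] g) x) x := by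
  have he0 : ∀ n : ℕ, 0 < 1 / ((n : ℝ) + 1) := fun n => by positivity
  have he1 : ∀ n : ℕ, 1 / ((n : ℝ) + 1) ≤ 1 := fun n => by
    rw [div_le_one (by positivity)]
    linarith [n.cast_nonneg (α := ℝ)]
  obtain ⟨h1, h2⟩ := tendsto_integral_norm_logKernel_sub (fun n => (he0 n).le) he1
    tendsto_one_div_add_atTop_nhds_zero_nat
  exact hasFDerivAt_convolution_of_tendsto (fun n => hasCompactSupport_logKernel _)
    (fun n => (contDiff_logKernel (he0 n)).of_le (by simp))
    (integrable_logKernel le_rfl zero_le_one)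
    (integrable_fderiv_logKernel le_rfl zero_le_one) hg hM h1 h2 x

/-- Convolution with the parametrix gains one derivative. -/
lemma contDiff_logKernel_convolution {g : ℂ → ℝ} {n : ℕ} (hg : ContDiff ℝ n g)
    (hc : HasCompactSupport g) :
    ContDiff ℝ (n + 1) (logKernel 0 ⋆[ContinuousLinearMap.lsmul ℝ ℝ, volume] g) := by
  obtain ⟨M, hM⟩ := hg.continuous.bounded_above_of_compact_support hc
  have hi := hg.continuous.integrable_of_hasCompactSupport (μ := volume) hc
  rw [contDiff_succ_iff_hasFDerivAt]
  refine ⟨_, ?_, fun x => hasFDerivAt_logKernel_convolution hi hM x⟩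
  exact_mod_cast hc.contDiff_convolution_right (n := n) _
    (integrable_fderiv_logKernel le_rfl zero_le_one).locallyIntegrable (by exact_mod_cast hg)

end MeanField

end

noncomputable section
namespace MeanField

open Filter Topology ComplexConjugate MeasureTheory Metric
open scoped Convolution

/-! ### Regularity of solutions -/

/-- Convolution of real functions on the plane. -/
abbrev conv (K G : ℂ → ℝ) : ℂ → ℝ := K ⋆[ContinuousLinearMap.lsmul ℝ ℝ, volume] G

lemma conv_apply (K G : ℂ → ℝ) (x : ℂ) : conv K G x = ∫ t, K t * G (x - t) := rfl

lemma conv_congr_of_ball {K G G' : ℂ → ℝ} (hK : ∀ t, 1 < ‖t‖ → K t = 0) {R : ℝ}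
    (h : ∀ᵐ z, ‖z‖ ≤ R + 1 → G z = G' z) {x : ℂ} (hx : ‖x‖ ≤ R) : conv K G x = conv K G' x := by
  rw [conv_apply, conv_apply]
  refine integral_congr_ae ?_
  filter_upwards [(quasiMeasurePreserving_sub_left_of_right_invariant volume x).ae h] with t ht
  rcases lt_or_ge 1 ‖t‖ with h1 | h1
  · simp [hK t h1]
  · rw [ht]
    exact (norm_sub_le x t).trans (add_le_add hx h1)

lemma conv_congr_indicator {K G : ℂ → ℝ} (hK : ∀ t, 1 < ‖t‖ → K t = 0) {R : ℝ} {x : ℂ}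
    (hx : ‖x‖ ≤ R) : conv K G x = conv K ((closedBall (0 : ℂ) (R + 1)).indicator G) x :=
  conv_congr_of_ball hK (ae_of_all _ fun z hz => by
    rw [Set.indicator_of_mem (mem_closedBall_zero_iff.mpr hz)]) hx

lemma integrable_indicator_of_locallyIntegrable {G : ℂ → ℝ} (hG : LocallyIntegrable G) (R : ℝ) :
    Integrable ((closedBall (0 : ℂ) R).indicator G) :=
  (hG.integrableOn_isCompact (isCompact_closedBall 0 R)).integrable_indicator
    measurableSet_closedBall

lemma integrable_conv_kernel {K G ψ : ℂ → ℝ} (hK : Integrable K) (hG : Integrable G)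
    (hψ : Continuous ψ) {M : ℝ} (hM : ∀ z, ‖ψ z‖ ≤ M) {φ : ℂ × ℂ → ℂ} (hφ : Continuous φ) :
    Integrable (fun p : ℂ × ℂ => K p.1 * G p.2 * ψ (φ p)) (volume.prod volume) :=
  (hK.mul_prod hG).mul_bdd (c := M) (hψ.comp hφ).aestronglyMeasurable
    (ae_of_all _ fun _ => hM _)

/-- Convolution with an even kernel is symmetric. -/
lemma integral_mul_conv {K G ψ : ℂ → ℝ} (hK : Integrable K) (he : ∀ t, K (-t) = K t)
    (hG : Integrable G) (hψ : Continuous ψ) {M : ℝ} (hM : ∀ z, ‖ψ z‖ ≤ M) :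
    ∫ x, ψ x * conv K G x = ∫ y, G y * conv K ψ y := by
  have h1 : ∀ t, ∫ x, ψ x * (K t * G (x - t)) = ∫ y, K t * G y * ψ (y + t) := fun t => by
    rw [← integral_add_right_eq_self _ t]
    refine integral_congr_ae (ae_of_all _ fun y => ?_)
    simp only [add_sub_cancel_right]
    ring
  have h2 : ∀ t, ∫ y, G y * (K t * ψ (y - t)) = ∫ y, K t * G y * ψ (y - t) := fun t =>
    integral_congr_ae (ae_of_all _ fun y => by simp only; ring)
  have i1 : Integrable (fun p : ℂ × ℂ => ψ p.1 * (K p.2 * G (p.1 - p.2)))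
      (volume.prod volume) := by
    have := hK.convolution_integrand (ContinuousLinearMap.lsmul ℝ ℝ) hG
    exact this.bdd_mul (c := M) (hψ.comp continuous_fst).aestronglyMeasurable
      (ae_of_all _ fun p => hM _)
  have i2 : Integrable (fun p : ℂ × ℂ => G p.1 * (K p.2 * ψ (p.1 - p.2)))
      (volume.prod volume) := by
    have := (integrable_conv_kernel hK hG hψ hM (φ := fun p => p.2 - p.1) (by fun_prop)).swap
    refine this.congr (ae_of_all _ fun p => ?_)
    simp only [Function.comp, Prod.fst_swap, Prod.snd_swap]
    ring
  simp only [conv_apply, ← integral_const_mul]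
  rw [integral_integral_swap (f := fun x t => ψ x * (K t * G (x - t))) i1,
    integral_integral_swap (f := fun y t => G y * (K t * ψ (y - t))) i2]
  simp only [h1, h2]
  rw [← integral_neg_eq_self]
  simp only [he, ← sub_eq_add_neg]

section Smooth

variable {K ψ : ℂ → ℝ} (hK : LocallyIntegrable K) (hψ : ContDiff ℝ ∞ ψ) (hc : HasCompactSupport ψ)
include hK hψ hc

lemma contDiff_conv_right : ContDiff ℝ ∞ (conv K ψ) :=
  hc.contDiff_convolution_right (n := ⊤) _ hK hψ

lemma fderiv_conv (x v : ℂ) : fderiv ℝ (conv K ψ) x v = conv K (fun z => fderiv ℝ ψ z v) x := by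
  rw [(hc.hasFDerivAt_convolution_right _ hK (hψ.of_le (by simp)) x).fderiv,
    convolution_precompR_apply _ hK (hc.fderiv ℝ) (hψ.continuous_fderiv (by simp))]

lemma laplacian_conv (x : ℂ) : Δ (conv K ψ) x = conv K (Δ ψ) x := by
  have hd : ∀ v, HasCompactSupport fun z => fderiv ℝ ψ z v := fun v =>
    hc.of_isClosed_subset (isClosed_tsupport _) (tsupport_fderiv_apply_subset' ψ v)
  have hdd : ∀ v, HasCompactSupport fun z => fderiv ℝ (fun z => fderiv ℝ ψ z v) z v := fun v =>
    (hd v).of_isClosed_subset (isClosed_tsupport _) (tsupport_fderiv_apply_subset' _ v)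
  have hs := contDiff_fderiv_apply hψ
  rw [laplacian_eq_fderiv ((contDiff_conv_right hK hψ hc).of_le (by norm_cast)).contDiffAt]
  simp only [fderiv_conv hK hψ hc]
  rw [fderiv_conv hK (hs _) (hd _), fderiv_conv hK (hs _) (hd _)]
  have e : Δ ψ = (fun z => fderiv ℝ (fun z => fderiv ℝ ψ z 1) z 1) +
      fun z => fderiv ℝ (fun z => fderiv ℝ ψ z Complex.I) z Complex.I := by
    ext z
    exact laplacian_eq_fderiv (hψ.of_le (by norm_cast)).contDiffAt
  rw [e]
  exact (((hdd _).convolutionExists_right _ hK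
    (contDiff_fderiv_apply (hs _) _).continuous x).distrib_add
    ((hdd _).convolutionExists_right _ hK (contDiff_fderiv_apply (hs _) _).continuous x)).symm

end Smooth

lemma locallyIntegrable_logKernel : LocallyIntegrable (logKernel 0) :=
  (integrable_logKernel le_rfl zero_le_one).locallyIntegrable

lemma integrable_errorKernel : Integrable errorKernel :=
  contDiff_errorKernel.continuous.integrable_of_hasCompactSupport hasCompactSupport_errorKernel

lemma conv_logKernel_laplacian {ψ : ℂ → ℝ} (hψ : ContDiff ℝ ∞ ψ) (hc : HasCompactSupport ψ)
    (x : ℂ) : conv (logKernel 0) (Δ ψ) x = ψ x + conv errorKernel ψ x := by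
  have h1 : ContDiff ℝ ∞ fun t => ψ (x - t) := hψ.comp (contDiff_const.sub contDiff_id)
  have h2 : HasCompactSupport fun t => ψ (x - t) := hc.comp_homeomorph (Homeomorph.subLeft x)
  have h := integral_logKernel_mul_laplacian h1 h2
  rw [sub_zero] at h
  rw [conv_apply, conv_apply, ← h]
  refine integral_congr_ae (ae_of_all _ fun t => ?_)
  have h3 : ContDiff ℝ ∞ fun t => ψ (t + x) := hψ.comp (contDiff_id.add contDiff_const)
  have e1 : (fun t => ψ (x - t)) = fun t => (fun t => ψ (t + x)) (-t) := by
    ext t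
    simp only [neg_add_eq_sub]
  simp only
  rw [e1, laplacian_comp_neg h3, laplacian_comp_add_right (hψ.of_le (by norm_cast))]
  rw [neg_add_eq_sub]

lemma logKernel_eq_zero_of_lt {t : ℂ} (ht : 1 < ‖t‖) : logKernel 0 t = 0 :=
  logKernel_eq_zero 0 ht.le

lemma tsupport_conv_logKernel_subset {ψ : ℂ → ℝ} {R : ℝ} (h : tsupport ψ ⊆ ball 0 R) {x : ℂ}
    (hx : R + 1 < ‖x‖) : conv (logKernel 0) ψ x = 0 := by
  rw [conv_apply]
  refine integral_eq_zero_of_ae (ae_of_all _ fun t => ?_)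
  rcases lt_or_ge 1 ‖t‖ with h1 | h1
  · simp [logKernel_eq_zero_of_lt h1]
  · have : ψ (x - t) = 0 := by
      refine image_eq_zero_of_notMem_tsupport fun hm => ?_
      have h2 := mem_ball_zero_iff.mp (h hm)
      have h3 := norm_sub_norm_le x t
      linarith
    simp [this]

/-- A distribution solution of `Δ θ = - F` is represented by convolution with the parametrix. -/
lemma ae_eq_conv_of_integral_test {θ F : ℂ → ℝ} (hθ : LocallyIntegrable θ)
    (hF : LocallyIntegrable F)
    (h : ∀ ψ : ℂ → ℝ, ContDiff ℝ ∞ ψ → HasCompactSupport ψ → ∫ z, (θ z * Δ ψ z + F z * ψ z) = 0) :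
    ∀ᵐ x, θ x = -(conv errorKernel θ x) - conv (logKernel 0) F x := by
  have key : ∀ n : ℕ, ∀ᵐ x, x ∈ ball (0 : ℂ) n →
      θ x = -(conv errorKernel θ x) - conv (logKernel 0) F x := by
    intro n
    set θ' := (closedBall (0 : ℂ) (n + 1)).indicator θ with hθ'
    set F' := (closedBall (0 : ℂ) (n + 1)).indicator F with hF'
    have iθ : Integrable θ' := integrable_indicator_of_locallyIntegrable hθ _
    have iF : Integrable F' := integrable_indicator_of_locallyIntegrable hF _
    have i1 : Integrable (conv errorKernel θ') :=
      integrable_errorKernel.integrable_convolution (ContinuousLinearMap.lsmul ℝ ℝ) iθ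
    have i2 : Integrable (conv (logKernel 0) F') :=
      (integrable_logKernel le_rfl zero_le_one).integrable_convolution
        (ContinuousLinearMap.lsmul ℝ ℝ) iF
    have h0 := isOpen_ball.ae_eq_zero_of_integral_contDiff_smul_eq_zero (U := ball (0 : ℂ) n)
      (((iθ.add i1).add i2).locallyIntegrable.locallyIntegrableOn _) fun ψ hψ hc hs => ?_
    · filter_upwards [h0] with x hx hxn
      have hxn' : ‖x‖ ≤ n := (mem_ball_zero_iff.mp hxn).le
      have h1 := hx hxn
      simp only [Pi.add_apply] at h1
      rw [conv_congr_indicator (fun t => errorKernel_eq_zero) hxn',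
        conv_congr_indicator (fun t => logKernel_eq_zero_of_lt) hxn']
      have h2 : θ x = θ' x := by
        rw [hθ', Set.indicator_of_mem]
        rw [mem_closedBall_zero_iff]
        linarith
      rw [h2]
      linarith
    · obtain ⟨M, hM⟩ := hψ.continuous.bounded_above_of_compact_support hc
      have hK := locallyIntegrable_logKernel
      have hφ := contDiff_conv_right hK hψ hc
      have hφc : HasCompactSupport (conv (logKernel 0) ψ) :=
        (hasCompactSupport_logKernel 0).convolution _ hc
      have hb : ∀ g : ℂ → ℝ, Integrable g → Integrable fun x => ψ x * g x := fun g hg =>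
        hg.bdd_mul (c := M) hψ.continuous.aestronglyMeasurable (ae_of_all _ hM)
      have e1 : ∫ x, ψ x • (θ' + conv errorKernel θ' + conv (logKernel 0) F') x =
          ∫ x, ψ x * θ' x + ψ x * conv errorKernel θ' x + ψ x * conv (logKernel 0) F' x := by
        refine integral_congr_ae (ae_of_all _ fun x => ?_)
        simp only [Pi.add_apply, smul_eq_mul]
        ring
      have hω : Continuous (conv errorKernel ψ) :=
        hc.continuous_convolution_right _ integrable_errorKernel.locallyIntegrable hψ.continuous
      have hωc : HasCompactSupport (conv errorKernel ψ) :=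
        hasCompactSupport_errorKernel.convolution _ hc
      have j1 : Integrable fun x => θ' x * conv errorKernel ψ x :=
        integrable_mul_of_locallyIntegrable iθ.locallyIntegrable hω hωc
      have j2 : Integrable fun x => F' x * conv (logKernel 0) ψ x :=
        integrable_mul_of_locallyIntegrable iF.locallyIntegrable hφ.continuous hφc
      have k1 : Integrable fun x => ψ x * θ' x + ψ x * conv errorKernel θ' x :=
        (hb _ iθ).add (hb _ i1)
      have k2 : Integrable fun x => ψ x * θ' x + θ' x * conv errorKernel ψ x :=
        (hb _ iθ).add j1
      rw [e1, integral_add k1 (hb _ i2), integral_add (hb _ iθ) (hb _ i1),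
        integral_mul_conv integrable_errorKernel errorKernel_neg iθ hψ.continuous hM,
        integral_mul_conv (integrable_logKernel le_rfl zero_le_one) logKernel_neg iF
          hψ.continuous hM, ← integral_add (hb _ iθ) j1, ← integral_add k2 j2]
      refine Eq.trans ?_ (h _ hφ hφc)
      refine integral_congr_ae (ae_of_all _ fun x => ?_)
      simp only
      rw [laplacian_conv hK hψ hc, conv_logKernel_laplacian hψ hc]
      by_cases hx : x ∈ closedBall (0 : ℂ) (n + 1)
      · rw [hθ', hF', Set.indicator_of_mem hx, Set.indicator_of_mem hx]
        ring
      · have hx' : (n : ℝ) + 1 < ‖x‖ := by simpa using hx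
        have z1 := tsupport_conv_logKernel_subset hs hx'
        have z2 := tsupport_conv_logKernel_subset ((tsupport_laplacian_subset ψ).trans hs) hx'
        rw [conv_logKernel_laplacian hψ hc] at z2
        rw [hθ', hF', Set.indicator_of_notMem hx, Set.indicator_of_notMem hx, z1, z2]
        ring
  filter_upwards [ae_all_iff.mpr key] with x hx
  obtain ⟨n, hn⟩ := exists_nat_gt ‖x‖
  exact hx n (mem_ball_zero_iff.mpr hn)

end MeanField

end

noncomputable section
namespace MeanField

open Filter Topology ComplexConjugate MeasureTheory Metric
open scoped Convolution

lemma abs_conv_le_of_bounded {K G : ℂ → ℝ} (hK : Integrable K) {M : ℝ} (hG : ∀ z, |G z| ≤ M)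
    (x : ℂ) : |conv K G x| ≤ (∫ t, |K t|) * M := by
  rw [conv_apply, ← integral_mul_const]
  refine (Real.norm_eq_abs _).symm.trans_le <|
    norm_integral_le_of_norm_le (hK.abs.mul_const M) (ae_of_all _ fun t => ?_)
  rw [Real.norm_eq_abs, abs_mul]
  exact mul_le_mul_of_nonneg_left (hG _) (abs_nonneg _)

lemma abs_conv_le_of_kernel_bounded {K G : ℂ → ℝ} (hG : Integrable G) {M : ℝ}
    (hK : ∀ z, |K z| ≤ M) (x : ℂ) : |conv K G x| ≤ M * ∫ t, |G t| := by
  rw [conv_apply, ← integral_sub_left_eq_self (fun t => |G t|) volume x, ← integral_const_mul]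
  refine (Real.norm_eq_abs _).symm.trans_le <|
    norm_integral_le_of_norm_le ((hG.abs.comp_sub_left x).const_mul M)
    (ae_of_all _ fun t => ?_)
  rw [Real.norm_eq_abs, abs_mul]
  exact mul_le_mul_of_nonneg_right (hK _) (abs_nonneg _)

lemma abs_conv_le_of_sq {K G : ℂ → ℝ} (hK : Integrable fun t => K t ^ 2)
    (hG : Integrable fun t => G t ^ 2) (x : ℂ) :
    |conv K G x| ≤ (∫ t, K t ^ 2) + ∫ t, G t ^ 2 := by
  rw [conv_apply, ← integral_sub_left_eq_self (fun t => G t ^ 2) volume x,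
    ← integral_add hK (hG.comp_sub_left x)]
  refine (Real.norm_eq_abs _).symm.trans_le <|
    norm_integral_le_of_norm_le (hK.add (hG.comp_sub_left x)) (ae_of_all _ fun t => ?_)
  rw [Real.norm_eq_abs, abs_le]
  constructor <;> nlinarith [sq_nonneg (K t + G (x - t)), sq_nonneg (K t - G (x - t)),
    sq_nonneg (K t), sq_nonneg (G (x - t))]

/-- Jensen's inequality for the exponential of a potential of small mass. -/
lemma exp_conv_le {m : ℂ → ℝ} (hm : Integrable m) (hm0 : ∀ z, 0 ≤ m z) (hm1 : ∫ z, m z ≤ 1) :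
    ∀ᵐ x, Real.exp (2 * -conv (logKernel 0) m x) ≤ 1 + (∫ z, m z)⁻¹ *
      conv ((closedBall (0 : ℂ) 1).indicator fun z => ‖z‖ ^ (-(1 : ℝ))) m x := by
  set k := (closedBall (0 : ℂ) 1).indicator fun z => ‖z‖ ^ (-(1 : ℝ))
  have hk : Integrable k := integrable_indicator_rpow (s := 1) (by norm_num)
  have hM0 : 0 ≤ ∫ z, m z := integral_nonneg hm0
  rcases hM0.eq_or_lt with hM | hM
  · have h0 : m =ᵐ[volume] 0 := (integral_eq_zero_iff_of_nonneg hm0 hm).mp hM.symm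
    refine ae_of_all _ fun x => ?_
    rw [← hM, show conv (logKernel 0) m = conv (logKernel 0) 0 from
      convolution_congr (ContinuousLinearMap.lsmul ℝ ℝ) (ae_eq_refl _) h0, conv_apply]
    simp
  filter_upwards [(integrable_logKernel le_rfl zero_le_one).ae_convolution_exists
    (ContinuousLinearMap.lsmul ℝ ℝ) hm, hk.ae_convolution_exists
    (ContinuousLinearMap.lsmul ℝ ℝ) hm] with x h1 h2
  have i1 : Integrable fun t => logKernel 0 t * m (x - t) := h1
  have i2 : Integrable fun t => k t * m (x - t) := h2
  have i0 : Integrable fun t => m (x - t) := hm.comp_sub_left x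
  set M := ∫ z, m z
  set a := 2 * -conv (logKernel 0) m x with ha
  have hMx : ∫ t, m (x - t) = M := integral_sub_left_eq_self _ _ _
  -- the tangent line of the exponential at `a` is integrated against `m (x - t) dt`
  have hpt : ∀ t, Real.exp a * (1 - a) * m (x - t) -
      Real.exp a * (2 * M) * (logKernel 0 t * m (x - t)) ≤ m (x - t) + k t * m (x - t) := by
    intro t
    have b1 := exp_neg_logKernel_le hM0 hm1 t
    have b2 : Real.exp a * (2 * M * -logKernel 0 t - a + 1) ≤
        Real.exp (2 * M * -logKernel 0 t) := by
      have : Real.exp (2 * M * -logKernel 0 t) =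
          Real.exp a * Real.exp (2 * M * -logKernel 0 t - a) := by
        rw [← Real.exp_add]; congr 1; ring
      rw [this]
      exact mul_le_mul_of_nonneg_left (Real.add_one_le_exp _) (Real.exp_pos a).le
    have := mul_le_mul_of_nonneg_right (b2.trans b1) (hm0 (x - t))
    linarith
  have hint := integral_mono ((i0.const_mul _).sub (i1.const_mul _)) (i0.add i2) hpt
  simp only [Pi.sub_apply, Pi.add_apply] at hint
  rw [integral_sub (i0.const_mul _) (i1.const_mul _), integral_add i0 i2, integral_const_mul,
    integral_const_mul, hMx, ← conv_apply, ← conv_apply] at hint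
  have hc : conv (logKernel 0) m x = -a / 2 := by rw [ha]; ring
  rw [hc] at hint
  have : Real.exp a ≤ (M + conv k m x) / M := by
    rw [le_div_iff₀ hM]
    linarith
  rwa [add_div, div_self hM.ne', div_eq_inv_mul] at this

section Regularity

variable {U θ : ℂ → ℝ} (hU : Continuous U) (hU0 : ∀ z, 0 ≤ U z) (hθ : LocallyIntegrable θ)
  (hm : LocallyIntegrable fun z => U z * Real.exp (θ z))
  (hrep : ∀ᵐ x, θ x = -(conv errorKernel θ x) -
    conv (logKernel 0) (fun z => U z * (Real.exp (θ z) - 1)) x)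

include hU hm in
lemma locallyIntegrable_source : LocallyIntegrable fun z => U z * (Real.exp (θ z) - 1) := by
  have : (fun z => U z * (Real.exp (θ z) - 1)) = fun z => U z * Real.exp (θ z) - U z := by
    ext z; ring
  rw [this]
  exact hm.sub hU.locallyIntegrable

include hU hU0 hθ hm hrep

/-- `e ^ θ` is locally square integrable: a bounded part of the density `U e ^ θ` and `- U`
contribute a potential bounded above, and the rest has mass at most `1`, so that Jensen's inequality
applies to it. -/
lemma integrableOn_exp_two_mul (R : ℝ) :
    IntegrableOn (fun z => Real.exp (2 * θ z)) (closedBall (0 : ℂ) R) := by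
  set B := closedBall (0 : ℂ) (R + 1)
  set θ' := B.indicator θ with hθ'
  set m := B.indicator fun z => U z * Real.exp (θ z) with hmd
  set V := B.indicator U with hV
  have iθ : Integrable θ' := integrable_indicator_of_locallyIntegrable hθ _
  have im : Integrable m := integrable_indicator_of_locallyIntegrable hm _
  have iV : Integrable V := integrable_indicator_of_locallyIntegrable hU.locallyIntegrable _
  have hm0 : ∀ z, 0 ≤ m z := fun z =>
    Set.indicator_nonneg (fun z _ => mul_nonneg (hU0 z) (Real.exp_pos _).le) z
  -- the part of the density above a high level has small mass
  obtain ⟨N, hN⟩ : ∃ N : ℕ, ∫ z, (m z - min (m z) N) ≤ 1 := by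
    have hlim : Tendsto (fun N : ℕ => ∫ z, (m z - min (m z) N)) atTop (𝓝 (∫ _ : ℂ, (0 : ℝ))) := by
      refine tendsto_integral_of_dominated_convergence m
        (fun N => im.aestronglyMeasurable.sub
          (im.aestronglyMeasurable.inf aestronglyMeasurable_const)) im (fun N => ?_) ?_
      · refine ae_of_all _ fun z => ?_
        have h1 : 0 ≤ min (m z) N := le_min (hm0 z) N.cast_nonneg
        rw [Real.norm_of_nonneg (sub_nonneg.mpr (min_le_left _ _))]
        linarith
      · refine ae_of_all _ fun z => ?_
        obtain ⟨N₀, hN₀⟩ := exists_nat_ge (m z)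
        refine tendsto_const_nhds.congr' ?_
        filter_upwards [eventually_ge_atTop N₀] with N hN
        have : (N₀ : ℝ) ≤ N := by exact_mod_cast hN
        rw [min_eq_left (hN₀.trans this), sub_self]
    rw [integral_zero] at hlim
    exact (hlim.eventually_le_const one_pos).exists
  set m₁ := fun z => min (m z) N with hm₁
  set m₂ := fun z => m z - min (m z) N with hm₂
  have hm₁0 : ∀ z, 0 ≤ m₁ z := fun z => le_min (hm0 z) N.cast_nonneg
  have im₁ : Integrable m₁ := im.mono' (im.aestronglyMeasurable.inf aestronglyMeasurable_const)
    (ae_of_all _ fun z => by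
      rw [Real.norm_of_nonneg (hm₁0 z)]; exact min_le_left _ _)
  have im₂ : Integrable m₂ := im.sub im₁
  have hm₂0 : ∀ z, 0 ≤ m₂ z := fun z => sub_nonneg.mpr (min_le_left _ _)
  have iP := integrable_logKernel le_rfl zero_le_one
  obtain ⟨D, hD⟩ := contDiff_errorKernel.continuous.bounded_above_of_compact_support
    hasCompactSupport_errorKernel
  set C := D * (∫ t, |θ' t|) + (∫ t, |logKernel 0 t|) * N
  set k := (closedBall (0 : ℂ) 1).indicator fun z => ‖z‖ ^ (-(1 : ℝ))
  have ik : Integrable k := integrable_indicator_rpow (s := 1) (by norm_num)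
  have hbound : IntegrableOn (fun x => Real.exp (2 * C) * (1 + (∫ z, m₂ z)⁻¹ * conv k m₂ x))
      (closedBall (0 : ℂ) R) := by
    refine Integrable.const_mul (Integrable.add ?_ (Integrable.const_mul ?_ _)) _
    · exact integrableOn_const (isCompact_closedBall (0 : ℂ) R).measure_lt_top.ne
    · exact (ik.integrable_convolution (ContinuousLinearMap.lsmul ℝ ℝ) im₂).integrableOn
  have hmeas : AEStronglyMeasurable (fun z => Real.exp (2 * θ z)) :=
    Real.continuous_exp.comp_aestronglyMeasurable (hθ.aestronglyMeasurable.const_mul 2)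
  refine Integrable.mono' hbound hmeas.restrict ?_
  rw [ae_restrict_iff' measurableSet_closedBall]
  filter_upwards [hrep, exp_conv_le im₂ hm₂0 hN,
    iP.ae_convolution_exists (ContinuousLinearMap.lsmul ℝ ℝ) im₁,
    iP.ae_convolution_exists (ContinuousLinearMap.lsmul ℝ ℝ) im₂,
    iP.ae_convolution_exists (ContinuousLinearMap.lsmul ℝ ℝ) iV] with x h1 h2 e1 e2 e3 hx
  rw [mem_closedBall_zero_iff] at hx
  rw [Real.norm_of_nonneg (Real.exp_pos _).le]
  have hsplit : B.indicator (fun z => U z * (Real.exp (θ z) - 1)) = m₁ + m₂ - V := by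
    ext z
    simp only [Pi.add_apply, Pi.sub_apply, hm₁, hm₂, hmd, hV]
    by_cases hz : z ∈ B
    · simp only [Set.indicator_of_mem hz]; ring
    · simp only [Set.indicator_of_notMem hz]; ring
  have hconv : conv (logKernel 0) (fun z => U z * (Real.exp (θ z) - 1)) x =
      conv (logKernel 0) m₁ x + conv (logKernel 0) m₂ x - conv (logKernel 0) V x := by
    rw [conv_congr_indicator (fun t => logKernel_eq_zero_of_lt) hx, hsplit]
    have i1 : Integrable fun t => logKernel 0 t * m₁ (x - t) := e1
    have i2 : Integrable fun t => logKernel 0 t * m₂ (x - t) := e2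
    have i3 : Integrable fun t => logKernel 0 t * V (x - t) := e3
    have i12 : Integrable fun t => logKernel 0 t * m₁ (x - t) + logKernel 0 t * m₂ (x - t) :=
      i1.add i2
    simp only [conv_apply, Pi.add_apply, Pi.sub_apply]
    rw [← integral_add i1 i2, ← integral_sub i12 i3]
    refine integral_congr_ae (ae_of_all _ fun t => ?_)
    simp only
    ring
  have b1 : -conv errorKernel θ x ≤ D * ∫ t, |θ' t| := by
    rw [conv_congr_indicator (fun t => errorKernel_eq_zero) hx]
    exact (neg_le_abs _).trans (abs_conv_le_of_kernel_bounded iθ hD x)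
  have b2 : -conv (logKernel 0) m₁ x ≤ (∫ t, |logKernel 0 t|) * N :=
    (neg_le_abs _).trans (abs_conv_le_of_bounded iP (fun z => by
      rw [abs_of_nonneg (hm₁0 z)]; exact min_le_right _ _) x)
  have b3 : conv (logKernel 0) V x ≤ 0 := by
    rw [conv_apply]
    refine integral_nonpos fun t => mul_nonpos_of_nonpos_of_nonneg (logKernel_nonpos t) ?_
    exact Set.indicator_nonneg (fun z _ => hU0 z) _
  calc Real.exp (2 * θ x) ≤ Real.exp (2 * C + 2 * -conv (logKernel 0) m₂ x) := by
        refine Real.exp_le_exp.mpr ?_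
        rw [h1, hconv]
        linarith
    _ = Real.exp (2 * C) * Real.exp (2 * -conv (logKernel 0) m₂ x) := Real.exp_add _ _
    _ ≤ _ := mul_le_mul_of_nonneg_left h2 (Real.exp_pos _).le

/-- `θ` is locally bounded, since the logarithmic kernel and the source are both locally square
integrable. -/
lemma exists_bound_ae (R : ℝ) : ∃ C, ∀ᵐ x, ‖x‖ ≤ R → |θ x| ≤ C := by
  set B := closedBall (0 : ℂ) (R + 1)
  set F := fun z => U z * (Real.exp (θ z) - 1) with hF
  have iθ : Integrable (B.indicator θ) := integrable_indicator_of_locallyIntegrable hθ _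
  obtain ⟨D, hD⟩ := contDiff_errorKernel.continuous.bounded_above_of_compact_support
    hasCompactSupport_errorKernel
  obtain ⟨E, hE⟩ := (isCompact_closedBall (0 : ℂ) (R + 1)).exists_bound_of_continuousOn
    hU.continuousOn
  have hsq : Integrable fun z => (B.indicator F z) ^ 2 := by
    have hFm : AEStronglyMeasurable (B.indicator F) :=
      (locallyIntegrable_source hU hm).aestronglyMeasurable.indicator measurableSet_closedBall
    have hb : Integrable (B.indicator fun z => E ^ 2 * (Real.exp (2 * θ z) + 1)) := by
      rw [integrable_indicator_iff measurableSet_closedBall]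
      refine Integrable.const_mul (Integrable.add
        (integrableOn_exp_two_mul hU hU0 hθ hm hrep (R + 1)) ?_) _
      exact integrableOn_const (isCompact_closedBall (0 : ℂ) (R + 1)).measure_lt_top.ne
    refine hb.mono' (hFm.pow 2) (ae_of_all _ fun z => ?_)
    by_cases hz : z ∈ B
    · rw [Set.indicator_of_mem hz, Set.indicator_of_mem hz, Real.norm_of_nonneg (sq_nonneg _), hF]
      simp only
      rw [mul_pow]
      have h1 : U z ^ 2 ≤ E ^ 2 := pow_le_pow_left₀ (hU0 z) ((le_abs_self _).trans (hE z hz)) 2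
      have h2 : (Real.exp (θ z) - 1) ^ 2 ≤ Real.exp (2 * θ z) + 1 := by
        rw [two_mul, Real.exp_add]
        nlinarith [Real.exp_pos (θ z)]
      gcongr
    · simp [Set.indicator_of_notMem hz]
  refine ⟨D * (∫ t, |B.indicator θ t|) +
    ((∫ t, logKernel 0 t ^ 2) + ∫ t, (B.indicator F t) ^ 2), ?_⟩
  filter_upwards [hrep] with x hx hxR
  rw [hx, conv_congr_indicator (fun t => errorKernel_eq_zero) hxR,
    conv_congr_indicator (fun t => logKernel_eq_zero_of_lt) hxR]
  have b1 := abs_conv_le_of_kernel_bounded iθ hD x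
  have b2 := abs_conv_le_of_sq integrable_logKernel_sq hsq x
  refine (abs_sub _ _).trans ?_
  rw [abs_neg]
  exact add_le_add b1 b2

/-- The convolution representation is continuous, its source being locally bounded. -/
lemma continuous_representation : Continuous fun x => -(conv errorKernel θ x) -
    conv (logKernel 0) (fun z => U z * (Real.exp (θ z) - 1)) x := by
  set F := fun z => U z * (Real.exp (θ z) - 1) with hF
  have h1 : Continuous (conv errorKernel θ) :=
    hasCompactSupport_errorKernel.continuous_convolution_left _ contDiff_errorKernel.continuous hθ
  refine h1.neg.sub (continuous_iff_continuousAt.mpr fun x => ?_)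
  obtain ⟨C, hC⟩ := exists_bound_ae hU hU0 hθ hm hrep (‖x‖ + 1 + 1)
  set B := closedBall (0 : ℂ) (‖x‖ + 1 + 1)
  obtain ⟨E, hE⟩ := (isCompact_closedBall (0 : ℂ) (‖x‖ + 1 + 1)).exists_bound_of_continuousOn
    hU.continuousOn
  -- truncation makes the source bounded everywhere
  set G := B.indicator fun z => max (-(E * (Real.exp C + 1))) (min (F z) (E * (Real.exp C + 1)))
  set N := E * (Real.exp C + 1) with hN
  have hN0 : 0 ≤ N := by
    have := (norm_nonneg _).trans (hE 0 (mem_closedBall_self (by positivity)))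
    have := Real.exp_pos C
    positivity
  have hGN : ∀ z, ‖G z‖ ≤ N := fun z => by
    by_cases hz : z ∈ B
    · simp only [G, Set.indicator_of_mem hz, Real.norm_eq_abs, abs_le]
      exact ⟨le_max_left _ _, max_le (by linarith) (min_le_right _ _)⟩
    · simp only [G, Set.indicator_of_notMem hz, norm_zero]; exact hN0
  have hFm := (locallyIntegrable_source hU hm).aestronglyMeasurable
  have hGi : Integrable G := by
    refine Integrable.mono' (g := B.indicator fun _ => N) ?_
      ((aestronglyMeasurable_const.sup (hFm.inf aestronglyMeasurable_const)).indicator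
        measurableSet_closedBall) (ae_of_all _ fun z => ?_)
    · rw [integrable_indicator_iff measurableSet_closedBall]
      exact integrableOn_const (isCompact_closedBall (0 : ℂ) (‖x‖ + 1 + 1)).measure_lt_top.ne
    · by_cases hz : z ∈ B
      · rw [Set.indicator_of_mem hz (f := fun _ => N)]; exact hGN z
      · simp [G, Set.indicator_of_notMem hz]
  have hFG : ∀ᵐ z, ‖z‖ ≤ ‖x‖ + 1 + 1 → F z = G z := by
    filter_upwards [hC] with z hz hzB
    have hzB' : z ∈ B := mem_closedBall_zero_iff.mpr hzB
    have h2 := hz hzB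
    have h3 : |F z| ≤ N := by
      rw [hF, hN, abs_mul]
      have h5 : Real.exp (θ z) ≤ Real.exp C := Real.exp_le_exp.mpr ((le_abs_self _).trans h2)
      have h6 := Real.exp_pos (θ z)
      refine mul_le_mul (hE z hzB') (abs_le.mpr ⟨by linarith [Real.exp_pos C], by linarith⟩)
        (abs_nonneg _) ((abs_nonneg _).trans (hE z hzB'))
    rw [abs_le] at h3
    simp only [G, Set.indicator_of_mem hzB']
    rw [min_eq_left h3.2, max_eq_right h3.1]
  have hd : Continuous (conv (logKernel 0) G) := continuous_iff_continuousAt.mpr fun y =>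
    (hasFDerivAt_logKernel_convolution hGi hGN y).continuousAt
  refine hd.continuousAt.congr ?_
  filter_upwards [isOpen_ball.mem_nhds (show x ∈ ball (0 : ℂ) (‖x‖ + 1) by simp)] with y hy
  exact (conv_congr_of_ball (fun t => logKernel_eq_zero_of_lt) hFG
    (mem_ball_zero_iff.mp hy).le).symm

end Regularity

/-- Regularity: a distribution solution of `Δ θ = - U (e ^ θ - 1)` agrees almost everywhere with a
smooth solution. -/
theorem exists_contDiff_of_integral_test {U θ : ℂ → ℝ} (hU : ContDiff ℝ ∞ U) (hU0 : ∀ z, 0 ≤ U z)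
    (hθ : LocallyIntegrable θ) (hm : LocallyIntegrable fun z => U z * Real.exp (θ z))
    (h : ∀ ψ : ℂ → ℝ, ContDiff ℝ ∞ ψ → HasCompactSupport ψ →
      ∫ z, (θ z * Δ ψ z + U z * (Real.exp (θ z) - 1) * ψ z) = 0) :
    ∃ τ : ℂ → ℝ, ContDiff ℝ ∞ τ ∧ θ =ᵐ[volume] τ ∧
      ∀ z, Δ τ z = -(U z * (Real.exp (τ z) - 1)) := by
  have hF := locallyIntegrable_source hU.continuous hm
  have hrep := ae_eq_conv_of_integral_test hθ hF h
  have hcont := continuous_representation hU.continuous hU0 hθ hm hrep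
  set τ := fun x => -(conv errorKernel θ x) -
    conv (logKernel 0) (fun z => U z * (Real.exp (θ z) - 1)) x with hτ
  have hae : θ =ᵐ[volume] τ := hrep
  have hτrep : ∀ x, τ x = -(conv errorKernel τ x) -
      conv (logKernel 0) (fun z => U z * (Real.exp (τ z) - 1)) x := by
    intro x
    have e1 : conv errorKernel θ = conv errorKernel τ :=
      convolution_congr (ContinuousLinearMap.lsmul ℝ ℝ) (ae_eq_refl _) hae
    have e2 : conv (logKernel 0) (fun z => U z * (Real.exp (θ z) - 1)) =
        conv (logKernel 0) (fun z => U z * (Real.exp (τ z) - 1)) :=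
      convolution_congr (ContinuousLinearMap.lsmul ℝ ℝ) (ae_eq_refl _)
        (hae.mono fun z hz => by simp only [hz])
    rw [← e1, ← e2]
  have hω : ContDiff ℝ ∞ (conv errorKernel τ) :=
    hasCompactSupport_errorKernel.contDiff_convolution_left (n := ⊤) _ contDiff_errorKernel
      hcont.locallyIntegrable
  have hn : ∀ n : ℕ, ContDiff ℝ n τ := by
    intro n
    -- near `x` only a cut-off source matters, and the parametrix gains one derivative
    induction n with
    | zero => exact_mod_cast contDiff_zero.mpr hcont
    | succ n ih =>
      rw [contDiff_iff_contDiffAt]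
      intro x
      let χ : ContDiffBump (0 : ℂ) := ⟨‖x‖ + 1 + 1, ‖x‖ + 1 + 1 + 1, by positivity, by linarith⟩
      set G := fun z => χ z * (U z * (Real.exp (τ z) - 1)) with hG
      have hGn : ContDiff ℝ n G := χ.contDiff.mul ((hU.of_le (by
        exact_mod_cast le_top)).mul ((Real.contDiff_exp.comp ih).sub contDiff_const))
      have hPG := contDiff_logKernel_convolution hGn χ.hasCompactSupport.mul_right
      have e : τ =ᶠ[𝓝 x] fun y => -(conv errorKernel τ y) - conv (logKernel 0) G y := by
        filter_upwards [isOpen_ball.mem_nhds (show x ∈ ball (0 : ℂ) (‖x‖ + 1) by simp)] with y hy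
        rw [hτrep y]
        congr 1
        refine conv_congr_of_ball (fun t => logKernel_eq_zero_of_lt) (ae_of_all _ fun z hz => ?_)
          (mem_ball_zero_iff.mp hy).le
        rw [hG]
        simp only
        rw [χ.one_of_mem_closedBall (mem_closedBall_zero_iff.mpr hz), one_mul]
      refine ContDiffAt.congr_of_eventuallyEq ?_ e
      exact ((hω.of_le (by exact_mod_cast le_top)).neg.sub (by exact_mod_cast hPG)).contDiffAt
  have hτs : ContDiff ℝ ∞ τ := contDiff_infty.mpr hn
  refine ⟨τ, hτs, hae, fun z => ?_⟩
  have hc1 : Continuous (Δ τ) := (contDiff_laplacian hτs).continuous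
  have hc2 : Continuous fun z => U z * (Real.exp (τ z) - 1) :=
    hU.continuous.mul ((Real.continuous_exp.comp hcont).sub continuous_const)
  have hzero : ∀ᵐ z, Δ τ z + U z * (Real.exp (τ z) - 1) = 0 := by
    refine ae_eq_zero_of_integral_contDiff_smul_eq_zero (hc1.add hc2).locallyIntegrable
      fun ψ hψ hc => ?_
    have hL := (contDiff_laplacian hψ).continuous
    have hLc := hasCompactSupport_laplacian hc
    have e1 := integral_mul_laplacian hψ hc fun z _ =>
      (hτs.of_le (m := 2) (by norm_cast)).contDiffAt (x := z)
    have i1 := integrable_mul_of_locallyIntegrable hc1.locallyIntegrable hψ.continuous hc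
    have i2 := integrable_mul_of_locallyIntegrable hc2.locallyIntegrable hψ.continuous hc
    have i3 := integrable_mul_of_locallyIntegrable hcont.locallyIntegrable hL hLc
    have e2 : ∫ z, (τ z * Δ ψ z + U z * (Real.exp (τ z) - 1) * ψ z) = 0 := by
      rw [← h ψ hψ hc]
      refine integral_congr_ae (hae.mono fun z hz => ?_)
      simp only [hz]
    rw [integral_add i3 i2, e1, ← integral_add i1 i2] at e2
    rw [← e2]
    refine integral_congr_ae (ae_of_all _ fun z => ?_)
    simp only [smul_eq_mul]
    ring
  have := (hc1.add hc2).ae_eq_iff_eq volume (continuous_const (y := (0 : ℝ))) |>.mp hzero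
  have hz := congrFun this z
  simp only [Pi.add_apply] at hz
  linarith

end MeanField

end

noncomputable section
namespace MeanField

open Filter Topology ComplexConjugate MeasureTheory Metric

/-! ### Uniqueness of the solution -/

lemma dz_comp_add {f : ℂ → ℂ} {l : ℂ} (h : ∀ z, f (z + l) = f z) (z : ℂ) :
    dz f (z + l) = dz f z := by
  have : fderiv ℝ f (z + l) = fderiv ℝ f z := by
    rw [← fderiv_comp_add_right, funext h]
  rw [dz, dz, this]

namespace IsDevelopingPair

variable {L : PeriodPair} {A B : ℂ → ℂ} (h : IsDevelopingPair L A B)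
include h

lemma differentiable_wronskian : Differentiable ℂ (wronskian A B) :=
  MeanField.differentiable_wronskian h.diffA h.diffB

lemma eq_of_notMem_lattice {f g : ℂ → ℂ} (hf : Continuous f) (hg : Continuous g)
    (e : ∀ z, wronskian A B z ≠ 0 → f z = g z) (z : ℂ) : f z = g z :=
  congrFun (hf.ext_on (dense_compl_lattice L) hg
    fun z hz => e z ((h.wronskian_eq_zero z).not.mpr hz)) z

/-- An entire function `X` such that `X / W` is an elliptic function of the lattice is a multiple
of `W`, since `X / W` has at most simple poles and these lie on the lattice. -/
lemma exists_eq_const_mul_wronskian {X : ℂ → ℂ} (hX : Differentiable ℂ X)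
    (hper : ∀ l ∈ L.lattice, ∀ z,
      X z * wronskian A B (z + l) = X (z + l) * wronskian A B z) :
    ∃ d : ℂ, ∀ z, X z = d * wronskian A B z := by
  set W := wronskian A B with hW
  have dW : Differentiable ℂ W := h.differentiable_wronskian
  set Y := fun z => A z * B z with hY
  have dY : Differentiable ℂ Y := h.diffA.mul h.diffB
  set a := -(L.ω₁ / 2) with ha
  have hWa : W a ≠ 0 := by
    rw [Ne, hW, h.wronskian_eq_zero, ha, neg_mem_iff]
    exact L.ω₁_div_two_notMem_lattice
  set d := X a / W a with hd
  have hsub : Differentiable ℂ fun z => X z - d * W z := hX.sub (dW.const_mul d)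
  -- `(X - d W) / (A B)` is `ω₁`-periodic and changes sign under `ω₂`, because `W / (A B)` does
  have hsh : ∀ l : ℂ, Continuous fun z : ℂ => z + l := fun l => continuous_add_const l
  have key1 : ∀ z, (X z - d * W z) * Y (z + L.ω₁) = (X (z + L.ω₁) - d * W (z + L.ω₁)) * Y z := by
    refine h.eq_of_notMem_lattice (hsub.continuous.mul (dY.continuous.comp (hsh _)))
      ((hsub.continuous.comp (hsh _)).mul dY.continuous) fun z hz => ?_
    have e1 := hper _ L.ω₁_mem_lattice z
    have e2 := h.wronskian_add_ω₁ z
    apply mul_right_cancel₀ hz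
    change (X z - d * W z) * (A (z + L.ω₁) * B (z + L.ω₁)) * W z =
      (X (z + L.ω₁) - d * W (z + L.ω₁)) * (A z * B z) * W z
    linear_combination (A z * B z) * e1 - X z * e2 + d * W z * e2
  have key2 : ∀ z, (X z - d * W z) * Y (z + L.ω₂) =
      -((X (z + L.ω₂) - d * W (z + L.ω₂)) * Y z) := by
    refine h.eq_of_notMem_lattice (hsub.continuous.mul (dY.continuous.comp (hsh _)))
      ((hsub.continuous.comp (hsh _)).mul dY.continuous).neg fun z hz => ?_
    have e1 := hper _ L.ω₂_mem_lattice z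
    have e2 := h.wronskian_add_ω₂ z
    apply mul_right_cancel₀ hz
    change (X z - d * W z) * (A (z + L.ω₂) * B (z + L.ω₂)) * W z =
      -((X (z + L.ω₂) - d * W (z + L.ω₂)) * (A z * B z)) * W z
    linear_combination -(A z * B z) * e1 + X z * e2 - d * W z * e2
  have key22 : ∀ z, (X z - d * W z) * Y (z + (double L).ω₂) =
      (X (z + (double L).ω₂) - d * W (z + (double L).ω₂)) * Y z := by
    have e0 : (double L).ω₂ = L.ω₂ + L.ω₂ := by rw [double]; ring
    rw [e0]
    refine fun z => h.eq_of_regular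
      (f := fun z => (X (z - L.ω₂) - d * W (z - L.ω₂)) * Y (z - L.ω₂ + (L.ω₂ + L.ω₂)))
      (g := fun z => (X (z - L.ω₂ + (L.ω₂ + L.ω₂)) - d * W (z - L.ω₂ + (L.ω₂ + L.ω₂))) *
        Y (z - L.ω₂)) ?_ ?_ (fun z hz => ?_) (z + L.ω₂) |> fun e => by simpa using e
    · exact (hsub.continuous.comp (continuous_sub_right _)).mul
        (dY.continuous.comp (by fun_prop))
    · exact (hsub.continuous.comp (by fun_prop : Continuous fun z => z - L.ω₂ + (L.ω₂ + L.ω₂))).mul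
        (dY.continuous.comp (by fun_prop))
    · have e1 := key2 (z - L.ω₂)
      have e2 := key2 z
      have e3 : z - L.ω₂ + (L.ω₂ + L.ω₂) = z + L.ω₂ := by ring
      rw [sub_add_cancel] at e1
      rw [e3]
      have hz' : Y z ≠ 0 := hz
      apply mul_right_cancel₀ hz'
      linear_combination Y (z + L.ω₂) * e1 - Y (z - L.ω₂) * e2
  -- by the choice of `d` it has no poles, so it is constant, and the sign change makes it zero
  obtain ⟨c, hc⟩ := exists_eq_const_mul_of_simple_zeros (double L) hsub dY (fun z hz => by
      have hd := ((h.diffA z).hasDerivAt.mul (h.diffB z).hasDerivAt).deriv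
      change deriv Y z = _ at hd
      rw [hd]
      rcases mul_eq_zero.mp hz with h0 | h0
      · rw [h0, zero_mul, add_zero]
        exact mul_ne_zero (h.simpleA z h0) (h.disjoint z h0)
      · rw [h0, mul_zero, zero_add]
        exact mul_ne_zero (fun hA => h.disjoint z hA h0) (h.simpleB z h0))
    (fun z hz => by
      have hl := (h.zeros z).mp hz
      have e := hper _ hl a
      have e1 : a + (z + L.ω₁ / 2) = z := by rw [ha]; ring
      rw [e1] at e
      rw [hd]
      field_simp
      linear_combination -e)
    key1 key22
  refine ⟨d, fun z => ?_⟩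
  have hY0 : Y 0 ≠ 0 := fun h0 => by
    have := (h.zeros 0).mp h0
    rw [zero_add] at this
    exact L.ω₁_div_two_notMem_lattice this
  have hY2 : Y (0 + L.ω₂) ≠ 0 := fun h0 => by
    have := (h.zeros _).mp h0
    rw [zero_add] at this
    refine L.ω₁_div_two_notMem_lattice ?_
    have := sub_mem this L.ω₂_mem_lattice
    rwa [add_sub_cancel_left] at this
  have hc0 : c = 0 := by
    have e := key2 0
    rw [hc, hc] at e
    have : c * (Y 0 * Y (0 + L.ω₂)) = 0 := by linear_combination e / 2
    exact (mul_eq_zero.mp this).resolve_right (mul_ne_zero hY0 hY2)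
  have := hc z
  rw [hc0, zero_mul] at this
  exact sub_eq_zero.mp this

end IsDevelopingPair

end MeanField

end

noncomputable section
namespace MeanField

open Filter Topology ComplexConjugate MeasureTheory Metric

lemma contDiff_ofReal_comp {S : ℂ → ℝ} (hS : ContDiff ℝ ∞ S) : ContDiff ℝ ∞ fun z => (S z : ℂ) :=
  Complex.ofRealCLM.contDiff.comp hS

lemma hasWirtingerAt_exp {s : ℂ → ℂ} (hs : ContDiff ℝ ∞ s) (z : ℂ) :
    HasWirtingerAt (fun z => Complex.exp (s z)) (Complex.exp (s z) * dz s z)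
      (Complex.exp (s z) * dzb s z) z :=
  HasWirtingerAt.comp (Complex.hasDerivAt_exp _) (hasWirtingerAt_of_contDiff hs z)

lemma dz_exp_mul {s t : ℂ → ℂ} (hs : ContDiff ℝ ∞ s) (ht : ContDiff ℝ ∞ t) (z : ℂ) :
    dz (fun z => Complex.exp (s z) * t z) z = Complex.exp (s z) * (dz s z * t z + dz t z) := by
  rw [((hasWirtingerAt_exp hs z).mul (hasWirtingerAt_of_contDiff ht z)).dz_eq]
  ring

lemma dz_dz_exp_mul {s t : ℂ → ℂ} (hs : ContDiff ℝ ∞ s) (ht : ContDiff ℝ ∞ t) (z : ℂ) :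
    dz (dz fun z => Complex.exp (s z) * t z) z = Complex.exp (s z) *
      ((dz (dz s) z + dz s z ^ 2) * t z + 2 * (dz s z * dz t z) + dz (dz t) z) := by
  rw [funext (dz_exp_mul hs ht)]
  have hs1 := hasWirtingerAt_of_contDiff (contDiff_dz hs) z
  have ht1 := hasWirtingerAt_of_contDiff (contDiff_dz ht) z
  rw [((hasWirtingerAt_exp hs z).mul ((hs1.mul (hasWirtingerAt_of_contDiff ht z)).add ht1)).dz_eq]
  ring

lemma deriv_wronskian_eq {A B : ℂ → ℂ} (hA : Differentiable ℂ A) (hB : Differentiable ℂ B)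
    (z : ℂ) : deriv (wronskian A B) z =
      deriv (deriv A) z * B z - A z * deriv (deriv B) z := by
  have hA' : Differentiable ℂ (deriv A) := (hA.contDiff (n := 2)).differentiable_deriv_two
  have hB' : Differentiable ℂ (deriv B) := (hB.contDiff (n := 2)).differentiable_deriv_two
  have := (((hA' z).hasDerivAt.mul (hB z).hasDerivAt).sub
    ((hA z).hasDerivAt.mul (hB' z).hasDerivAt)).deriv
  change deriv (wronskian A B) z = _ at this
  rw [this]
  ring

namespace IsDevelopingPair

variable {L : PeriodPair} {A B : ℂ → ℂ} (h : IsDevelopingPair L A B)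
include h

lemma wronskian_mul_dz_dz_pairNorm (z : ℂ) :
    wronskian A B z * dz (dz fun z => (pairNorm A B z : ℂ)) z -
      deriv (wronskian A B) z * dz (fun z => (pairNorm A B z : ℂ)) z =
    (deriv A z * deriv (deriv B) z - deriv (deriv A) z * deriv B z) * pairNorm A B z := by
  rw [(hasWirtingerAt_dz_pairNorm h.diffA h.diffB z).dz_eq,
    (hasWirtingerAt_pairNorm h.diffA h.diffB z).dz_eq, deriv_wronskian_eq h.diffA h.diffB,
    ofReal_pairNorm, wronskian]
  ring

/-- If `e ^ S (|A|² + |B|²)` with `S` elliptic solves the same Monge–Ampère type equation as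
`|A|² + |B|²`, then it solves the same linear second order equation. The difference of the two
potentials is a multiple `d W` of the Wronskian, and comparing first derivatives at the simple zero
`0` of `W` gives `d = 0`. -/
lemma linear_equation {S : ℂ → ℝ} (hS : ContDiff ℝ ∞ S) (hper : IsPeriodic L S)
    {w : ℂ → ℂ} (hw : w = fun z => Complex.exp (S z) * pairNorm A B z)
    (heq : ∀ z, w z * dzb (dz w) z - dz w z * dzb w z =
      wronskian A B z * conj (wronskian A B z)) (z : ℂ) :
    wronskian A B z * dz (dz w) z - deriv (wronskian A B) z * dz w z =
      (deriv A z * deriv (deriv B) z - deriv (deriv A) z * deriv B z) * w z := by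
  set W := wronskian A B with hW
  set s : ℂ → ℂ := fun z => (S z : ℂ) with hs
  set t : ℂ → ℂ := fun z => (pairNorm A B z : ℂ) with ht
  set U : ℂ → ℂ := fun z => (conformalFactor A B z : ℂ) with hU
  have dW : Differentiable ℂ W := h.differentiable_wronskian
  have dW' : Differentiable ℂ (deriv W) := (dW.contDiff (n := 2)).differentiable_deriv_two
  have dA' : Differentiable ℂ (deriv A) := (h.diffA.contDiff (n := 2)).differentiable_deriv_two
  have dB' : Differentiable ℂ (deriv B) := (h.diffB.contDiff (n := 2)).differentiable_deriv_two
  have dA'' : Differentiable ℂ (deriv (deriv A)) :=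
    (dA'.contDiff (n := 2)).differentiable_deriv_two
  have dB'' : Differentiable ℂ (deriv (deriv B)) :=
    (dB'.contDiff (n := 2)).differentiable_deriv_two
  have cs : ContDiff ℝ ∞ s := contDiff_ofReal_comp hS
  have ct : ContDiff ℝ ∞ t := contDiff_ofReal_comp (contDiff_pairNorm h.diffA h.diffB)
  have t0 : ∀ z, t z ≠ 0 := fun z => Complex.ofReal_ne_zero.mpr (h.pairNorm_pos z).ne'
  have w0 : ∀ z, w z ≠ 0 := fun z => by
    rw [hw]; exact mul_ne_zero (Complex.exp_ne_zero _) (t0 z)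
  have cw : ContDiff ℝ ∞ w := by rw [hw]; exact cs.cexp.mul ct
  set K : ℂ → ℂ := fun z =>
    deriv A z * deriv (deriv B) z - deriv (deriv A) z * deriv B z with hK
  have dK : Differentiable ℂ K := (dA'.mul dB'').sub (dA''.mul dB')
  have hKt : ∀ z, W z * dz (dz t) z - deriv W z * dz t z = K z * t z :=
    h.wronskian_mul_dz_dz_pairNorm
  set X : ℂ → ℂ := fun z => (W z * dz (dz w) z - deriv W z * dz w z) / w z - K z with hX
  have dX : Differentiable ℂ X := (differentiable_schwarzian cw w0 dW heq).sub dK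
  have hXt : ∀ z, X z * t z = W z * ((dz (dz s) z + dz s z * dz s z) * t z) +
      dz s z * (2 * (W z * dz t z) - deriv W z * t z) := by
    intro z
    have e1 : dz w z = Complex.exp (s z) * (dz s z * t z + dz t z) := by
      rw [hw]; exact dz_exp_mul cs ct z
    have e2 : dz (dz w) z = Complex.exp (s z) *
        ((dz (dz s) z + dz s z ^ 2) * t z + 2 * (dz s z * dz t z) + dz (dz t) z) := by
      rw [hw]; exact dz_dz_exp_mul cs ct z
    have e3 : w z = Complex.exp (s z) * t z := by rw [hw]
    have hE := Complex.exp_ne_zero (s z)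
    have := t0 z
    simp only [hX]
    rw [e1, e2, e3]
    field_simp
    linear_combination hKt z
  have hdU : ∀ z, W z * dz U z * t z ^ 3 =
      2 / Real.pi * (W z * conj (W z)) * (deriv W z * t z - 2 * (W z * dz t z)) := by
    intro z
    have e : U = fun z => 2 / Real.pi * (W z * conj (W z) / (t z * t z)) := by
      ext z
      simp only [hU, ht, conformalFactor, ← hW]
      rw [Complex.mul_conj, Complex.normSq_eq_norm_sq]
      push_cast
      ring
    have dw := HasWirtingerAt.of_hasDerivAt (dW z).hasDerivAt
    have dt := hasWirtingerAt_of_contDiff ct z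
    rw [e, ((HasWirtingerAt.const (2 / Real.pi : ℂ)).mul
      ((dw.mul dw.conjugate).div (dt.mul dt) (mul_ne_zero (t0 z) (t0 z)))).dz_eq]
    have := t0 z
    simp only [map_zero]
    field_simp
    ring
  have hU : ∀ z, U z * t z ^ 2 = 2 / Real.pi * (W z * conj (W z)) := by
    intro z
    simp only [hU, ht, conformalFactor, ← hW]
    rw [Complex.mul_conj, Complex.normSq_eq_norm_sq]
    have := t0 z
    simp only [ht] at this
    push_cast
    field_simp
  -- `X / W` is expressed by elliptic functions: `S` and the conformal factor `U`
  have hXU : ∀ z, X z * U z =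
      W z * ((dz (dz s) z + dz s z * dz s z) * U z - dz s z * dz U z) := by
    intro z
    apply mul_right_cancel₀ (pow_ne_zero 3 (t0 z))
    linear_combination (U z * t z ^ 2) * hXt z + dz s z * hdU z +
      dz s z * (2 * (W z * dz t z) - deriv W z * t z) * hU z
  have hsper : ∀ l ∈ L.lattice, ∀ z, s (z + l) = s z := fun l hl z => by
    simp only [hs]; rw [hper l hl]
  have hUper : ∀ l ∈ L.lattice, ∀ z, U (z + l) = U z := fun l hl z => by
    change ((conformalFactor A B (z + l) : ℝ) : ℂ) = (conformalFactor A B z : ℝ)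
    rw [h.isPeriodic_conformalFactor l hl]
  obtain ⟨d, hd⟩ := h.exists_eq_const_mul_wronskian dX fun l hl => by
    refine h.eq_of_notMem_lattice
      (dX.continuous.mul (dW.continuous.comp (continuous_add_const l)))
      ((dX.continuous.comp (continuous_add_const l)).mul dW.continuous) fun z hz => ?_
    have hU0 : U z ≠ 0 := Complex.ofReal_ne_zero.mpr
      ((conformalFactor_eq_zero_iff h.pairNorm_pos z).not.mpr hz)
    have e1 := hXU z
    have e2 := hXU (z + l)
    rw [hUper l hl, dz_comp_add (hsper l hl), dz_comp_add (hUper l hl),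
      dz_comp_add (dz_comp_add (hsper l hl))] at e2
    apply mul_right_cancel₀ hU0
    linear_combination W (z + l) * e1 - W z * e2
  have W0 : W 0 = 0 := (h.wronskian_eq_zero 0).mpr (zero_mem _)
  have W0' : deriv W 0 ≠ 0 := h.deriv_wronskian 0 (zero_mem _)
  have X0 : X 0 = 0 := by rw [hd, ← hW, W0, mul_zero]
  have s0 : dz s 0 = 0 := by
    have e := hXt 0
    rw [X0, W0] at e
    have : dz s 0 * (deriv W 0 * t 0) = 0 := by linear_combination e
    exact (mul_eq_zero.mp this).resolve_right (mul_ne_zero W0' (t0 0))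
  -- first derivatives at the simple zero `0` of `W`
  have hd0 : d = 0 := by
    have w1 := HasWirtingerAt.of_hasDerivAt (dW 0).hasDerivAt
    have w1' := HasWirtingerAt.of_hasDerivAt (dW' 0).hasDerivAt
    have x1 := HasWirtingerAt.of_hasDerivAt ((dW 0).hasDerivAt.const_mul d)
    have x2 : HasWirtingerAt X (d * deriv W 0) 0 0 := by
      rw [funext hd]; exact x1
    have s1 := hasWirtingerAt_of_contDiff (contDiff_dz cs) 0
    have s2 := hasWirtingerAt_of_contDiff (contDiff_dz (contDiff_dz cs)) 0
    have t1 := hasWirtingerAt_of_contDiff ct 0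
    have t2 := hasWirtingerAt_of_contDiff (contDiff_dz ct) 0
    have r1 := (w1.mul ((s2.add (s1.mul s1)).mul t1)).add (s1.mul
      (((HasWirtingerAt.const 2).mul (w1.mul t2)).sub (w1'.mul t1)))
    have l1 := x2.mul t1
    rw [funext hXt] at l1
    have e := (l1.unique r1).1
    simp only [W0, s0, X0] at e
    have : d * (deriv W 0 * t 0) = 0 := by linear_combination e
    exact (mul_eq_zero.mp this).resolve_right (mul_ne_zero W0' (t0 0))
  have e := hd z
  rw [hd0, zero_mul, sub_eq_zero, div_eq_iff (w0 z)] at e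
  exact e

end IsDevelopingPair

end MeanField

end

noncomputable section
namespace MeanField

open Filter Topology ComplexConjugate MeasureTheory Metric

namespace IsDevelopingPair

variable {L : PeriodPair} {A B : ℂ → ℂ} (h : IsDevelopingPair L A B)
include h

/-- A Hermitian form in the developing pair which is an elliptic multiple of `|A|² + |B|²` is a
constant multiple of it: the translation by `ω₁` kills the cross terms and the translation by `ω₂`
interchanges the diagonal ones. -/
lemma hermitian_form_const {E : ℂ → ℂ} (h1 : ∀ z, E (z + L.ω₁) = E z)
    (h2 : ∀ z, E (z + L.ω₂) = E z) {a b c d : ℂ}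
    (e : ∀ z, E z * (pairNorm A B z : ℂ) = a * (B z * conj (B z)) - b * (B z * conj (A z)) -
      c * (A z * conj (B z)) + d * (A z * conj (A z))) (z : ℂ) : E z = a := by
  have cA := h.diffA.continuous
  have cB := h.diffB.continuous
  have cc : Continuous (conj : ℂ → ℂ) := Complex.continuous_conj
  simp only [ofReal_pairNorm] at e
  have k1 : ∀ z, b * (B z * conj (A z)) + c * (A z * conj (B z)) = 0 := by
    refine h.eq_of_regular (by fun_prop) continuous_const fun z hz => ?_
    obtain ⟨t, ht, e1, e2, -⟩ := h.exists_factor_ω₁ hz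
    have f1 := e (z + L.ω₁)
    rw [e1, e2, h1] at f1
    simp only [map_neg, map_mul] at f1
    have : t * conj t ≠ 0 := mul_ne_zero ht ((map_ne_zero _).mpr ht)
    apply mul_left_cancel₀ this
    linear_combination (t * conj t * e z - f1) / 2
  have k2 : ∀ z, (a - d) * (A z * conj (A z) - B z * conj (B z)) = 0 := by
    refine h.eq_of_regular (by fun_prop) continuous_const fun z hz => ?_
    obtain ⟨t, ht, e1, e2, -⟩ := h.exists_factor_ω₂ hz
    have f1 := e (z + L.ω₂)
    have f2 := k1 (z + L.ω₂)
    rw [e1, e2] at f2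
    rw [e1, e2, h2] at f1
    simp only [map_mul] at f1 f2
    have : t * conj t ≠ 0 := mul_ne_zero ht ((map_ne_zero _).mpr ht)
    apply mul_left_cancel₀ this
    linear_combination t * conj t * e z - f1 - t * conj t * k1 z + f2
  have had : a = d := by
    have hz : A (-(L.ω₁ / 2)) * B (-(L.ω₁ / 2)) = 0 := (h.zeros _).mpr (by simp)
    refine sub_eq_zero.mp ((mul_eq_zero.mp (k2 (-(L.ω₁ / 2)))).resolve_right ?_)
    rcases mul_eq_zero.mp hz with h0 | h0
    · have := h.disjoint _ h0
      rw [h0]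
      simpa using this
    · have : A (-(L.ω₁ / 2)) ≠ 0 := fun hA => h.disjoint _ hA h0
      rw [h0]
      simpa using this
  have ht : A z * conj (A z) + B z * conj (B z) ≠ 0 := by
    rw [← ofReal_pairNorm]
    exact Complex.ofReal_ne_zero.mpr (h.pairNorm_pos z).ne'
  apply mul_right_cancel₀ ht
  linear_combination e z - k1 z - A z * conj (A z) * had

/-- An elliptic function `S` for which `e ^ S (|A|² + |B|²)` solves the same equation as
`|A|² + |B|²` is constant: the solution is a Hermitian form in `A` and `B`. -/
lemma eq_const_of_equation {S : ℂ → ℝ} (hS : ContDiff ℝ ∞ S) (hper : IsPeriodic L S)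
    {w : ℂ → ℂ} (hw : w = fun z => Complex.exp (S z) * pairNorm A B z)
    (heq : ∀ z, w z * dzb (dz w) z - dz w z * dzb w z =
      wronskian A B z * conj (wronskian A B z)) : ∃ c : ℝ, ∀ z, S z = c := by
  set W := wronskian A B with hW
  have dW : Differentiable ℂ W := h.differentiable_wronskian
  have dA' : Differentiable ℂ (deriv A) := (h.diffA.contDiff (n := 2)).differentiable_deriv_two
  have dB' : Differentiable ℂ (deriv B) := (h.diffB.contDiff (n := 2)).differentiable_deriv_two
  have dA'' : Differentiable ℂ (deriv (deriv A)) :=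
    (dA'.contDiff (n := 2)).differentiable_deriv_two
  have dB'' : Differentiable ℂ (deriv (deriv B)) :=
    (dB'.contDiff (n := 2)).differentiable_deriv_two
  have cs := contDiff_ofReal_comp hS
  have ct := contDiff_ofReal_comp (contDiff_pairNorm h.diffA h.diffB)
  have cw : ContDiff ℝ ∞ w := by rw [hw]; exact cs.cexp.mul ct
  have hr : ∀ z, conj (w z) = w z := fun z => by
    rw [hw]
    simp only [map_mul, Complex.conj_ofReal, ← Complex.ofReal_exp]
  set K : ℂ → ℂ := fun z =>
    deriv A z * deriv (deriv B) z - deriv (deriv A) z * deriv B z with hK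
  have dK : Differentiable ℂ K := (dA'.mul dB'').sub (dA''.mul dB')
  have ew : ∀ z, W z * dz (dz w) z - deriv W z * dz w z = K z * w z :=
    h.linear_equation hS hper hw heq
  have eA : ∀ z, W z * deriv (deriv A) z - deriv W z * deriv A z = K z * A z := fun z => by
    simp only [hK, hW]
    rw [deriv_wronskian_eq h.diffA h.diffB, wronskian]
    ring
  have eB : ∀ z, W z * deriv (deriv B) z - deriv W z * deriv B z = K z * B z := fun z => by
    simp only [hK, hW]
    rw [deriv_wronskian_eq h.diffA h.diffB, wronskian]
    ring
  have hW0 : ∀ z ∈ (L.lattice : Set ℂ)ᶜ, W z ≠ 0 := fun z hz =>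
    (h.wronskian_eq_zero z).not.mpr hz
  have hVo := isOpen_compl_lattice L
  have hVc := isPreconnected_compl_lattice L
  obtain ⟨a, ha⟩ := exists_wronskian_const hVo hVc cw hr dW hW0 dK h.diffA h.diffA ew eA eA
  obtain ⟨b, hb⟩ := exists_wronskian_const hVo hVc cw hr dW hW0 dK h.diffA h.diffB ew eA eB
  obtain ⟨c, hc⟩ := exists_wronskian_const hVo hVc cw hr dW hW0 dK h.diffB h.diffA ew eB eA
  obtain ⟨d, hd⟩ := exists_wronskian_const hVo hVc cw hr dW hW0 dK h.diffB h.diffB ew eB eB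
  have cA := h.diffA.continuous
  have cB := h.diffB.continuous
  have cc : Continuous (conj : ℂ → ℂ) := Complex.continuous_conj
  have key : ∀ z, w z = a * (B z * conj (B z)) - b * (B z * conj (A z)) -
      c * (A z * conj (B z)) + d * (A z * conj (A z)) := by
    refine h.eq_of_notMem_lattice cw.continuous (by fun_prop) fun z hz => ?_
    have hz' : z ∈ (L.lattice : Set ℂ)ᶜ := fun hl => hz ((h.wronskian_eq_zero z).mpr hl)
    apply mul_right_cancel₀ (mul_ne_zero hz ((map_ne_zero conj).mpr hz))
    have e : wronskian A B z = deriv A z * B z - A z * deriv B z := rfl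
    have e' : conj (wronskian A B z) =
        conj (deriv A z) * conj (B z) - conj (A z) * conj (deriv B z) := by
      rw [e]; simp only [map_sub, map_mul]
    have ha' := ha z hz'
    have hb' := hb z hz'
    have hc' := hc z hz'
    have hd' := hd z hz'
    simp only [hW] at ha' hb' hc' hd'
    have expand : w z * (wronskian A B z * conj (wronskian A B z)) =
      w z * ((deriv A z * B z - A z * deriv B z) *
        (conj (deriv A z) * conj (B z) - conj (A z) * conj (deriv B z))) := by rw [e', e]
    rw [expand]
    linear_combination (B z * conj (B z)) * ha' - (B z * conj (A z)) * hb' -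
      (A z * conj (B z)) * hc' + (A z * conj (A z)) * hd'
  have hconst := h.hermitian_form_const (E := fun z => Complex.exp (S z))
    (fun z => by rw [hper _ L.ω₁_mem_lattice])
    (fun z => by rw [hper _ L.ω₂_mem_lattice]) (a := a) (b := b) (c := c) (d := d)
    (fun z => by rw [← key, hw])
  refine ⟨S 0, fun z => Real.exp_injective (Complex.ofReal_injective ?_)⟩
  rw [Complex.ofReal_exp, Complex.ofReal_exp]
  exact (hconst z).trans (hconst 0).symm

/-- The mean field equation has no solution other than the explicit one. -/
lemma ae_eq_of_isSolution {v : ℂ → ℝ} (hv : IsSolution L (4 * Real.pi) v) :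
    v =ᵐ[volume] fun z => Real.log (conformalFactor A B z) := by
  set u : ℂ → ℝ := fun z => Real.log (conformalFactor A B z) with hu
  have hus := h.isSolution_log_conformalFactor
  rw [← hu] at hus
  have hc0 := contDiff_conformalFactor h.diffA h.diffB h.pairNorm_pos
  have hexp : ∀ᵐ z, Real.exp (u z) = conformalFactor A B z := h.exp_log_ae_eq
  set U : ℂ → ℝ := fun z => 4 * Real.pi * conformalFactor A B z with hU
  have hUs : ContDiff ℝ ∞ U := contDiff_const.mul hc0
  have hU0 : ∀ z, 0 ≤ U z := fun z => by
    have := conformalFactor_nonneg A B z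
    simp only [hU]
    positivity
  set θ : ℂ → ℝ := fun z => v z - u z with hθ
  have hθi : LocallyIntegrable θ := hv.locallyIntegrable.sub hus.locallyIntegrable
  have hUe : (fun z => U z * Real.exp (θ z)) =ᵐ[volume] fun z =>
      4 * Real.pi * Real.exp (v z) := by
    filter_upwards [hexp] with z hz
    simp only [hU, hθ, Real.exp_sub, ← hz]
    have := Real.exp_ne_zero (u z)
    field_simp
  have hm : LocallyIntegrable fun z => U z * Real.exp (θ z) :=
    (hv.locallyIntegrable_exp.smul (4 * Real.pi)).congr hUe.symm
  obtain ⟨τ, hτ, hτe, hΔ⟩ := exists_contDiff_of_integral_test hUs hU0 hθi hm fun ψ hψ hc => by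
    have hL := (contDiff_laplacian hψ).continuous
    have hLc := hasCompactSupport_laplacian hc
    have i : ∀ {y : ℂ → ℝ}, IsSolution L (4 * Real.pi) y → Integrable fun z =>
        y z * Δ ψ z + 4 * Real.pi * Real.exp (y z) * ψ z := fun hy => by
      have j := (integrable_mul_of_locallyIntegrable hy.locallyIntegrable_exp hψ.continuous
        hc).const_mul (4 * Real.pi)
      simp only [← mul_assoc] at j
      exact (integrable_mul_of_locallyIntegrable hy.locallyIntegrable hL hLc).add j
    have e : ∫ z, (θ z * Δ ψ z + U z * (Real.exp (θ z) - 1) * ψ z) =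
        ∫ z, ((v z * Δ ψ z + 4 * Real.pi * Real.exp (v z) * ψ z) -
          (u z * Δ ψ z + 4 * Real.pi * Real.exp (u z) * ψ z)) := by
      refine integral_congr_ae ?_
      filter_upwards [hexp, hUe] with z h1 h2
      rw [mul_sub, h2, h1]
      simp only [hθ, hU]
      ring
    rw [e, integral_sub (i hv) (i hus), hv.integral_test hψ hc, hus.integral_test hψ hc, sub_self]
  have hτp : IsPeriodic L τ := by
    intro l hl
    refine congrFun ((Continuous.ae_eq_iff_eq volume (hτ.continuous.comp
      (continuous_add_const l)) hτ.continuous).mp ?_)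
    have h1 : (fun z => θ (z + l)) =ᵐ[volume] fun z => τ (z + l) :=
      (measurePreserving_add_right volume l).quasiMeasurePreserving.ae_eq hτe
    have h2 : (fun z => θ (z + l)) = θ := funext fun z => by
      simp only [hθ]
      rw [hv.periodic l hl, hus.periodic l hl]
    rw [h2] at h1
    exact h1.symm.trans hτe
  have hTs := contDiff_pairNorm h.diffA h.diffB
  have hS : ContDiff ℝ ∞ fun z => -τ z / 2 := hτ.neg.div_const 2
  set Y : ℂ → ℝ := fun z => Real.exp (-τ z / 2) * pairNorm A B z with hY
  have hYs : ContDiff ℝ ∞ Y := hS.exp.mul hTs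
  have hY0 : ∀ z, 0 < Y z := fun z => mul_pos (Real.exp_pos _) (h.pairNorm_pos z)
  -- the metric `e ^ v` has the same curvature, which is a second order equation for `Y`
  have hlog : ∀ z, Δ (fun z => Real.log (Y z)) z =
      4 * (‖wronskian A B z‖ ^ 2 / Y z ^ 2) := by
    intro z
    have e : (fun z => Real.log (Y z)) =
        (-(1 / 2) : ℝ) • τ + fun z => Real.log (pairNorm A B z) := by
      ext z
      simp only [hY, Pi.add_apply, Pi.smul_apply, smul_eq_mul]
      rw [Real.log_mul (Real.exp_ne_zero _) (h.pairNorm_pos z).ne', Real.log_exp]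
      ring
    have c1 : ContDiffAt ℝ 2 τ z := (hτ.of_le (by norm_cast)).contDiffAt
    have c2 : ContDiffAt ℝ 2 (fun z => Real.log (pairNorm A B z)) z :=
      ((hTs.log fun z => (h.pairNorm_pos z).ne').of_le (by norm_cast)).contDiffAt
    have c3 : ContDiffAt ℝ 2 ((-(1 / 2) : ℝ) • τ) z := c1.const_smul (-(1 / 2) : ℝ)
    rw [e, c3.laplacian_add c2, InnerProductSpace.laplacian_smul _ c1,
      laplacian_log_pairNorm h.diffA h.diffB h.pairNorm_pos, hΔ]
    simp only [hU, hY, conformalFactor, mul_pow, ← Real.exp_nat_mul]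
    have e1 : Real.exp ((2 : ℕ) * (-τ z / 2)) = (Real.exp (τ z))⁻¹ := by
      rw [← Real.exp_neg]; congr 1; push_cast; ring
    rw [e1]
    have := (h.pairNorm_pos z).ne'
    have := Real.exp_ne_zero (τ z)
    have := Real.pi_ne_zero
    simp only [smul_eq_mul]
    field_simp
    ring
  obtain ⟨c, hc⟩ := h.eq_const_of_equation (S := fun z => -τ z / 2) hS
    (fun l hl z => by simp only [hτp l hl z]) (w := fun z => (Y z : ℂ))
    (by ext z; simp only [hY]; push_cast; rfl) (fun z => by
      have e := laplacian_log hYs hY0 (z := z) rfl rfl rfl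
      rw [hlog] at e
      have : (Y z : ℂ) ≠ 0 := Complex.ofReal_ne_zero.mpr (hY0 z).ne'
      rw [Complex.mul_conj, Complex.normSq_eq_norm_sq]
      push_cast at e
      field_simp at e
      push_cast
      linear_combination -e)
  have hτc : τ = fun _ => -(2 * c) := by
    ext z
    linarith [hc z]
  have hc0 : -(2 * c) = 0 := by
    obtain ⟨z, hz⟩ : ∃ z, z ∉ L.lattice := ⟨_, L.ω₁_div_two_notMem_lattice⟩
    have e := hΔ z
    rw [hτc, InnerProductSpace.laplacian_const] at e
    have hp := h.conformalFactor_pos hz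
    have hp2 : 4 * Real.pi * conformalFactor A B z ≠ 0 := by positivity
    simp only [hU, Pi.zero_apply, zero_eq_neg, mul_eq_zero (a := 4 * Real.pi * _), hp2,
      false_or] at e
    rw [← Real.exp_eq_one_iff]
    linarith
  filter_upwards [hτe] with z hz
  rw [hτc] at hz
  simp only [hθ, hc0] at hz
  linarith

end IsDevelopingPair

end MeanField

end

noncomputable section
namespace MeanField

open Filter Topology ComplexConjugate MeasureTheory Metric

/-! ### Quotients of entire functions -/

section Quotient

lemma eventually_codiscrete_nhdsNE {p : ℂ → Prop} (h : ∀ᶠ z in codiscrete ℂ, p z) (z : ℂ) :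
    ∀ᶠ w in 𝓝[≠] z, p w := by
  have := mem_codiscrete.mp h z
  rw [disjoint_principal_right, compl_compl] at this
  exact this

lemma eventually_codiscrete_ne_zero {Q : ℂ → ℂ} (hQ : Differentiable ℂ Q) {z₀ : ℂ}
    (h0 : Q z₀ ≠ 0) : ∀ᶠ z in codiscrete ℂ, Q z ≠ 0 := by
  have ha : AnalyticOnNhd ℂ Q Set.univ := fun z _ => hQ.analyticAt z
  exact (ha.eqOn_zero_or_eventually_ne_zero_of_preconnected isPreconnected_univ).resolve_left
    fun h => h0 (h (Set.mem_univ z₀))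

/-- Two meromorphic functions in normal form which agree off a discrete set are equal. -/
lemma eq_of_eventuallyEq_codiscrete {F G : ℂ → ℂ} (hF : MeromorphicNFOn F Set.univ)
    (hG : MeromorphicNFOn G Set.univ) (h : F =ᶠ[codiscrete ℂ] G) : F = G := by
  ext z
  exact (((hF (Set.mem_univ z)).eventuallyEq_nhdsNE_iff_eventuallyEq_nhds
    (hG (Set.mem_univ z))).mp (eventually_codiscrete_nhdsNE h z)).self_of_nhds

/-- The identity theorem for meromorphic functions. -/
lemma eventually_codiscrete_eq_zero {D : ℂ → ℂ} (hD : MeromorphicOn D Set.univ) {z₀ : ℂ}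
    (h : ∀ᶠ z in 𝓝 z₀, D z = 0) : ∀ᶠ z in codiscrete ℂ, D z = 0 := by
  have h0 : meromorphicOrderAt D z₀ = ⊤ :=
    meromorphicOrderAt_eq_top_iff.mpr (h.filter_mono nhdsWithin_le_nhds)
  refine mem_codiscrete.mpr fun z => ?_
  rw [disjoint_principal_right, compl_compl]
  have h1 : meromorphicOrderAt D z = ⊤ := by
    by_contra hz
    exact hD.meromorphicOrderAt_ne_top_of_isPreconnected isPreconnected_univ (Set.mem_univ z)
      (Set.mem_univ z₀) hz h0
  exact meromorphicOrderAt_eq_top_iff.mp h1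

lemma nonempty_of_mem_codiscrete {S : Set ℂ} (h : S ∈ codiscrete ℂ) : S.Nonempty := by
  have := eventually_codiscrete_nhdsNE h 0
  exact Filter.nonempty_of_mem this

variable {P Q : ℂ → ℂ} (hP : Differentiable ℂ P) (hQ : Differentiable ℂ Q)
  (hd : ∀ z, P z = 0 → Q z ≠ 0)
include hP hQ hd

lemma meromorphicNFOn_div : MeromorphicNFOn (fun z => P z / Q z) Set.univ := fun z _ =>
  MeromorphicNFOn.div (hP.analyticAt z) (hQ.analyticAt z).meromorphicNFAt
    (or_iff_not_imp_left.mpr fun h h' => h fun h0 => hd z h' h0)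

/-- The value `0` which the junk division gives to `P / Q` at a zero of `Q` does not make the
quotient analytic there. -/
lemma ne_zero_of_analyticAt_div {z₀ z : ℂ} (h0 : Q z₀ ≠ 0)
    (hz : AnalyticAt ℂ (fun z => P z / Q z) z) : Q z ≠ 0 := by
  intro hQz
  have hPz : P z ≠ 0 := fun h => hd z h hQz
  have t1 : Tendsto (fun w => P w / Q w * Q w) (𝓝[≠] z) (𝓝 (P z / Q z * Q z)) :=
    ((hz.continuousAt.mul hQ.continuous.continuousAt).tendsto).mono_left nhdsWithin_le_nhds
  have t2 : Tendsto P (𝓝[≠] z) (𝓝 (P z)) :=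
    hP.continuous.continuousAt.tendsto.mono_left nhdsWithin_le_nhds
  have e : (fun w => P w / Q w * Q w) =ᶠ[𝓝[≠] z] P := by
    filter_upwards [eventually_codiscrete_nhdsNE (eventually_codiscrete_ne_zero hQ h0) z] with w hw
    exact div_mul_cancel₀ _ hw
  have := tendsto_nhds_unique (t1.congr' e) t2
  rw [hQz, mul_zero] at this
  exact hPz this.symm

omit hd in
lemma deriv_div_eq_wronskian {z : ℂ} (hz : Q z ≠ 0) :
    deriv (fun z => P z / Q z) z = wronskian P Q z / Q z ^ 2 := by
  rw [((hP z).hasDerivAt.fun_div (hQ z).hasDerivAt hz).deriv, wronskian]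

omit hP hQ hd in
/-- With `D` the Wronskian of `P` and `Q` this computes the spherical derivative of `P / Q`. -/
lemma sphericalDerivative_div {z : ℂ} (hz : Q z ≠ 0) (D : ℂ) :
    ‖D / Q z ^ 2‖ ^ 2 / (1 + ‖P z / Q z‖ ^ 2) ^ 2 = ‖D‖ ^ 2 / pairNorm P Q z ^ 2 := by
  have := norm_ne_zero_iff.mpr hz
  have h1 : ‖P z‖ ^ 2 + ‖Q z‖ ^ 2 ≠ 0 := by positivity
  have h2 : ‖Q z‖ ^ 2 + ‖P z‖ ^ 2 ≠ 0 := by positivity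
  rw [norm_div, norm_div, norm_pow, pairNorm]
  field_simp
  ring

lemma isDevelopingMap_div {L : PeriodPair} {c : ℝ} {u : ℂ → ℝ} {z₀ : ℂ} (h0 : Q z₀ ≠ 0)
    (hu : ∀ z ∉ L.lattice,
      Real.exp (u z) = Real.exp c * (‖wronskian P Q z‖ ^ 2 / pairNorm P Q z ^ 2)) :
    IsDevelopingMap L c u fun z => P z / Q z where
  meromorphic := meromorphicNFOn_div hP hQ hd
  exp_eq z hz ha := by
    have := ne_zero_of_analyticAt_div hP hQ hd h0 ha
    rw [deriv_div_eq_wronskian hP hQ this, sphericalDerivative_div this, hu z hz]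

end Quotient

/-! ### Rigidity of the developing map -/

/-- Two pairs of holomorphic functions with the same Wronskian and proportional norms differ by a
constant special unitary matrix: the entries of the matrix are both holomorphic and
antiholomorphic. -/
lemma exists_unitary_of_pairNorm_eq {V : Set ℂ} (hVo : IsOpen V) (hVc : IsPreconnected V)
    {x : ℂ} (hx : x ∈ V) {A B P Q : ℂ → ℂ} (hA : DifferentiableOn ℂ A V)
    (hB : DifferentiableOn ℂ B V) (hP : DifferentiableOn ℂ P V) (hQ : DifferentiableOn ℂ Q V)
    (hW0 : ∀ z ∈ V, wronskian A B z ≠ 0) (hW : ∀ z ∈ V, wronskian P Q z = wronskian A B z)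
    {κ : ℝ} (hκ : 0 < κ) (hn : ∀ z ∈ V, pairNorm P Q z = κ * pairNorm A B z) :
    κ = 1 ∧ ∃ p q : ℂ, ‖p‖ ^ 2 + ‖q‖ ^ 2 = 1 ∧ ∀ z ∈ V,
      P z = p * A z - conj q * B z ∧ Q z = q * A z + conj p * B z := by
  have der : ∀ {F : ℂ → ℂ}, DifferentiableOn ℂ F V → ∀ z ∈ V, HasDerivAt F (deriv F z) z :=
    fun hF z hz => (hF.differentiableAt (hVo.mem_nhds hz)).hasDerivAt
  have der' : ∀ {F : ℂ → ℂ}, DifferentiableOn ℂ F V → DifferentiableOn ℂ (deriv F) V :=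
    fun hF => hF.deriv hVo
  have wir : ∀ {F : ℂ → ℂ}, DifferentiableOn ℂ F V → ∀ z ∈ V,
      HasWirtingerAt F (deriv F z) 0 z := fun hF z hz => .of_hasDerivAt (der hF z hz)
  have R00 : ∀ z ∈ V, P z * conj (P z) + Q z * conj (Q z) =
      κ * (A z * conj (A z) + B z * conj (B z)) := fun z hz => by
    rw [← ofReal_pairNorm, ← ofReal_pairNorm, hn z hz, Complex.ofReal_mul]
  have R10 : ∀ z ∈ V, deriv P z * conj (P z) + deriv Q z * conj (Q z) =
      κ * (deriv A z * conj (A z) + deriv B z * conj (B z)) := fun z hz => by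
    have l1 := ((wir hP z hz).mul (wir hP z hz).conjugate).add
      ((wir hQ z hz).mul (wir hQ z hz).conjugate)
    have l2 := (HasWirtingerAt.const (κ : ℂ)).mul (((wir hA z hz).mul (wir hA z hz).conjugate).add
      ((wir hB z hz).mul (wir hB z hz).conjugate))
    have l3 := HasFDerivAt.congr_of_eventuallyEq l2 (by
      filter_upwards [hVo.mem_nhds hz] with w hw using R00 w hw)
    have := (HasWirtingerAt.unique l1 l3).1
    simp only [map_zero] at this
    linear_combination this
  have R11 : ∀ z ∈ V, deriv P z * conj (deriv P z) + deriv Q z * conj (deriv Q z) =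
      κ * (deriv A z * conj (deriv A z) + deriv B z * conj (deriv B z)) := fun z hz => by
    have l1 := ((wir (der' hP) z hz).mul (wir hP z hz).conjugate).add
      ((wir (der' hQ) z hz).mul (wir hQ z hz).conjugate)
    have l2 := (HasWirtingerAt.const (κ : ℂ)).mul (((wir (der' hA) z hz).mul
      (wir hA z hz).conjugate).add ((wir (der' hB) z hz).mul (wir hB z hz).conjugate))
    have l3 := HasFDerivAt.congr_of_eventuallyEq l2 (by
      filter_upwards [hVo.mem_nhds hz] with w hw using R10 w hw)
    have := (HasWirtingerAt.unique l1 l3).2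
    linear_combination this
  have R01 : ∀ z ∈ V, P z * conj (deriv P z) + Q z * conj (deriv Q z) =
      κ * (A z * conj (deriv A z) + B z * conj (deriv B z)) := fun z hz => by
    have := congrArg conj (R10 z hz)
    simp only [map_add, map_mul, Complex.conj_conj, Complex.conj_ofReal] at this
    linear_combination this
  -- the matrix entries, by Cramer's rule
  set p : ℂ → ℂ := fun z => (deriv P z * B z - P z * deriv B z) / wronskian A B z with hp
  set q : ℂ → ℂ := fun z => (deriv Q z * B z - Q z * deriv B z) / wronskian A B z with hq
  set r : ℂ → ℂ := fun z => (P z * deriv A z - deriv P z * A z) / wronskian A B z with hr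
  set s : ℂ → ℂ := fun z => (Q z * deriv A z - deriv Q z * A z) / wronskian A B z with hs
  have hWd : DifferentiableOn ℂ (wronskian A B) V := ((der' hA).mul hB).sub (hA.mul (der' hB))
  have dp : DifferentiableOn ℂ p V := (((der' hP).mul hB).sub (hP.mul (der' hB))).div hWd hW0
  have dq : DifferentiableOn ℂ q V := (((der' hQ).mul hB).sub (hQ.mul (der' hB))).div hWd hW0
  have dr : DifferentiableOn ℂ r V := ((hP.mul (der' hA)).sub ((der' hP).mul hA)).div hWd hW0
  have ds : DifferentiableOn ℂ s V := ((hQ.mul (der' hA)).sub ((der' hQ).mul hA)).div hWd hW0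
  have eW : ∀ z, wronskian A B z = deriv A z * B z - A z * deriv B z := fun _ => rfl
  have eW' : ∀ z ∈ V, wronskian A B z = deriv P z * Q z - P z * deriv Q z := fun z hz =>
    (hW z hz).symm
  have eWc : ∀ z, conj (wronskian A B z) =
      conj (deriv A z) * conj (B z) - conj (A z) * conj (deriv B z) := fun z => by
    rw [eW]; simp only [map_sub, map_mul]
  have eWc' : ∀ z ∈ V, conj (wronskian A B z) =
      conj (deriv P z) * conj (Q z) - conj (P z) * conj (deriv Q z) := fun z hz => by
    rw [eW' z hz]; simp only [map_sub, map_mul]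
  have hWc0 : ∀ z ∈ V, conj (wronskian A B z) ≠ 0 := fun z hz =>
    (map_ne_zero conj).mpr (hW0 z hz)
  have e1 : ∀ z ∈ V, p z = κ * conj (s z) := fun z hz => by
    have h1 := hW0 z hz
    have h2 := hWc0 z hz
    simp only [hp, hs, map_div₀, map_sub, map_mul]
    rw [← mul_div_assoc, div_eq_div_iff h1 h2]
    linear_combination (deriv P z * B z - P z * deriv B z) * eWc' z hz -
      κ * (conj (Q z) * conj (deriv A z) - conj (deriv Q z) * conj (A z)) * eW z +
      conj (Q z) * B z * R11 z hz - conj (Q z) * deriv B z * R01 z hz -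
      conj (deriv Q z) * B z * R10 z hz + conj (deriv Q z) * deriv B z * R00 z hz
  have e2 : ∀ z ∈ V, s z = κ * conj (p z) := fun z hz => by
    have h1 := hW0 z hz
    have h2 := hWc0 z hz
    simp only [hp, hs, map_div₀, map_sub, map_mul]
    rw [← mul_div_assoc, div_eq_div_iff h1 h2]
    linear_combination (Q z * deriv A z - deriv Q z * A z) * eWc' z hz -
      κ * (conj (deriv P z) * conj (B z) - conj (P z) * conj (deriv B z)) * eW z +
      conj (deriv P z) * deriv A z * R00 z hz - conj (deriv P z) * A z * R10 z hz -
      conj (P z) * deriv A z * R01 z hz + conj (P z) * A z * R11 z hz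
  have e3 : ∀ z ∈ V, q z = -(κ * conj (r z)) := fun z hz => by
    have h1 := hW0 z hz
    have h2 := hWc0 z hz
    simp only [hq, hr, map_div₀, map_sub, map_mul]
    rw [← mul_div_assoc, ← neg_div, div_eq_div_iff h1 h2]
    linear_combination (deriv Q z * B z - Q z * deriv B z) * eWc' z hz +
      κ * (conj (P z) * conj (deriv A z) - conj (deriv P z) * conj (A z)) * eW z -
      (conj (P z) * B z * R11 z hz - conj (P z) * deriv B z * R01 z hz -
      conj (deriv P z) * B z * R10 z hz + conj (deriv P z) * deriv B z * R00 z hz)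
  have e4 : ∀ z ∈ V, r z = -(κ * conj (q z)) := fun z hz => by
    have h1 := hW0 z hz
    have h2 := hWc0 z hz
    simp only [hq, hr, map_div₀, map_sub, map_mul]
    rw [← mul_div_assoc, ← neg_div, div_eq_div_iff h1 h2]
    linear_combination (P z * deriv A z - deriv P z * A z) * eWc' z hz +
      κ * (conj (deriv Q z) * conj (B z) - conj (Q z) * conj (deriv B z)) * eW z -
      (conj (deriv Q z) * deriv A z * R00 z hz - conj (deriv Q z) * A z * R10 z hz -
      conj (Q z) * deriv A z * R01 z hz + conj (Q z) * A z * R11 z hz)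
  have edet : ∀ z ∈ V, p z * s z - q z * r z = 1 := fun z hz => by
    have h1 := hW0 z hz
    simp only [hp, hq, hr, hs]
    field_simp
    linear_combination -wronskian A B z * eW z -
      (deriv A z * B z - A z * deriv B z) * eW' z hz
  have const : ∀ {F G : ℂ → ℂ} {k : ℂ}, DifferentiableOn ℂ F V → DifferentiableOn ℂ G V →
      (∀ z ∈ V, F z = k * conj (G z)) → ∀ z ∈ V, F z = F x := by
    intro F G k hF hG e z hz
    refine hVo.is_const_of_deriv_eq_zero hVc hF (fun w hw => ?_) hz hx
    have l1 := (HasWirtingerAt.const k).mul (wir hG w hw).conjugate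
    have l2 := HasFDerivAt.congr_of_eventuallyEq l1 (by
      filter_upwards [hVo.mem_nhds hw] with w hw using e w hw)
    have := ((wir hF w hw).unique l2).1
    simpa using this
  have n1 : κ * (‖p x‖ ^ 2 + ‖q x‖ ^ 2) = 1 := by
    apply Complex.ofReal_injective
    push_cast
    rw [← Complex.mul_conj', ← Complex.mul_conj']
    linear_combination edet x hx - p x * e2 x hx + q x * e4 x hx
  have hκ1 : κ = 1 := by
    have n2 : κ * (‖s x‖ ^ 2 + ‖r x‖ ^ 2) = 1 := by
      apply Complex.ofReal_injective
      push_cast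
      rw [← Complex.mul_conj', ← Complex.mul_conj']
      linear_combination edet x hx - s x * e1 x hx + r x * e3 x hx
    rw [e2 x hx, e4 x hx] at n2
    simp only [norm_neg, norm_mul, RCLike.norm_conj, Complex.norm_real, mul_pow, Real.norm_eq_abs,
      sq_abs] at n2
    have : κ ^ 2 = 1 := by linear_combination n2 - κ ^ 2 * n1
    nlinarith
  refine ⟨hκ1, p x, q x, by rw [← n1, hκ1, one_mul], fun z hz => ?_⟩
  have hp' : p z = p x := const dp ds e1 z hz
  have hq' : q z = q x :=
    const (k := -κ) dq dr (fun z hz => by rw [e3 z hz, neg_mul]) z hz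
  have f2 := e2 z hz
  have f4 := e4 z hz
  have h1 := hW0 z hz
  rw [hκ1, Complex.ofReal_one, one_mul] at f2 f4
  rw [← hp', ← hq', ← f2, ← neg_eq_iff_eq_neg.mpr f4]
  simp only [hp, hq, hr, hs]
  constructor
  · field_simp
    linear_combination P z * eW z
  · field_simp
    linear_combination Q z * eW z

end MeanField

end

noncomputable section
namespace MeanField

open Filter Topology ComplexConjugate MeasureTheory Metric

/-! ### The developing maps of the solution -/

/-- A holomorphic function without zeros at a point has a holomorphic square root nearby. -/
lemma exists_sqrt_near {k : ℂ → ℂ} {x : ℂ} (hk : AnalyticAt ℂ k x) (h0 : k x ≠ 0) :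
    ∃ m : ℂ → ℂ, AnalyticAt ℂ m x ∧ ∀ᶠ z in 𝓝 x, m z ^ 2 = k z := by
  have hq : AnalyticAt ℂ (fun z => k z / k x) x := hk.div_const
  have h1 : k x / k x ∈ Complex.slitPlane := by rw [div_self h0]; exact Complex.one_mem_slitPlane
  refine ⟨fun z => Complex.exp ((Complex.log (k x) + Complex.log (k z / k x)) / 2),
    ((analyticAt_const.add (hq.clog h1)).div_const).cexp, ?_⟩
  filter_upwards [hk.continuousAt.eventually_ne h0] with z hz
  rw [← Complex.exp_nat_mul, Nat.cast_ofNat, mul_div_cancel₀ _ two_ne_zero, Complex.exp_add,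
    Complex.exp_log h0, Complex.exp_log (div_ne_zero hz h0), mul_div_cancel₀ _ h0]

lemma exists_ball_of_eventually {p : ℂ → Prop} {x : ℂ} (h : ∀ᶠ z in 𝓝 x, p z) :
    ∃ ε > 0, ∀ z ∈ ball x ε, p z := by
  obtain ⟨ε, hε, h⟩ := Metric.eventually_nhds_iff_ball.mp h
  exact ⟨ε, hε, h⟩

namespace IsDevelopingPair

variable {L : PeriodPair} {A B : ℂ → ℂ} (h : IsDevelopingPair L A B)
include h

lemma A_zero_mul_B_zero_ne_zero : A 0 * B 0 ≠ 0 := fun h0 => by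
  have := (h.zeros 0).mp h0
  rw [zero_add] at this
  exact L.ω₁_div_two_notMem_lattice this

lemma A_mul_B_ω₂_ne_zero : A L.ω₂ * B L.ω₂ ≠ 0 := fun h0 => by
  have := sub_mem ((h.zeros _).mp h0) L.ω₂_mem_lattice
  rw [add_sub_cancel_left] at this
  exact L.ω₁_div_two_notMem_lattice this

lemma eventually_regular : ∀ᶠ z in codiscrete ℂ, A z * B z ≠ 0 :=
  eventually_codiscrete_ne_zero (h.diffA.mul h.diffB) h.A_zero_mul_B_zero_ne_zero

lemma eventually_wronskian_ne_zero : ∀ᶠ z in codiscrete ℂ, wronskian A B z ≠ 0 :=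
  eventually_codiscrete_ne_zero h.differentiable_wronskian
    ((h.wronskian_eq_zero _).not.mpr L.ω₁_div_two_notMem_lattice)

lemma meromorphicNFOn : MeromorphicNFOn (fun z => A z / B z) Set.univ :=
  meromorphicNFOn_div h.diffA h.diffB h.disjoint

lemma div_add_ω₁ (z : ℂ) : A (z + L.ω₁) / B (z + L.ω₁) = -(A z / B z) := by
  have e := h.add_ω₁ z
  by_cases h1 : B z = 0
  · have hA : A z ≠ 0 := fun h0 => h.disjoint z h0 h1
    rw [h1, mul_zero, zero_eq_neg, mul_eq_zero, or_iff_right hA] at e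
    rw [h1, e, div_zero, div_zero, neg_zero]
  · have h2 : B (z + L.ω₁) ≠ 0 := fun h2 => by
      rw [h2, mul_zero, neg_zero, mul_eq_zero, or_iff_left h1] at e
      exact h.disjoint _ e h2
    rw [← neg_div, div_eq_div_iff h2 h1, e, neg_mul]

lemma div_add_ω₂ (z : ℂ) : A (z + L.ω₂) / B (z + L.ω₂) = B z / A z := by
  have e := h.add_ω₂ z
  by_cases h1 : A z = 0
  · have hB := h.disjoint z h1
    rw [h1, mul_zero, eq_comm, mul_eq_zero, or_iff_left hB] at e
    rw [h1, e, div_zero, div_zero]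
  · have h2 : B (z + L.ω₂) ≠ 0 := fun h2 => by
      rw [h2, zero_mul, mul_eq_zero, or_iff_left h1] at e
      exact h.disjoint _ e h2
    rw [div_eq_div_iff h2 h1, e, mul_comm]

lemma div_zero_mul_div_ω₂ : A 0 / B 0 * (A L.ω₂ / B L.ω₂) = 1 := by
  have e := h.add_ω₂ 0
  rw [zero_add] at e
  have h1 := right_ne_zero_of_mul h.A_zero_mul_B_zero_ne_zero
  have h2 := right_ne_zero_of_mul h.A_mul_B_ω₂_ne_zero
  field_simp
  linear_combination e

lemma logDeriv_div {z : ℂ} (hz : A z * B z ≠ 0) :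
    logDeriv (fun z => A z / B z) z = wronskian A B z / (A z * B z) := by
  have h1 := left_ne_zero_of_mul hz
  have h2 := right_ne_zero_of_mul hz
  rw [logDeriv_apply, deriv_div_eq_wronskian h.diffA h.diffB h2]
  field_simp

variable (hg : ∀ z, wronskian A B z = sigmaQuotient L z * (A z * B z) ∨ A z * B z = 0)

section Sigma

include hg

omit h in
lemma sigmaQuotient_eq {z : ℂ} (hz : A z * B z ≠ 0) :
    sigmaQuotient L z = wronskian A B z / (A z * B z) := by
  rw [(hg z).resolve_right hz, mul_div_cancel_right₀ _ hz]

lemma isSigmaMap_const_mul {k : ℂ} (hk : ‖k‖ = 1) :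
    IsSigmaMap L fun z => k * (A z / B z) where
  meromorphic := by
    have hk0 : k ≠ 0 := norm_ne_zero_iff.mp (by rw [hk]; exact one_ne_zero)
    exact (meromorphicNFOn_mul_iff_right_of_analyticOnNhd (g := fun _ => k)
      analyticOnNhd_const fun _ _ => hk0).mpr h.meromorphicNFOn
  logDeriv_eq := by
    have hk0 : k ≠ 0 := norm_ne_zero_iff.mp (by rw [hk]; exact one_ne_zero)
    filter_upwards [h.eventually_regular] with z hz
    rw [logDeriv_const_mul z k hk0, h.logDeriv_div hz, sigmaQuotient_eq hg hz]
  norm_eq := by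
    have e : k * (A 0 / B 0) * (k * (A L.ω₂ / B L.ω₂)) =
        k * k * (A 0 / B 0 * (A L.ω₂ / B L.ω₂)) := by ring
    rw [e, h.div_zero_mul_div_ω₂, mul_one, norm_mul, hk, mul_one]

lemma isSigmaMap_iff (F : ℂ → ℂ) :
    IsSigmaMap L F ↔ ∃ k : ℂ, ‖k‖ = 1 ∧ ∀ z, F z = k * (A z / B z) := by
  constructor
  swap
  · rintro ⟨k, hk, e⟩
    rw [funext e]
    exact h.isSigmaMap_const_mul hg hk
  intro hF
  have hFm := hF.meromorphic.meromorphicOn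
  have hFa : ∀ᶠ z in codiscrete ℂ, AnalyticAt ℂ F z := hFm.analyticAt_mem_codiscreteWithin
  have good : ∀ᶠ z in codiscrete ℂ, (A z * B z ≠ 0 ∧ wronskian A B z ≠ 0) ∧
      AnalyticAt ℂ F z ∧ logDeriv F z = sigmaQuotient L z :=
    (h.eventually_regular.and h.eventually_wronskian_ne_zero).and
      (hFa.and hF.logDeriv_eq)
  obtain ⟨x, hx⟩ := nonempty_of_mem_codiscrete good
  obtain ⟨ε, hε, hb⟩ := exists_ball_of_eventually ((mem_codiscrete'.mp good).1.mem_nhds hx)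
  have hxb : x ∈ ball x ε := mem_ball_self hε
  obtain ⟨k, hk⟩ := exists_eq_const_mul_of_deriv_mul_eq isOpen_ball
    (convex_ball x ε).isPreconnected (F := F) (G := fun z => A z / B z)
    (fun z hz => (hb z hz).2.1.differentiableAt.differentiableWithinAt)
    (fun z hz => ((h.diffA z).div (h.diffB z)
      (right_ne_zero_of_mul (hb z hz).1.1)).differentiableWithinAt)
    (fun z hz => div_ne_zero (left_ne_zero_of_mul (hb z hz).1.1)
      (right_ne_zero_of_mul (hb z hz).1.1))
    (fun z hz => by
      obtain ⟨⟨h1, h2⟩, -, h3⟩ := hb z hz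
      have hA := left_ne_zero_of_mul h1
      have hB := right_ne_zero_of_mul h1
      rw [sigmaQuotient_eq hg h1, logDeriv_apply] at h3
      have hF0 : F z ≠ 0 := fun h0 => by
        rw [h0, div_zero, eq_comm, div_eq_zero_iff] at h3
        tauto
      rw [div_eq_iff hF0] at h3
      rw [h3, deriv_div_eq_wronskian h.diffA h.diffB hB]
      field_simp)
  have hcod : F =ᶠ[codiscrete ℂ] fun z => k * (A z / B z) := by
    have := eventually_codiscrete_eq_zero (D := fun z => F z - k * (A z / B z)) (z₀ := x)
      (hFm.sub ((MeromorphicOn.const k).mul h.meromorphicNFOn.meromorphicOn)) (by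
        filter_upwards [isOpen_ball.mem_nhds hxb] with z hz
        rw [hk z hz, sub_self])
    filter_upwards [this] with z hz using sub_eq_zero.mp hz
  have hk0 : k ≠ 0 := by
    rintro rfl
    obtain ⟨⟨h1, h2⟩, -, h3⟩ := hb x hxb
    have : F =ᶠ[𝓝 x] fun _ => 0 := by
      filter_upwards [isOpen_ball.mem_nhds hxb] with z hz
      rw [hk z hz, zero_mul]
    rw [sigmaQuotient_eq hg h1, logDeriv_apply, this.deriv_eq, deriv_const, zero_div, eq_comm,
      div_eq_zero_iff] at h3
    tauto
  have hall : F = fun z => k * (A z / B z) := eq_of_eventuallyEq_codiscrete hF.meromorphic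
    ((meromorphicNFOn_mul_iff_right_of_analyticOnNhd (g := fun _ => k)
      analyticOnNhd_const fun _ _ => hk0).mpr h.meromorphicNFOn) hcod
  refine ⟨k, ?_, congrFun hall⟩
  have hn := hF.norm_eq
  have e : F 0 * F L.ω₂ = k * k * (A 0 / B 0 * (A L.ω₂ / B L.ω₂)) := by rw [hall]; ring
  rw [e, h.div_zero_mul_div_ω₂, mul_one, norm_mul] at hn
  nlinarith [norm_nonneg k]

end Sigma

lemma exp_log_conformalFactor {z : ℂ} (hz : z ∉ L.lattice) :
    Real.exp (Real.log (conformalFactor A B z)) = Real.exp (Real.log (2 / Real.pi)) *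
      (‖wronskian A B z‖ ^ 2 / pairNorm A B z ^ 2) := by
  rw [Real.exp_log (h.conformalFactor_pos hz), Real.exp_log (by positivity), conformalFactor]

lemma isDevelopingMap_const_mul {k : ℂ} (hk : ‖k‖ = 1) :
    IsDevelopingMap L (Real.log (2 / Real.pi)) (fun z => Real.log (conformalFactor A B z))
      fun z => k * (A z / B z) := by
  have hk0 : k ≠ 0 := norm_ne_zero_iff.mp (by rw [hk]; exact one_ne_zero)
  have := isDevelopingMap_div (L := L) (P := fun z => k * A z) (Q := B)
    (h.diffA.const_mul k) h.diffB
    (fun z hz => h.disjoint z ((mul_eq_zero.mp hz).resolve_left hk0))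
    (right_ne_zero_of_mul h.A_zero_mul_B_zero_ne_zero) (c := Real.log (2 / Real.pi))
    (u := fun z => Real.log (conformalFactor A B z)) (fun z hz => by
      have e : wronskian (fun z => k * A z) B z = k * wronskian A B z := by
        rw [wronskian, wronskian, deriv_const_mul k (h.diffA z)]; ring
      rw [h.exp_log_conformalFactor hz, e, pairNorm, pairNorm, norm_mul, norm_mul, hk, one_mul,
        one_mul])
  simpa only [mul_div_assoc] using this

lemma isDevelopingMap_const_div {k : ℂ} (hk : ‖k‖ = 1) :
    IsDevelopingMap L (Real.log (2 / Real.pi)) (fun z => Real.log (conformalFactor A B z))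
      fun z => k / (A z / B z) := by
  have hk0 : k ≠ 0 := norm_ne_zero_iff.mp (by rw [hk]; exact one_ne_zero)
  have := isDevelopingMap_div (L := L) (P := fun z => k * B z) (Q := A)
    (h.diffB.const_mul k) h.diffA
    (fun z hz hA => h.disjoint z hA ((mul_eq_zero.mp hz).resolve_left hk0))
    (left_ne_zero_of_mul h.A_zero_mul_B_zero_ne_zero) (c := Real.log (2 / Real.pi))
    (u := fun z => Real.log (conformalFactor A B z)) (fun z hz => by
      have e : wronskian (fun z => k * B z) A z = -(k * wronskian A B z) := by
        rw [wronskian, wronskian, deriv_const_mul k (h.diffB z)]; ring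
      rw [h.exp_log_conformalFactor hz, e, pairNorm, pairNorm, norm_neg, norm_mul, norm_mul, hk,
        one_mul, one_mul, add_comm (‖A z‖ ^ 2)])
  simpa only [div_div_eq_mul_div] using this

/-- All developing maps of the solution are the unitary Möbius transforms of `A / B`. -/
lemma developingMap_eq {c : ℝ} {F : ℂ → ℂ}
    (hF : IsDevelopingMap L c (fun z => Real.log (conformalFactor A B z)) F) :
    c = Real.log (2 / Real.pi) ∧ ∃ p q : ℂ, ‖p‖ ^ 2 + ‖q‖ ^ 2 = 1 ∧
      F = fun z => (p * A z - conj q * B z) / (q * A z + conj p * B z) := by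
  have hFm := hF.meromorphic.meromorphicOn
  have good : ∀ᶠ z in codiscrete ℂ, (A z * B z ≠ 0 ∧ wronskian A B z ≠ 0) ∧ AnalyticAt ℂ F z :=
    (h.eventually_regular.and h.eventually_wronskian_ne_zero).and
      hFm.analyticAt_mem_codiscreteWithin
  obtain ⟨x, hx⟩ := nonempty_of_mem_codiscrete good
  have hgood : ∀ᶠ z in 𝓝 x, (A z * B z ≠ 0 ∧ wronskian A B z ≠ 0) ∧ AnalyticAt ℂ F z :=
    (mem_codiscrete'.mp good).1.mem_nhds hx
  set γ : ℝ := Real.exp c / (2 / Real.pi) with hγ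
  have hγ0 : 0 < γ := by positivity
  have hmetric : ∀ z, wronskian A B z ≠ 0 → AnalyticAt ℂ F z →
      γ * (‖deriv F z‖ ^ 2 / (1 + ‖F z‖ ^ 2) ^ 2) =
        ‖wronskian A B z‖ ^ 2 / pairNorm A B z ^ 2 := by
    intro z hz ha
    have hl : z ∉ L.lattice := (h.wronskian_eq_zero z).not.mp hz
    have e := hF.exp_eq z hl ha
    rw [h.exp_log_conformalFactor hl, Real.exp_log (by positivity)] at e
    rw [hγ, div_mul_eq_mul_div, ← e, mul_div_cancel_left₀ _ (by positivity)]
  have hF' : ∀ z, wronskian A B z ≠ 0 → AnalyticAt ℂ F z → deriv F z ≠ 0 := by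
    intro z hz ha h0
    have e := hmetric z hz ha
    have := (h.pairNorm_pos z).ne'
    have := norm_ne_zero_iff.mpr hz
    rw [h0, norm_zero, zero_pow two_ne_zero, zero_div, mul_zero, eq_comm, div_eq_zero_iff] at e
    simp_all
  obtain ⟨⟨hx1, hx2⟩, hxF⟩ := hx
  obtain ⟨m, hm, hm2⟩ := exists_sqrt_near
    (k := fun z => wronskian A B z / deriv F z)
    ((h.differentiable_wronskian.analyticAt x).div hxF.deriv (hF' x hx2 hxF))
    (div_ne_zero hx2 (hF' x hx2 hxF))
  obtain ⟨ε, hε, hb⟩ := exists_ball_of_eventually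
    (hgood.and (hm2.and hm.eventually_analyticAt))
  have hxb : x ∈ ball x ε := mem_ball_self hε
  -- `F = P / Q` with `P = F m`, `Q = m`, normalized to have the same Wronskian as `A`, `B`
  have dF : DifferentiableOn ℂ F (ball x ε) := fun z hz =>
    (hb z hz).1.2.differentiableAt.differentiableWithinAt
  have dm : DifferentiableOn ℂ m (ball x ε) := fun z hz =>
    (hb z hz).2.2.differentiableAt.differentiableWithinAt
  have hmF : ∀ z ∈ ball x ε, m z ^ 2 * deriv F z = wronskian A B z := fun z hz => by
    rw [(hb z hz).2.1, div_mul_cancel₀ _ (hF' z (hb z hz).1.1.2 (hb z hz).1.2)]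
  obtain ⟨hκ, p, q, hpq, hPQ⟩ := exists_unitary_of_pairNorm_eq isOpen_ball
    (convex_ball x ε).isPreconnected hxb (A := A) (B := B) (P := fun z => F z * m z) (Q := m)
    (κ := Real.sqrt γ) h.diffA.differentiableOn h.diffB.differentiableOn (dF.mul dm) dm
    (fun z hz => (hb z hz).1.1.2)
    (fun z hz => by
      have := ((hb z hz).1.2.differentiableAt.hasDerivAt.mul
        (hb z hz).2.2.differentiableAt.hasDerivAt).deriv
      change deriv (fun z => F z * m z) z = _ at this
      rw [← hmF z hz, wronskian, this]
      ring)
    (Real.sqrt_pos.mpr hγ0)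
    (fun z hz => by
      obtain ⟨⟨⟨-, hW⟩, ha⟩, -, -⟩ := hb z hz
      have e := hmetric z hW ha
      have hD := norm_pos_iff.mpr (hF' z hW ha)
      have hT := h.pairNorm_pos z
      have hn : ‖m z‖ ^ 2 * ‖deriv F z‖ = ‖wronskian A B z‖ := by
        rw [← hmF z hz, norm_mul, norm_pow]
      have hF1 : 0 < 1 + ‖F z‖ ^ 2 := by positivity
      refine (sq_eq_sq₀ (by rw [pairNorm]; positivity) (by positivity)).mp ?_
      rw [mul_pow, Real.sq_sqrt hγ0.le, pairNorm, norm_mul]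
      rw [← hn] at e
      field_simp at e
      have hD2 : ‖deriv F z‖ ^ 2 ≠ 0 := by positivity
      linear_combination -e)
  have hc : c = Real.log (2 / Real.pi) := by
    have : γ = 1 := by
      rw [← Real.sq_sqrt hγ0.le, hκ, one_pow]
    rw [hγ, div_eq_one_iff_eq (by positivity)] at this
    rw [← this, Real.log_exp]
  refine ⟨hc, p, q, hpq, ?_⟩
  have hpq' : p * conj p + q * conj q = 1 := by
    rw [Complex.mul_conj', Complex.mul_conj']
    exact_mod_cast hpq
  have dP : Differentiable ℂ fun z => p * A z - conj q * B z :=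
    (h.diffA.const_mul _).sub (h.diffB.const_mul _)
  have dQ : Differentiable ℂ fun z => q * A z + conj p * B z :=
    (h.diffA.const_mul _).add (h.diffB.const_mul _)
  have hm0 : m x ≠ 0 := fun h0 => by
    have := hmF x hxb
    rw [h0, zero_pow two_ne_zero, zero_mul] at this
    exact hx2 this.symm
  have hQ0 : q * A x + conj p * B x ≠ 0 := by rw [← (hPQ x hxb).2]; exact hm0
  refine eq_of_eventuallyEq_codiscrete hF.meromorphic (meromorphicNFOn_div dP dQ
    fun z h1 h2 => ?_) ?_
  · have hA : A z = 0 := by linear_combination conj p * h1 + conj q * h2 - A z * hpq'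
    have hB : B z = 0 := by linear_combination -q * h1 + p * h2 - B z * hpq'
    exact h.disjoint z hA hB
  · have := eventually_codiscrete_eq_zero (z₀ := x)
      (D := fun z => F z * (q * A z + conj p * B z) - (p * A z - conj q * B z))
      ((hFm.mul fun z _ => (dQ.analyticAt z).meromorphicAt).sub
        fun z _ => (dP.analyticAt z).meromorphicAt) (by
        filter_upwards [isOpen_ball.mem_nhds hxb] with z hz
        rw [← (hPQ z hz).1, ← (hPQ z hz).2, sub_self])
    filter_upwards [this, eventually_codiscrete_ne_zero dQ hQ0] with z h1 h2
    rw [eq_div_iff h2]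
    exact sub_eq_zero.mp h1

/-- At the common point `- ω₁ / 2` of the zeros of `A B`, the relation `F (z + ω₁) = - F z`
forces the Möbius transformation to be diagonal or antidiagonal. -/
lemma mul_eq_zero_of_add_ω₁ {p q : ℂ} {F : ℂ → ℂ}
    (hF : F = fun z => (p * A z - conj q * B z) / (q * A z + conj p * B z))
    (h1 : ∀ z, F (z + L.ω₁) = -F z) : p = 0 ∨ q = 0 := by
  set z := -(L.ω₁ / 2) with hz
  have h0 : A z * B z = 0 := (h.zeros _).mpr (by simp [hz])
  have e := h1 z
  have e1 := h.add_ω₁ z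
  rw [hF] at e
  rcases mul_eq_zero.mp h0 with hA | hB
  · have hB := h.disjoint z hA
    rw [hA, zero_mul, neg_zero, mul_eq_zero, or_iff_left hB] at e1
    have hB' := h.disjoint _ e1
    simp only [hA, e1, mul_zero, zero_sub, zero_add, mul_div_mul_right _ _ hB,
      mul_div_mul_right _ _ hB', neg_div] at e
    have e2 : conj q / conj p = 0 := by linear_combination -e / 2
    simp only [div_eq_zero_iff, map_eq_zero] at e2
    tauto
  · have hA : A z ≠ 0 := fun hA => h.disjoint z hA hB
    rw [hB, mul_zero, zero_eq_neg, mul_eq_zero, or_iff_right hA] at e1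
    have hA' : A (z + L.ω₁) ≠ 0 := fun hA => h.disjoint _ hA e1
    simp only [hB, e1, mul_zero, sub_zero, add_zero, mul_div_mul_right _ _ hA,
      mul_div_mul_right _ _ hA'] at e
    have e2 : p / q = 0 := by linear_combination e / 2
    simpa only [div_eq_zero_iff] using e2

lemma normalMonodromy_iff (F : ℂ → ℂ) :
    (IsDevelopingMap L (Real.log (2 / Real.pi)) (fun z => Real.log (conformalFactor A B z)) F ∧
      HasNormalMonodromy L F) ↔
    ∃ k : ℂ, ‖k‖ = 1 ∧ ((∀ z, F z = k * (A z / B z)) ∨ ∀ z, F z = k / (A z / B z)) := by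
  constructor
  · rintro ⟨hF, h1, -⟩
    obtain ⟨-, p, q, hpq, rfl⟩ := h.developingMap_eq hF
    rcases h.mul_eq_zero_of_add_ω₁ rfl h1 with rfl | rfl
    · have hq : ‖q‖ = 1 := by
        rw [norm_zero] at hpq
        nlinarith [norm_nonneg q]
      have hq0 : q ≠ 0 := norm_ne_zero_iff.mp (by rw [hq]; exact one_ne_zero)
      refine ⟨-(conj q / q), ?_, Or.inr fun z => ?_⟩
      · rw [norm_neg, norm_div, RCLike.norm_conj, hq, div_one]
      simp only [map_zero, zero_mul, zero_sub, add_zero]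
      rw [div_div_eq_mul_div, ← neg_mul, mul_div_mul_comm, neg_div, mul_div_assoc]
    · have hp : ‖p‖ = 1 := by
        rw [norm_zero] at hpq
        nlinarith [norm_nonneg p]
      refine ⟨p / conj p, ?_, Or.inl fun z => ?_⟩
      · rw [norm_div, RCLike.norm_conj, hp, div_one]
      simp only [map_zero, zero_mul, sub_zero, zero_add]
      rw [mul_div_mul_comm]
  · rintro ⟨k, hk, e⟩
    have hk0 : k ≠ 0 := norm_ne_zero_iff.mp (by rw [hk]; exact one_ne_zero)
    have hkk : ‖k * k‖ = 1 := by rw [norm_mul, hk, mul_one]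
    rcases e with e | e <;> obtain rfl := funext e
    · refine ⟨h.isDevelopingMap_const_mul hk, fun z => ?_, k * k, hkk, fun z => ?_⟩
      · simp only [h.div_add_ω₁, mul_neg]
      · simp only [h.div_add_ω₂]
        rw [mul_div_mul_left _ _ hk0, div_div_eq_mul_div, mul_div_assoc]
    · refine ⟨h.isDevelopingMap_const_div hk, fun z => ?_, k * k, hkk, fun z => ?_⟩
      · simp only [h.div_add_ω₁, div_neg]
      · simp only [h.div_add_ω₂, div_div_eq_mul_div]
        rw [mul_assoc, mul_div_mul_left _ _ hk0]

end IsDevelopingPair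

end MeanField

end

theorem mainTheorem9 (L : PeriodPair) :
    ∃ u : ℂ → ℝ,
      -- `u` is a solution, smooth away from the singular point
      MeanField.IsSolution L (4 * Real.pi) u ∧
      ContDiffOn ℝ ∞ u ((L.lattice : Set ℂ)ᶜ) ∧
      -- it is the only solution, and it is even
      (∀ v : ℂ → ℝ, MeanField.IsSolution L (4 * Real.pi) v →
        v =ᵐ[MeasureTheory.volume] u) ∧
      (∀ z, u (-z) = u z) ∧
      -- the explicit developing map
      ∃ f : ℂ → ℂ,
        MeanField.IsSigmaMap L f ∧
        (∀ h : ℂ → ℂ, MeanField.IsSigmaMap L h ↔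
          ∃ k : ℂ, ‖k‖ = 1 ∧ ∀ z, h z = k * f z) ∧
        MeanField.IsDevelopingMap L (Real.log (2 / Real.pi)) u f ∧
        (∀ z, f (z + L.ω₁) = -f z) ∧
        (∀ z, f (z + L.ω₂) = f 0 * f L.ω₂ / f z) ∧
        -- all developing maps of `u`
        (∀ (c : ℝ) (F : ℂ → ℂ), MeanField.IsDevelopingMap L c u F →
          c = Real.log (2 / Real.pi) ∧
          ∃ p q : ℂ, ‖p‖ ^ 2 + ‖q‖ ^ 2 = 1 ∧
            F =ᶠ[Filter.codiscrete ℂ]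
              fun z => (p * f z - (starRingEnd ℂ) q) / (q * f z + (starRingEnd ℂ) p)) ∧
        -- the developing maps of `u` with normalized monodromy
        (∀ F : ℂ → ℂ,
          (MeanField.IsDevelopingMap L (Real.log (2 / Real.pi)) u F ∧
              MeanField.HasNormalMonodromy L F) ↔
            ∃ k : ℂ, ‖k‖ = 1 ∧ ((∀ z, F z = k * f z) ∨ ∀ z, F z = k / f z)) := by
  obtain ⟨A, B, h, hg⟩ := MeanField.exists_isDevelopingPair L
  refine ⟨fun z => Real.log (MeanField.conformalFactor A B z), h.isSolution_log_conformalFactor,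
    h.contDiffOn_log_conformalFactor, fun v hv => h.ae_eq_of_isSolution hv,
    fun z => congrArg Real.log (h.conformalFactor_neg z), fun z => A z / B z,
    (h.isSigmaMap_iff hg _).mpr ⟨1, norm_one, fun z => (one_mul _).symm⟩, h.isSigmaMap_iff hg,
    ?_, h.div_add_ω₁, fun z => ?_, fun c F hF => ?_, h.normalMonodromy_iff⟩
  · simpa only [one_mul] using h.isDevelopingMap_const_mul norm_one
  · simp only [h.div_add_ω₂, h.div_zero_mul_div_ω₂, one_div_div]
  · obtain ⟨hc, p, q, hpq, hF⟩ := h.developingMap_eq hF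
    refine ⟨hc, p, q, hpq, ?_⟩
    filter_upwards [h.eventually_regular] with z hz
    have hB := right_ne_zero_of_mul hz
    have e1 : p * (A z / B z) - starRingEnd ℂ q =
        (p * A z - starRingEnd ℂ q * B z) / B z := by field_simp
    have e2 : q * (A z / B z) + starRingEnd ℂ p =
        (q * A z + starRingEnd ℂ p * B z) / B z := by field_simp
    rw [hF, e1, e2, div_div_div_cancel_right₀ hB]
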